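/- **Setting.** Let $N\ge 0$, let $\mathfrak g$ be a finite-dimensional complex Lie algebra with basis $J^a$, let $\delta^{ab}$ be the matrix of a symmetric invariant bilinear form on $\mathfrak g$, and let $\delta^a=\ell(J^a)$ for a linear functional $\ell$ vanishing on $[\mathfrak g,\mathfrak g]$. Functions on the circle are trigonometric polynomials; vector fields $\xi=\xi^\mu(x)\partial_\mu$ and maps $X=X_a(x)J^a$ on $N$-dimensional space have polynomial components. Put $[\xi,\eta]^\nu=\xi^\mu\partial_\mu\eta^\nu-\eta^\mu\partial_\mu\xi^\nu$, $(\xi X)_a=\xi^\mu\partial_\mu X_a$, $[X,Y]=X_aY_b[J^a,J^b]$, $[f,g]=f\dot g-g\dot f$. A field on a complex vector space $V$ is $a(t)=\sum_{n\in\mathbb Z}a_ne^{int}$ with $a_n\in\mathrm{End}(V)$ such that each $v\in V$ is killed by $a_n$ for all large $n$; all integrals are over one period. Repeated Greek indices and repeated $\mathfrak g$-indices are summed. Operators $\mathcal L_\xi,\mathcal J_X,L_f$ on $V$, linear in $\xi,X,f$, and fields $q^\mu(t)$, $\mu=1,\dots,N$, are said to satisfy the algebra $DGRO(N,\mathfrak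 g)$ with abelian charges $c_1,\dots,c_8$ if $$[\mathcal L_\xi,\mathcal L_\eta]=\mathcal L_{[\xi,\eta]}+\tfrac1{2\pi i}\int dt\,\dot q^\rho\{c_1\,\partial_\rho\partial_\nu\xi^\mu(q)\,\partial_\mu\eta^\nu(q)+c_2\,\partial_\rho\partial_\mu\xi^\mu(q)\,\partial_\nu\eta^\nu(q)\},$$ $$[\mathcal L_\xi,\mathcal J_X]=\mathcal J_{\xi X}-\tfrac{c_7}{2\pi i}\delta^a\int dt\,\dot q^\rho X_a(q)\,\partial_\rho\partial_\mu\xi^\mu(q),$$ $$[\mathcal J_X,\mathcal J_Y]=\mathcal J_{[X,Y]}-\tfrac1{2\pi i}(c_5\delta^{ab}+c_8\delta^a\delta^b)\int dt\,\dot q^\rho\,\partial_\rho X_a(q)\,Y_b(q),$$ $$[L_f,\mathcal L_\xi]=\tfrac{c_3}{4\pi i}\int dt\,(\ddot f-i\dot f)\,\partial_\mu\xi^\mu(q),\qquad [L_f,\mathcal J_X]=\tfrac{c_6}{4\pi i}\delta^a\int dt\,(\ddot f-i\dot f)\,X_a(q),$$ $$[L_f,L_g]=L_{[f,g]}+\tfrac{c_4}{24\pi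 i}\int dt\,(\ddot f\dot g-\dot fg),$$ $$[\mathcal L_\xi,q^\mu(t)]=\xi^\mu(q(t)),\quad [L_f,q^\mu(t)]=-f(t)\dot q^\mu(t),\quad [\mathcal J_X,q^\mu(t)]=[q^\mu(s),q^\nu(t)]=0.$$ **Currents.** Let $U$ be the universal enveloping algebra of $\mathfrak g\oplus gl(N)$, where $gl(N)$ has the basis $T^\mu_\nu$ of matrix units, $[T^\mu_\nu,T^\rho_\sigma]=\delta^\rho_\nu T^\mu_\sigma-\delta^\mu_\sigma T^\rho_\nu$. Let $0\le r\le p$. On $V$ let there be fields $q^\mu(t),p_\mu(t)$ with $[p_\mu(s),q^\nu(t)]=\delta^\nu_\mu\delta(s-t)$ and all other brackets among them zero, and, for $i=0,\dots,r$, fields $F_{(i)}(t)$ and $I^{\mathbf mA}_{(i)\mathbf n}(t)$, linear in $A\in U$, where $\mathbf m,\mathbf n\in\mathbb N^N$ have length $|\mathbf m|,|\mathbf n|\le p-i$ (otherwise $I^{\mathbf mA}_{(i)\mathbf n}=0$). The currents commute with all $q^\mu,p_\mu$, currents with different labels $i$ commute, and $$[I^{\mathbf mA}_{(i)\mathbf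 n}(s),I^{\mathbf rB}_{(i)\mathbf s}(t)]=\big(\delta^{\mathbf r}_{\mathbf n}I^{\mathbf m,AB}_{(i)\mathbf s}(s)-\delta^{\mathbf m}_{\mathbf s}I^{\mathbf r,BA}_{(i)\mathbf n}(s)\big)\delta(s-t)+\tfrac{k_{(i)}(A,B)}{2\pi i}\delta^{\mathbf r}_{\mathbf n}\delta^{\mathbf m}_{\mathbf s}\,\dot\delta(s-t),$$ $$[F_{(i)}(s),F_{(i)}(t)]=(F_{(i)}(s)+F_{(i)}(t))\dot\delta(s-t)+\tfrac{c^{(i)}}{24\pi i}\tbinom{N+p-i}{N}(\dddot\delta(s-t)+\dot\delta(s-t)),$$ $$[F_{(i)}(s),I^{\mathbf mA}_{(i)\mathbf n}(t)]=I^{\mathbf mA}_{(i)\mathbf n}(s)\dot\delta(s-t)+\tfrac{d_{(i)}(A)}{4\pi i}\delta^{\mathbf m}_{\mathbf n}(\ddot\delta(s-t)+i\dot\delta(s-t)).$$ Here $k_{(i)}$ is bilinear on $U$ with $k_{(i)}(A,B)=k_{(i)}(B,A)$, $k_{(i)}(AB,C)=k_{(i)}(BC,A)$, $d_{(i)}$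 is linear with $d_{(i)}(AB)=d_{(i)}(BA)$, and $$k_{(i)}(T^\mu_\nu,T^\rho_\sigma)=k_1^{(i)}\delta^\mu_\sigma\delta^\rho_\nu+k_2^{(i)}\delta^\mu_\nu\delta^\rho_\sigma,\quad k_{(i)}(T^\mu_\nu,1)=k_3^{(i)}\delta^\mu_\nu,\quad k_{(i)}(1,1)=k_4^{(i)},$$ $$k_{(i)}(J^a,J^b)=k_5^{(i)}\delta^{ab}+k_8^{(i)}\delta^a\delta^b,\quad k_{(i)}(J^a,1)=k_6^{(i)}\delta^a,\quad k_{(i)}(T^\mu_\nu,J^a)=k_7^{(i)}\delta^\mu_\nu\delta^a,$$ $$d_{(i)}(1)=d_0^{(i)},\quad d_{(i)}(T^\mu_\nu)=d_1^{(i)}\delta^\mu_\nu,\quad d_{(i)}(J^a)=d_2^{(i)}\delta^a,$$ with complex numbers $k_n^{(i)},d_n^{(i)},c^{(i)}$ that do not depend on $p$. Set $F=\sum_iF_{(i)}$, $I=\sum_iI_{(i)}$, $E^{\mathbf m}_{\mathbf n}=I^{\mathbf m,1}_{\mathbf n}$, $J^{\mathbf ma}_{\mathbf n}=I^{\mathbf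 m,J^a}_{\mathbf n}$, $T^{\mathbf m\mu}_{\mathbf n\nu}=I^{\mathbf m,T^\mu_\nu}_{\mathbf n}$. Sums over multi-indices run over length at most $p$, $\binom{\mathbf m}{\mathbf n}=\prod_\mu\binom{m_\mu}{n_\mu}$, $\mathbf n+\mu$ is $\mathbf n$ plus the $\mu$-th unit vector, and normal ordering $:\ :$ puts the modes $p_{\mu,n}$, $n<0$, to the left and $p_{\mu,n}$, $n\ge0$, to the right of functions of $q$. Define $P_\mu(t)=\sum_{\mathbf m}E^{\mathbf m}_{\mathbf m+\mu}(t)$ and $$\mathcal L_\xi=\int dt\Big\{:\!\xi^\mu(q)p_\mu\!:-\,\xi^\mu(q)P_\mu+\sum_{\mathbf m,\mathbf n}\tbinom{\mathbf m}{\mathbf n}\partial_{\mathbf m-\mathbf n}\xi^\mu(q)E^{\mathbf m}_{\mathbf n+\mu}+\sum_{\mathbf m,\mathbf n}\tbinom{\mathbf m}{\mathbf n}\partial_{\mathbf m-\mathbf n+\nu}\xi^\mu(q)T^{\mathbf m\nu}_{\mathbf n\mu}\Big\},$$ $$\mathcal J_X=\int dt\sum_{\mathbf m,\mathbf n}\tbinom{\mathbf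 m}{\mathbf n}\partial_{\mathbf m-\mathbf n}X_a(q)J^{\mathbf ma}_{\mathbf n},\qquad L_f=\int dt\,f(t)\{-:\!\dot q^\mu p_\mu\!:+F\}.$$ **Theorem.** Write $k_n=k_n^{(0)}$, $d_n=d_n^{(0)}$, $c=c^{(0)}$ and suppose that, for $0\le i\le r$ in the conditions containing a free $i$, $$k_1^{(i)}+\sum_{j=0}^{i-1}\sum_{\ell=0}^{j}k_4^{(\ell)}=(-1)^i\tbinom rik_1,\qquad k_2^{(i)}+\sum_{j=0}^{i-1}\Big(2k_3^{(j)}+\sum_{\ell=0}^{j-1}k_4^{(\ell)}\Big)=(-1)^i\tbinom rik_2,$$ $$\sum_{i=0}^r\Big(2k_3^{(i)}+\sum_{\ell=0}^{i-1}k_4^{(\ell)}\Big)=0,\quad \sum_{i=0}^rk_4^{(i)}=0,\quad \sum_{i=0}^{r-1}\sum_{j=0}^ik_4^{(j)}=0,\quad \sum_{i=0}^rk_6^{(i)}=0,\quad \sum_{i=0}^rd_0^{(i)}=0,$$ $$k_7^{(i)}+\sum_{j=0}^{i-1}k_6^{(j)}=(-1)^i\tbinom rik_7,\qquad d_1^{(i)}+\sum_{j=0}^{i-1}d_0^{(j)}=(-1)^i\tbinom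 rid_1,$$ $$k_5^{(i)}=(-1)^i\tbinom rik_5,\quad k_8^{(i)}=(-1)^i\tbinom rik_8,\quad d_2^{(i)}=(-1)^i\tbinom rid_2,\quad c^{(i)}=(-1)^i\tbinom ric.$$ Then for every $p\ge r$ the operators $\mathcal L_\xi,\mathcal J_X,L_f$ and $q^\mu(t)$ satisfy $DGRO(N,\mathfrak g)$ with the abelian charges $$c_1=1-k_1b,\ c_2=-k_2b,\ c_3=1+d_1b,\ c_4=2N+cb,\ c_5=k_5b,\ c_6=d_2b,\ c_7=k_7b,\ c_8=k_8b,\qquad b=\binom{N+p-r}{N-r},$$ where $b=0$ if $N<r$. Consequently: * if $N<r$, the contribution of the currents vanishes: $(c_1,\dots,c_8)=(1,0,1,2N,0,0,0,0)$; * if $N=r$, the charges are independent of $p$: $(c_1,\dots,c_8)=(1-k_1,-k_2,1+d_1,2N+c,k_5,d_2,k_7,k_8)$, and in general nonzero: the linear conditions on the parameters leave these eight numbers arbitrary; * if $N>r$, each charge whose constant ($k_1,k_2,d_1,c,k_5,d_2,k_7,k_8$ respectively) is nonzero diverges in absolute value as $p\to\infty$. -/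

import Mathlib

open scoped LaurentPolynomial BigOperators

noncomputable section

namespace DGRO

/-! ### Functions on the circle

A Laurent polynomial `f = ∑ fₙ Tⁿ` is the trigonometric polynomial `f(t) = ∑ fₙ exp (i n t)`. -/

/-- The `t`-derivative of a trigonometric polynomial: `T n = exp (i n t)` goes to `i n T n`. -/
def circDeriv (f : ℂ[T;T⁻¹]) : ℂ[T;T⁻¹] :=
  f.coeff.sum fun n c => LaurentPolynomial.C (Complex.I * n * c) * LaurentPolynomial.T n

/-- The integral of a trigonometric polynomial over a period. -/
def circInt (f : ℂ[T;T⁻¹]) : ℂ := 2 * Real.pi * f.coeff 0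

/-- The bracket of the vector fields `f d/dt` and `g d/dt`. -/
def circBracket (f g : ℂ[T;T⁻¹]) : ℂ[T;T⁻¹] := f * circDeriv g - g * circDeriv f

/-! ### Operator-valued fields on the circle -/

section Fields

variable (V : Type*) [AddCommGroup V] [Module ℂ V]

/-- An operator-valued field `a(t) = ∑ₙ aₙ exp (i n t)` is given by its modes `aₙ`. The modes of
high positive frequency are annihilating: every vector is killed by all `aₙ` with `n` large. -/
def RField : Submodule ℂ (ℤ → Module.End ℂ V) where
  carrier := {a | ∀ v : V, ∃ K : ℤ, ∀ n : ℤ, K < n → a n v = 0}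
  zero_mem' := fun _ => ⟨0, fun _ _ => rfl⟩
  add_mem' := by
    intro a b ha hb v
    obtain ⟨K, hK⟩ := ha v
    obtain ⟨M, hM⟩ := hb v
    refine ⟨max K M, fun n hn => ?_⟩
    have h1 := hK n (lt_of_le_of_lt (le_max_left _ _) hn)
    have h2 := hM n (lt_of_le_of_lt (le_max_right _ _) hn)
    simp [h1, h2]
  smul_mem' := by
    intro c a ha v
    obtain ⟨K, hK⟩ := ha v
    exact ⟨K, fun n hn => by simp [hK n hn]⟩

variable {V}

/-- The mode `aₙ` of a field. -/
def mode (a : RField V) (n : ℤ) : Module.End ℂ V := a.1 n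

/-- `∫ f(t) a(t) dt`. -/
def smear (f : ℂ[T;T⁻¹]) (a : RField V) : Module.End ℂ V :=
  f.coeff.sum fun n c => (2 * Real.pi * c : ℂ) • mode a (-n)

/-- `∫ a(t) dt`. -/
def fieldInt (a : RField V) : Module.End ℂ V := (2 * Real.pi : ℂ) • mode a 0

/-- The identity operator as a constant field. -/
def oneField : RField V :=
  ⟨fun n => if n = 0 then 1 else 0, fun _ => ⟨0, fun n hn => by simp [hn.ne']⟩⟩

/-- The time derivative of a field. -/
def fieldDeriv (a : RField V) : RField V :=
  ⟨fun n => (Complex.I * n) • mode a n, fun v => by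
    obtain ⟨K, hK⟩ := a.2 v
    exact ⟨K, fun n hn => by simp [mode, hK n hn]⟩⟩

/-- The `k`-th summand of the `n`-th mode of the normal ordered product `:a(t) b(t):`, in which the
modes `aₖ` with `k < 0` stand to the left of `b` and the modes `aₖ` with `k ≥ 0` to its right. -/
def normalTerm (a b : RField V) (n k : ℤ) : Module.End ℂ V :=
  if k < 0 then mode a k * mode b (n - k) else mode b (n - k) * mode a k

theorem normalTerm_finite (a b : RField V) (n : ℤ) (v : V) :
    (Function.support fun k : ℤ => normalTerm a b n k v).Finite := by
  obtain ⟨K, hK⟩ := a.2 v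
  obtain ⟨M, hM⟩ := b.2 v
  refine (Set.finite_Icc (min (n - M) 0) (max K 0)).subset ?_
  intro k hk
  rw [Function.mem_support] at hk
  by_contra hcon
  rw [Set.mem_Icc, not_and_or, not_le, not_le] at hcon
  apply hk
  unfold normalTerm mode
  by_cases h0 : k < 0
  · simp [h0, hM (n - k) (by omega)]
  · simp [h0, hK k (by omega)]

/-- The normal ordered product `:a(t) b(t):`. When the modes of `a` commute with those of `b`
this is the ordinary product `a(t) b(t)`. -/
def normalProd (a b : RField V) : RField V :=
  ⟨fun n =>
    { toFun := fun v => ∑ᶠ k : ℤ, normalTerm a b n k v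
      map_add' := fun v w => by
        simp only [map_add]
        exact finsum_add_distrib (normalTerm_finite a b n v) (normalTerm_finite a b n w)
      map_smul' := fun c v => by
        simp only [map_smul, RingHom.id_apply]
        exact (smul_finsum' c (normalTerm_finite a b n v)).symm },
    fun v => by
      obtain ⟨K, hK⟩ := a.2 v
      obtain ⟨M, hM⟩ := b.2 v
      choose L hL using fun k : ℤ => b.2 (mode a k v)
      obtain ⟨S, hS⟩ := ((Set.finite_Icc (0 : ℤ) K).image fun k => L k + k).bddAbove
      refine ⟨max M S, fun n hn => ?_⟩
      change ∑ᶠ k : ℤ, normalTerm a b n k v = 0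
      refine finsum_eq_zero_of_forall_eq_zero fun k => ?_
      by_cases h0 : k < 0
      · simp [normalTerm, mode, h0, hM (n - k) (by omega)]
      · by_cases h1 : K < k
        · simp [normalTerm, mode, h0, hK k h1]
        · have h2 : L k + k ≤ S := hS ⟨k, ⟨by omega, by omega⟩, rfl⟩
          have h3 := hL k (n - k) (by omega)
          rw [normalTerm, if_neg h0]
          exact h3⟩

/-- The monomial `∏_μ q^μ(t) ^ s μ` in fields `q^μ(t)`. -/
def fieldMonomial {N : ℕ} (q : Fin N → RField V) (s : Fin N →₀ ℕ) : RField V :=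
  (List.finRange N).foldr (fun μ acc => (normalProd (q μ))^[s μ] acc) oneField

/-- The field `f(q(t))` for a polynomial function `f` of the space-time coordinates. -/
def onTrajectory {N : ℕ} (q : Fin N → RField V) (f : MvPolynomial (Fin N) ℂ) : RField V :=
  ∑ s ∈ f.support, f.coeff s • fieldMonomial q s

end Fields

/-! ### Multi-indices, vector fields, maps into a Lie algebra -/

/-- The multi-indices of length at most `p`. -/
def jets (N p : ℕ) : Finset (Fin N → ℕ) :=
  (Fintype.piFinset fun _ => Finset.range (p + 1)).filter fun m => ∑ μ, m μ ≤ p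

/-- The multi-dimensional binomial coefficient. -/
def multiChoose {N : ℕ} (m n : Fin N → ℕ) : ℕ := ∏ μ, (m μ).choose (n μ)

/-- The partial derivative of order `m`. -/
def multiDeriv {N : ℕ} (m : Fin N → ℕ) (f : MvPolynomial (Fin N) ℂ) : MvPolynomial (Fin N) ℂ :=
  (List.finRange N).foldr (fun μ g => (MvPolynomial.pderiv μ)^[m μ] g) f

/-- A polynomial vector field `ξ^μ(x) ∂_μ`. -/
abbrev VecField (N : ℕ) := Fin N → MvPolynomial (Fin N) ℂ

/-- The commutator of vector fields. -/
def vecBracket {N : ℕ} (ξ η : VecField N) : VecField N := fun ν =>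
  ∑ μ, (ξ μ * MvPolynomial.pderiv μ (η ν) - η μ * MvPolynomial.pderiv μ (ξ ν))

/-- A polynomial map `X = X_a(x) J^a` into a Lie algebra with basis `J^a`, `a : ι`. -/
abbrev GaugeMap (N : ℕ) (ι : Type*) := ι → MvPolynomial (Fin N) ℂ

/-- The pointwise bracket of two maps into a Lie algebra. -/
def gaugeBracket {N : ℕ} {ι 𝔤 : Type*} [Fintype ι] [LieRing 𝔤] [LieAlgebra ℂ 𝔤]
    (J : Module.Basis ι ℂ 𝔤) (X Y : GaugeMap N ι) : GaugeMap N ι := fun c =>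
  ∑ a, ∑ b, (J.repr ⁅J a, J b⁆ c) • (X a * Y b)

/-- The action `ξ X = ξ^μ ∂_μ X_a J^a` of vector fields on maps into a Lie algebra. -/
def vecAct {N : ℕ} {ι : Type*} (ξ : VecField N) (X : GaugeMap N ι) : GaugeMap N ι := fun a =>
  ∑ μ, ξ μ * MvPolynomial.pderiv μ (X a)

/-! ### The relations of the DGRO algebra -/

/-- The abelian charges. -/
@[ext] structure AbelianCharges where
  (c₁ c₂ c₃ c₄ c₅ c₆ c₇ c₈ : ℂ)

/-- The operators `L ξ`, `J X`, `R f` and the modes of `q^μ(t)` satisfy the brackets of the DGRO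
algebra with abelian charges `c`. Here `B (J^a) (J^b)` is the metric `δ^{ab}` and
`l (J^a)` is the linear Casimir `δ^a`. The brackets with all other functionals of the trajectory
follow by Leibniz' rule, which commutators of operators obey. -/
structure IsRealization {N : ℕ} {ι 𝔤 V : Type*} [Fintype ι] [LieRing 𝔤] [LieAlgebra ℂ 𝔤]
    [AddCommGroup V] [Module ℂ V] (Jb : Module.Basis ι ℂ 𝔤) (B : LinearMap.BilinForm ℂ 𝔤)
    (l : 𝔤 →ₗ[ℂ] ℂ) (c : AbelianCharges) (q : Fin N → RField V)
    (L : VecField N → Module.End ℂ V) (J : GaugeMap N ι → Module.End ℂ V)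
    (R : ℂ[T;T⁻¹] → Module.End ℂ V) : Prop where
  linear_L : IsLinearMap ℂ L
  linear_J : IsLinearMap ℂ J
  linear_R : IsLinearMap ℂ R
  LL : ∀ ξ η : VecField N, ⁅L ξ, L η⁆ = L (vecBracket ξ η) +
    (1 / (2 * Real.pi * Complex.I) : ℂ) • fieldInt (∑ ρ, normalProd (fieldDeriv (q ρ))
      (onTrajectory q (∑ μ, ∑ ν,
        (c.c₁ • (MvPolynomial.pderiv ρ (MvPolynomial.pderiv ν (ξ μ)) *
            MvPolynomial.pderiv μ (η ν)) +
          c.c₂ • (MvPolynomial.pderiv ρ (MvPolynomial.pderiv μ (ξ μ)) *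
            MvPolynomial.pderiv ν (η ν))))))
  LJ : ∀ (ξ : VecField N) (X : GaugeMap N ι), ⁅L ξ, J X⁆ = J (vecAct ξ X) -
    (c.c₇ / (2 * Real.pi * Complex.I) : ℂ) • fieldInt (∑ ρ, normalProd (fieldDeriv (q ρ))
      (onTrajectory q (∑ a, ∑ μ,
        l (Jb a) • (X a * MvPolynomial.pderiv ρ (MvPolynomial.pderiv μ (ξ μ))))))
  JJ : ∀ X Y : GaugeMap N ι, ⁅J X, J Y⁆ = J (gaugeBracket Jb X Y) -
    (1 / (2 * Real.pi * Complex.I) : ℂ) • fieldInt (∑ ρ, normalProd (fieldDeriv (q ρ))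
      (onTrajectory q (∑ a, ∑ b,
        (c.c₅ * B (Jb a) (Jb b) + c.c₈ * (l (Jb a) * l (Jb b))) •
          (MvPolynomial.pderiv ρ (X a) * Y b))))
  RL : ∀ (f : ℂ[T;T⁻¹]) (ξ : VecField N), ⁅R f, L ξ⁆ =
    (c.c₃ / (4 * Real.pi * Complex.I) : ℂ) •
      smear (circDeriv (circDeriv f) - Complex.I • circDeriv f)
        (onTrajectory q (∑ μ, MvPolynomial.pderiv μ (ξ μ)))
  RJ : ∀ (f : ℂ[T;T⁻¹]) (X : GaugeMap N ι), ⁅R f, J X⁆ =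
    (c.c₆ / (4 * Real.pi * Complex.I) : ℂ) •
      smear (circDeriv (circDeriv f) - Complex.I • circDeriv f)
        (onTrajectory q (∑ a, l (Jb a) • X a))
  RR : ∀ f g : ℂ[T;T⁻¹], ⁅R f, R g⁆ = R (circBracket f g) +
    (c.c₄ / (24 * Real.pi * Complex.I) *
      circInt (circDeriv (circDeriv f) * circDeriv g - circDeriv f * g) : ℂ) •
        (1 : Module.End ℂ V)
  Lq : ∀ (ξ : VecField N) (μ : Fin N) (n : ℤ),
    ⁅L ξ, mode (q μ) n⁆ = mode (onTrajectory q (ξ μ)) n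
  Rq : ∀ (f g : ℂ[T;T⁻¹]) (μ : Fin N),
    ⁅R f, smear g (q μ)⁆ = -smear (f * g) (fieldDeriv (q μ))
  Jq : ∀ (X : GaugeMap N ι) (μ : Fin N) (n : ℤ), ⁅J X, mode (q μ) n⁆ = 0
  qq : ∀ (μ ν : Fin N) (m n : ℤ), ⁅mode (q μ) m, mode (q ν) n⁆ = 0

/-! ### Trajectory, Kac-Moody and Virasoro currents -/

section Env

attribute [local instance 100] LieRing.ofAssociativeRing

/-- The universal enveloping algebra of `𝔤 ⊕ gl(N)`. -/
abbrev UEnv (N : ℕ) (𝔤 : Type*) [LieRing 𝔤] [LieAlgebra ℂ 𝔤] :=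
  UniversalEnvelopingAlgebra ℂ (𝔤 × Matrix (Fin N) (Fin N) ℂ)

/-- An element of `𝔤` in the universal enveloping algebra. -/
def uJ (N : ℕ) {𝔤 : Type*} [LieRing 𝔤] [LieAlgebra ℂ 𝔤] (x : 𝔤) : UEnv N 𝔤 :=
  UniversalEnvelopingAlgebra.ι ℂ (x, (0 : Matrix (Fin N) (Fin N) ℂ))

/-- The generator `T^μ_ν` of `gl(N)` in the universal enveloping algebra; the matrix units satisfy
`[T^μ_ν, T^ρ_σ] = δ^ρ_ν T^μ_σ - δ^μ_σ T^ρ_ν`. -/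
def uT {N : ℕ} (𝔤 : Type*) [LieRing 𝔤] [LieAlgebra ℂ 𝔤] (μ ν : Fin N) : UEnv N 𝔤 :=
  UniversalEnvelopingAlgebra.ι ℂ ((0 : 𝔤), Matrix.single μ ν (1 : ℂ))

end Env

/-- The numbers that specify the central extensions of one summand. -/
structure CentralParams where
  (k₁ k₂ k₃ k₄ k₅ k₆ k₇ k₈ d₀ d₁ d₂ c : ℂ)

/-- A representation on `V` of the trajectory `q^μ(t)`, its momentum `p_μ(t)`, and of mutually
commuting systems of currents `I_{(i)}`, `F_{(i)}`, `i = 0, …, r`, which commute with the trajectory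
and its momentum. The `i`-th system represents the semidirect product of the Virasoro algebra and
the affine algebra `Û(𝔤 ⊕ gl(N), N, p - i)` of jet order `p - i`, with central parameters `P i`.
The current `cur i m n A` is `I^{m A}_n (t)`; it is set to zero if `m` or `n` is longer
than `p - i`. -/
structure CurrentSystem {ι 𝔤 : Type*} [LieRing 𝔤] [LieAlgebra ℂ 𝔤]
    (N r p : ℕ) (Jb : Module.Basis ι ℂ 𝔤) (B : LinearMap.BilinForm ℂ 𝔤) (l : 𝔤 →ₗ[ℂ] ℂ)
    (P : ℕ → CentralParams) (V : Type*) [AddCommGroup V] [Module ℂ V] where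
  /-- the trajectory -/
  q : Fin N → RField V
  /-- its momentum -/
  mom : Fin N → RField V
  /-- the Kac-Moody currents -/
  cur : Fin (r + 1) → (Fin N → ℕ) → (Fin N → ℕ) → UEnv N 𝔤 →ₗ[ℂ] RField V
  /-- the Virasoro currents -/
  vir : Fin (r + 1) → RField V
  /-- the central charge matrices `k^{AB}` -/
  k : Fin (r + 1) → UEnv N 𝔤 →ₗ[ℂ] UEnv N 𝔤 →ₗ[ℂ] ℂ
  /-- the central terms `d^A` in the brackets of Virasoro and Kac-Moody currents -/
  d : Fin (r + 1) → UEnv N 𝔤 →ₗ[ℂ] ℂ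
  cur_zero : ∀ (i : Fin (r + 1)) (m n : Fin N → ℕ),
    (m ∉ jets N (p - (i : ℕ)) ∨ n ∉ jets N (p - (i : ℕ))) → cur i m n = 0
  mom_q : ∀ μ ν f g, ⁅smear f (mom μ), smear g (q ν)⁆ =
    (if μ = ν then circInt (f * g) else 0) • (1 : Module.End ℂ V)
  q_q : ∀ μ ν m n, ⁅mode (q μ) m, mode (q ν) n⁆ = 0
  mom_mom : ∀ μ ν m n, ⁅mode (mom μ) m, mode (mom ν) n⁆ = 0
  cur_q : ∀ i m n A μ s t, ⁅mode (cur i m n A) s, mode (q μ) t⁆ = 0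
  cur_mom : ∀ i m n A μ s t, ⁅mode (cur i m n A) s, mode (mom μ) t⁆ = 0
  vir_q : ∀ i μ s t, ⁅mode (vir i) s, mode (q μ) t⁆ = 0
  vir_mom : ∀ i μ s t, ⁅mode (vir i) s, mode (mom μ) t⁆ = 0
  k_symm : ∀ i A A', k i A A' = k i A' A
  k_cyclic : ∀ i A A' A'', k i (A * A') A'' = k i (A' * A'') A
  d_comm : ∀ i A A', d i (A * A') = d i (A' * A)
  cur_cur : ∀ i : Fin (r + 1), ∀ m ∈ jets N (p - (i : ℕ)), ∀ n ∈ jets N (p - (i : ℕ)),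
    ∀ m' ∈ jets N (p - (i : ℕ)),
    ∀ n' ∈ jets N (p - (i : ℕ)), ∀ A A' f g,
    ⁅smear f (cur i m n A), smear g (cur i m' n' A')⁆ =
      (if m' = n then smear (f * g) (cur i m n' (A * A')) else 0) -
      (if m = n' then smear (f * g) (cur i m' n (A' * A)) else 0) +
      (if m' = n ∧ m = n' then
        k i A A' / (2 * Real.pi * Complex.I) * -circInt (circDeriv f * g) else 0) •
          (1 : Module.End ℂ V)
  vir_vir : ∀ (i : Fin (r + 1)) (f g : ℂ[T;T⁻¹]),
    ⁅smear f (vir i), smear g (vir i)⁆ = smear (circBracket f g) (vir i) +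
    ((P i).c * (N + (p - (i : ℕ))).choose N / (24 * Real.pi * Complex.I) *
      circInt (circDeriv (circDeriv f) * circDeriv g - circDeriv f * g)) •
        (1 : Module.End ℂ V)
  vir_cur : ∀ i : Fin (r + 1), ∀ m ∈ jets N (p - (i : ℕ)), ∀ n ∈ jets N (p - (i : ℕ)), ∀ A f g,
    ⁅smear f (vir i), smear g (cur i m n A)⁆ = smear (f * circDeriv g) (cur i m n A) +
      (if m = n then d i A / (4 * Real.pi * Complex.I) *
        circInt ((circDeriv (circDeriv f) - Complex.I • circDeriv f) * g) else 0) •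
          (1 : Module.End ℂ V)
  cur_cur_ne : ∀ i j, i ≠ j → ∀ m n m' n' A A' s t,
    ⁅mode (cur i m n A) s, mode (cur j m' n' A') t⁆ = 0
  vir_vir_ne : ∀ i j, i ≠ j → ∀ s t, ⁅mode (vir i) s, mode (vir j) t⁆ = 0
  vir_cur_ne : ∀ i j, i ≠ j → ∀ m n A s t, ⁅mode (vir i) s, mode (cur j m n A) t⁆ = 0
  k_TT : ∀ i μ ν ρ σ, k i (uT 𝔤 μ ν) (uT 𝔤 ρ σ) =
    (if μ = σ ∧ ρ = ν then (P i).k₁ else 0) + (if μ = ν ∧ ρ = σ then (P i).k₂ else 0)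
  k_T : ∀ i μ ν, k i (uT 𝔤 μ ν) 1 = if μ = ν then (P i).k₃ else 0
  k_one : ∀ i : Fin (r + 1), k i 1 1 = (P i).k₄
  k_JJ : ∀ i a b, k i (uJ N (Jb a)) (uJ N (Jb b)) =
    (P i).k₅ * B (Jb a) (Jb b) + (P i).k₈ * (l (Jb a) * l (Jb b))
  k_J : ∀ i a, k i (uJ N (Jb a)) 1 = (P i).k₆ * l (Jb a)
  k_TJ : ∀ i μ ν a, k i (uT 𝔤 μ ν) (uJ N (Jb a)) =
    if μ = ν then (P i).k₇ * l (Jb a) else 0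
  d_one : ∀ i : Fin (r + 1), d i 1 = (P i).d₀
  d_T : ∀ i μ ν, d i (uT 𝔤 μ ν) = if μ = ν then (P i).d₁ else 0
  d_J : ∀ i a, d i (uJ N (Jb a)) = (P i).d₂ * l (Jb a)

namespace CurrentSystem

variable {ι 𝔤 : Type*} [LieRing 𝔤] [LieAlgebra ℂ 𝔤] {N r p : ℕ} {Jb : Module.Basis ι ℂ 𝔤}
  {B : LinearMap.BilinForm ℂ 𝔤} {l : 𝔤 →ₗ[ℂ] ℂ} {P : ℕ → CentralParams}
  {V : Type*} [AddCommGroup V] [Module ℂ V] (S : CurrentSystem N r p Jb B l P V)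

/-- The total Virasoro current `F(t) = ∑ᵢ F_{(i)}(t)`. -/
def F : RField V := ∑ i, S.vir i

/-- The total current `I^{m A}_n(t) = ∑ᵢ I^{m A}_{(i) n}(t)`. -/
def I (m n : Fin N → ℕ) (A : UEnv N 𝔤) : RField V := ∑ i, S.cur i m n A

/-- `E^m_n(t)`. -/
def E (m n : Fin N → ℕ) : RField V := S.I m n 1

/-- `J^{m a}_n(t)`. -/
def J (m n : Fin N → ℕ) (a : ι) : RField V := S.I m n (uJ N (Jb a))

/-- `T^{m μ}_{n ν}(t)`. -/
def T (m n : Fin N → ℕ) (μ ν : Fin N) : RField V := S.I m n (uT 𝔤 μ ν)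

/-- `P_μ(t) = ∑_m E^m_{m + μ}(t)`. -/
def bigP (μ : Fin N) : RField V := ∑ m ∈ jets N p, S.E m (m + Pi.single μ 1)

/-- `T_{dξ}`. -/
def genT (ξ : VecField N) : Module.End ℂ V :=
  fieldInt (∑ m ∈ jets N p, ∑ n ∈ jets N p, (multiChoose m n : ℂ) • ∑ μ, ∑ ν,
    normalProd (onTrajectory S.q (multiDeriv (m - n + Pi.single ν 1) (ξ μ))) (S.T m n ν μ))

/-- The generator of diffeomorphisms. -/
def genL (ξ : VecField N) : Module.End ℂ V :=
  fieldInt (∑ μ, (normalProd (S.mom μ) (onTrajectory S.q (ξ μ)) -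
    normalProd (onTrajectory S.q (ξ μ)) (S.bigP μ) +
    ∑ m ∈ jets N p, ∑ n ∈ jets N p, (multiChoose m n : ℂ) •
      normalProd (onTrajectory S.q (multiDeriv (m - n) (ξ μ))) (S.E m (n + Pi.single μ 1)))) +
  S.genT ξ

/-- The generator of gauge transformations. -/
def genJ [Fintype ι] (X : GaugeMap N ι) : Module.End ℂ V :=
  fieldInt (∑ m ∈ jets N p, ∑ n ∈ jets N p, (multiChoose m n : ℂ) • ∑ a,
    normalProd (onTrajectory S.q (multiDeriv (m - n) (X a))) (S.J m n a))

/-- The generator of reparametrizations, `∫ f(t) (-:q̇^μ(t) p_μ(t): + F(t)) dt`. -/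
def genR (f : ℂ[T;T⁻¹]) : Module.End ℂ V :=
  smear f (-(∑ μ, normalProd (S.mom μ) (fieldDeriv (S.q μ))) + S.F)

end CurrentSystem

/-! ### The finiteness conditions -/

/-- The alternating sign times a binomial coefficient. -/
def altChoose (r i : ℕ) : ℂ := (-1) ^ i * (r.choose i : ℂ)

/-- The linear conditions on the parameters `P 0, …, P r` of the summands. -/
structure FinitenessConditions (r : ℕ) (P : ℕ → CentralParams) : Prop where
  k₁ : ∀ i ≤ r, (P i).k₁ + ∑ j ∈ Finset.range i, ∑ s ∈ Finset.range (j + 1), (P s).k₄ =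
    altChoose r i * (P 0).k₁
  k₂ : ∀ i ≤ r, (P i).k₂ + ∑ j ∈ Finset.range i,
      (2 * (P j).k₃ + ∑ s ∈ Finset.range j, (P s).k₄) = altChoose r i * (P 0).k₂
  k₃ : ∑ i ∈ Finset.range (r + 1), (2 * (P i).k₃ + ∑ s ∈ Finset.range i, (P s).k₄) = 0
  k₄ : ∑ i ∈ Finset.range (r + 1), (P i).k₄ = 0
  k₄' : ∑ i ∈ Finset.range r, ∑ j ∈ Finset.range (i + 1), (P j).k₄ = 0
  k₅ : ∀ i ≤ r, (P i).k₅ = altChoose r i * (P 0).k₅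
  k₆ : ∑ i ∈ Finset.range (r + 1), (P i).k₆ = 0
  k₇ : ∀ i ≤ r, (P i).k₇ + ∑ j ∈ Finset.range i, (P j).k₆ = altChoose r i * (P 0).k₇
  k₈ : ∀ i ≤ r, (P i).k₈ = altChoose r i * (P 0).k₈
  d₀ : ∑ i ∈ Finset.range (r + 1), (P i).d₀ = 0
  d₁ : ∀ i ≤ r, (P i).d₁ + ∑ j ∈ Finset.range i, (P j).d₀ = altChoose r i * (P 0).d₁
  d₂ : ∀ i ≤ r, (P i).d₂ = altChoose r i * (P 0).d₂
  c : ∀ i ≤ r, (P i).c = altChoose r i * (P 0).c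

/-- The binomial coefficient `(N + p - r choose N - r)`, for `r ≤ p`; it is zero if the lower entry
is negative. -/
def chargeBinom (N r p : ℕ) : ℂ := if r ≤ N then ((N + p - r).choose (N - r) : ℂ) else 0

/-- The abelian charges of the direct sum. -/
def totalCharges (N r p : ℕ) (P : ℕ → CentralParams) : AbelianCharges where
  c₁ := 1 - (P 0).k₁ * chargeBinom N r p
  c₂ := -((P 0).k₂ * chargeBinom N r p)
  c₃ := 1 + (P 0).d₁ * chargeBinom N r p
  c₄ := 2 * N + (P 0).c * chargeBinom N r p
  c₅ := (P 0).k₅ * chargeBinom N r p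
  c₆ := (P 0).d₂ * chargeBinom N r p
  c₇ := (P 0).k₇ * chargeBinom N r p
  c₈ := (P 0).k₈ * chargeBinom N r p

end DGRO

end

/-! Each generator is a trajectory part, built from `q` and `p`, plus one part for each system of
currents. Parts belonging to different systems commute, so a bracket of generators is the trajectory
bracket plus, for each `i`, two cross brackets and one bracket inside the `i`-th system
(`lie_add_sum`). A mode of a normal ordered product is a locally finite sum of operators, and most
operator identities come from recognising two such sums as having the same terms (`HasLSum.unique`).

Trajectory. The operators `∫ :a p:` are normal ordered first order differential operators. Their
commutator is the classical one plus a double contraction, produced by moving annihilators past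
creators (`lie_of_hasLSum_ordTerm`). On the diagonal `k - j = l` the contraction is an oriented sum
over the integers between `0` and `l`, so it telescopes (`hasLSum_contraction`). The summands `1`,
`ik`, `-kj` give `l`, `i l(l-1)/2`, `(l³-l)/6`; these are the contributions `1`, `1`, `2N` to `c₁`,
`c₃`, `c₄`.

Currents. A matrix `M` of functions on space, evaluated on the trajectory and coupled to the
currents with label `A`, behaves like `M ⊗ A`: the commutator is `MM' ⊗ AA' - M'M ⊗ A'A` with the
cocycle `k(A,A') tr(∂M M')` (`lie_curOp`). The matrices that occur in the generators are those of
two operators on polynomials in `y` of degree at most `p - i`, with coefficients depending on a base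
point `x`: multiplication by `f(x+y)`, and the vector field `(ξ(x+y) - ξ(x)) ∂_y`. Subtracting `ξ P`
in the generator is the subtraction of `ξ(x)`. Because of it neither operator lowers the degree in
`y`, and truncation respects products (`jetMat_mul`). The commutators of these matrices reproduce
the algebra except for derivatives along `ξ(x)` of the coefficients (`jetV_lie_jetJ`,
`jetV_lie_jetV`); the momentum in the trajectory part supplies exactly these.

What remains is central and is a trace of jet matrices. Only the linear part in `y` of `ξ(x+y) -
ξ(x)` can contribute, and the counting identity `sum_jets_multiChoose` turns the traces into
binomial coefficients `C(N+q,N)`, `C(N+q,N+1)`, `C(N+q,N+2)`, `C(N+q+1,N+2)` with `q = p - i`. Under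
reparametrizations the integrand changes by a total derivative, so only the term `d(A) tr M`
survives (`lie_reparOp_curOp`).

Charges. It remains to sum over `i`. Since the sums of `k₄`, `k₆`, `d₀` and the like vanish,
summation by parts lowers `N+2` and `N+1` to `N`, replacing parameters by partial sums
(`sum_mul_eq_sum_partial_mul`). The finiteness conditions say that the resulting coefficients are
multiples of `(-1)^i C(r,i)`, and an `r`-fold difference of `C(N+p,N)` in `p` is `C(N+p-r,N-r)`
(`sum_altChoose_choose`). The three cases `N < r`, `N = r`, `N > r` are read off from this binomial.
-/

open scoped LaurentPolynomial BigOperators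

noncomputable section

namespace DGRO

/-! ### Locally finite sums of operators -/

section LocallyFinite

variable {V : Type*} [AddCommGroup V] [Module ℂ V] {κ α β : Type*}

/-- Every vector is killed by all but finitely many of the operators `T k`. -/
def LocFin (T : κ → Module.End ℂ V) : Prop :=
  ∀ v, (Function.support fun k => T k v).Finite

/-- The locally finite sum of the operators `T k` is `X`. -/
def HasLSum (T : κ → Module.End ℂ V) (X : Module.End ℂ V) : Prop :=
  ∀ v, (Function.support fun k => T k v).Finite ∧ ∑ᶠ k, T k v = X v

theorem HasLSum.locFin {T : κ → Module.End ℂ V} {X : Module.End ℂ V} (h : HasLSum T X) :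
    LocFin T := fun v => (h v).1

theorem LocFin.exists_hasLSum {T : κ → Module.End ℂ V} (h : LocFin T) : ∃ X, HasLSum T X :=
  ⟨{ toFun := fun v => ∑ᶠ k, T k v
     map_add' := fun v w => by
        simp only [map_add]
        exact finsum_add_distrib (h v) (h w)
     map_smul' := fun c v => by
        simp only [map_smul, RingHom.id_apply]
        exact (smul_finsum' c (h v)).symm }, fun v => ⟨h v, rfl⟩⟩

theorem HasLSum.unique {T : κ → Module.End ℂ V} {X Y : Module.End ℂ V} (h : HasLSum T X)
    (h' : HasLSum T Y) : X = Y := by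
  ext v
  rw [← (h v).2, (h' v).2]

theorem HasLSum.congr {T T' : κ → Module.End ℂ V} {X : Module.End ℂ V} (h : HasLSum T X)
    (e : ∀ k, T' k = T k) : HasLSum T' X := by
  rwa [show T' = T from funext e]

theorem LocFin.add {T T' : κ → Module.End ℂ V} (h : LocFin T) (h' : LocFin T') :
    LocFin (fun k => T k + T' k) := fun v =>
  ((h v).union (h' v)).subset (Function.support_add _ _)

theorem HasLSum.add {T T' : κ → Module.End ℂ V} {X X' : Module.End ℂ V} (h : HasLSum T X)
    (h' : HasLSum T' X') : HasLSum (fun k => T k + T' k) (X + X') := fun v =>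
  ⟨h.locFin.add h'.locFin v, by
    simp only [LinearMap.add_apply]
    rw [finsum_add_distrib (h v).1 (h' v).1, (h v).2, (h' v).2]⟩

theorem LocFin.mul_left {T : κ → Module.End ℂ V} (h : LocFin T) (Y : Module.End ℂ V) :
    LocFin (fun k => Y * T k) := fun v => by
  refine (h v).subset fun k hk => ?_
  simp only [Function.mem_support, Module.End.mul_apply] at hk ⊢
  intro h0
  exact hk (by rw [h0, map_zero])

theorem HasLSum.mul_left {T : κ → Module.End ℂ V} {X : Module.End ℂ V} (h : HasLSum T X)
    (Y : Module.End ℂ V) : HasLSum (fun k => Y * T k) (Y * X) := fun v =>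
  ⟨h.locFin.mul_left Y v, by
    simp only [Module.End.mul_apply]
    rw [← (h v).2]
    exact (AddMonoidHom.map_finsum Y.toAddMonoidHom (h v).1).symm⟩

theorem HasLSum.mul_right {T : κ → Module.End ℂ V} {X : Module.End ℂ V} (h : HasLSum T X)
    (Y : Module.End ℂ V) : HasLSum (fun k => T k * Y) (X * Y) := fun v => h (Y v)

theorem HasLSum.smul {T : κ → Module.End ℂ V} {X : Module.End ℂ V} (h : HasLSum T X)
    (c : ℂ) : HasLSum (fun k => c • T k) (c • X) := by
  have := h.mul_left (c • 1)
  simpa using this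

theorem HasLSum.neg {T : κ → Module.End ℂ V} {X : Module.End ℂ V} (h : HasLSum T X) :
    HasLSum (fun k => -T k) (-X) := by
  have := h.smul (-1)
  simpa using this

theorem HasLSum.sub {T T' : κ → Module.End ℂ V} {X X' : Module.End ℂ V} (h : HasLSum T X)
    (h' : HasLSum T' X') : HasLSum (fun k => T k - T' k) (X - X') := by
  simpa only [sub_eq_add_neg] using h.add h'.neg

theorem HasLSum.lie_left {T : κ → Module.End ℂ V} {X : Module.End ℂ V} (h : HasLSum T X)
    (Y : Module.End ℂ V) : HasLSum (fun k => ⁅Y, T k⁆) ⁅Y, X⁆ := by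
  simp only [Ring.lie_def]
  exact (h.mul_left Y).sub (h.mul_right Y)

theorem HasLSum.lie_right {T : κ → Module.End ℂ V} {X : Module.End ℂ V} (h : HasLSum T X)
    (Y : Module.End ℂ V) : HasLSum (fun k => ⁅T k, Y⁆) ⁅X, Y⁆ := by
  simp only [Ring.lie_def]
  exact (h.mul_right Y).sub (h.mul_left Y)

theorem HasLSum.commute {T : κ → Module.End ℂ V} {X Y : Module.End ℂ V} (h : HasLSum T X)
    (hY : ∀ k, Commute (T k) Y) : Commute X Y := by
  have h1 := h.mul_left Y
  have h2 := (h.mul_right Y).congr fun k => (hY k).eq.symm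
  exact h2.unique h1

theorem HasLSum.of_finset {T : κ → Module.End ℂ V} (s : Finset κ) (hs : ∀ k ∉ s, T k = 0) :
    HasLSum T (∑ k ∈ s, T k) := fun v => by
  have hsub : (Function.support fun k => T k v) ⊆ (s : Set κ) := by
    intro k hk
    by_contra hn
    exact hk (by simp [hs k hn])
  refine ⟨s.finite_toSet.subset hsub, ?_⟩
  rw [finsum_eq_sum_of_support_subset _ hsub]
  simp

theorem HasLSum.single {T : κ → Module.End ℂ V} (k₀ : κ) (h : ∀ k, k ≠ k₀ → T k = 0) :
    HasLSum T (T k₀) := by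
  have := HasLSum.of_finset (T := T) {k₀} (fun k hk => h k (by simpa using hk))
  simpa using this

theorem HasLSum.zero : HasLSum (fun _ : κ => (0 : Module.End ℂ V)) 0 := by
  simpa using HasLSum.of_finset (T := fun _ : κ => (0 : Module.End ℂ V)) ∅ (fun _ _ => rfl)

theorem HasLSum.comp_equiv {T : β → Module.End ℂ V} {X : Module.End ℂ V} (h : HasLSum T X)
    (e : α ≃ β) : HasLSum (fun a => T (e a)) X := fun v => by
  refine ⟨?_, ?_⟩
  · exact ((h v).1.preimage e.injective.injOn)
  · rw [finsum_comp_equiv e (f := fun b => T b v)]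
    exact (h v).2

/-- Fubini: on a fixed vector the double family has finite support, so it may be summed fibre by
fibre, and the fibre sums are supported in the projection of that support. -/
theorem HasLSum.fiberwise {T : α × β → Module.End ℂ V} {X : Module.End ℂ V} (h : HasLSum T X)
    {Y : α → Module.End ℂ V} (hY : ∀ a, HasLSum (fun b => T (a, b)) (Y a)) : HasLSum Y X := by
  intro v
  have h1 : (fun a => Y a v) = fun a => ∑ᶠ b, T (a, b) v := funext fun a => ((hY a v).2).symm
  refine ⟨?_, ?_⟩
  · refine ((h v).1.image Prod.fst).subset fun a ha => ?_
    by_contra hn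
    apply ha
    change Y a v = 0
    rw [← (hY a v).2]
    refine finsum_eq_zero_of_forall_eq_zero fun b => ?_
    by_contra hb
    exact hn ⟨(a, b), hb, rfl⟩
  · rw [h1, ← (h v).2, finsum_curry _ (h v).1]

end LocallyFinite

/-! ### The calculus of fields -/

section FieldCalculus

variable {V : Type*} [AddCommGroup V] [Module ℂ V]

theorem mode_ext {a b : RField V} (h : ∀ n, mode a n = mode b n) : a = b :=
  Subtype.ext (funext h)

@[simp] theorem mode_add (a b : RField V) (n : ℤ) : mode (a + b) n = mode a n + mode b n := rfl
@[simp] theorem mode_sub (a b : RField V) (n : ℤ) : mode (a - b) n = mode a n - mode b n := rfl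
@[simp] theorem mode_neg (a : RField V) (n : ℤ) : mode (-a) n = -mode a n := rfl
@[simp] theorem mode_zero (n : ℤ) : mode (0 : RField V) n = 0 := rfl
@[simp] theorem mode_smul (c : ℂ) (a : RField V) (n : ℤ) : mode (c • a) n = c • mode a n := rfl

/-- The `n`-th mode as a linear map. -/
def modeL (V : Type*) [AddCommGroup V] [Module ℂ V] (n : ℤ) : RField V →ₗ[ℂ] Module.End ℂ V where
  toFun a := mode a n
  map_add' _ _ := rfl
  map_smul' _ _ := rfl

@[simp] theorem mode_sum {α : Type*} (s : Finset α) (a : α → RField V) (n : ℤ) :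
    mode (∑ i ∈ s, a i) n = ∑ i ∈ s, mode (a i) n := map_sum (modeL V n) a s

theorem mode_oneField (n : ℤ) : mode (oneField : RField V) n = if n = 0 then 1 else 0 := rfl

@[simp] theorem mode_fieldDeriv (a : RField V) (n : ℤ) :
    mode (fieldDeriv a) n = (Complex.I * n) • mode a n := rfl

theorem exists_mode_eq_zero (a : RField V) (v : V) : ∃ K : ℤ, ∀ n, K < n → mode a n v = 0 := a.2 v

theorem hasLSum_normalProd (a b : RField V) (n : ℤ) :
    HasLSum (normalTerm a b n) (mode (normalProd a b) n) :=
  fun v => ⟨normalTerm_finite a b n v, rfl⟩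

/-- All modes of the two fields commute. -/
def FComm (a b : RField V) : Prop := ∀ m n, Commute (mode a m) (mode b n)

theorem FComm.symm {a b : RField V} (h : FComm a b) : FComm b a := fun m n => (h n m).symm

theorem hasLSum_normalProd_of_comm {a b : RField V} (h : FComm a b) (n : ℤ) :
    HasLSum (fun k => mode a k * mode b (n - k)) (mode (normalProd a b) n) := by
  refine (hasLSum_normalProd a b n).congr fun k => ?_
  unfold normalTerm
  split_ifs
  · rfl
  · exact (h k (n - k)).eq

theorem normalTerm_add_left (a a' b : RField V) (n k : ℤ) :
    normalTerm (a + a') b n k = normalTerm a b n k + normalTerm a' b n k := by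
  unfold normalTerm; split_ifs <;> simp [add_mul, mul_add]

theorem normalTerm_add_right (a b b' : RField V) (n k : ℤ) :
    normalTerm a (b + b') n k = normalTerm a b n k + normalTerm a b' n k := by
  unfold normalTerm; split_ifs <;> simp [add_mul, mul_add]

theorem normalTerm_smul_left (c : ℂ) (a b : RField V) (n k : ℤ) :
    normalTerm (c • a) b n k = c • normalTerm a b n k := by
  unfold normalTerm; split_ifs <;> simp

theorem normalTerm_smul_right (c : ℂ) (a b : RField V) (n k : ℤ) :
    normalTerm a (c • b) n k = c • normalTerm a b n k := by
  unfold normalTerm; split_ifs <;> simp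

/-- The normal ordered product as a bilinear map. -/
def normalProdL (V : Type*) [AddCommGroup V] [Module ℂ V] :
    RField V →ₗ[ℂ] RField V →ₗ[ℂ] RField V :=
  LinearMap.mk₂ ℂ normalProd
    (fun a a' b => mode_ext fun n => (((hasLSum_normalProd a b n).add
      (hasLSum_normalProd a' b n)).congr (normalTerm_add_left a a' b n)).unique
        (hasLSum_normalProd _ _ n) |>.symm)
    (fun c a b => mode_ext fun n => ((hasLSum_normalProd a b n).smul c).congr
      (normalTerm_smul_left c a b n) |>.unique (hasLSum_normalProd _ _ n) |>.symm)
    (fun a b b' => mode_ext fun n => (((hasLSum_normalProd a b n).add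
      (hasLSum_normalProd a b' n)).congr (normalTerm_add_right a b b' n)).unique
        (hasLSum_normalProd _ _ n) |>.symm)
    (fun c a b => mode_ext fun n => ((hasLSum_normalProd a b n).smul c).congr
      (normalTerm_smul_right c a b n) |>.unique (hasLSum_normalProd _ _ n) |>.symm)

theorem normalProd_eq (a b : RField V) : normalProd a b = normalProdL V a b := rfl

theorem normalProd_comm {a b : RField V} (h : FComm a b) : normalProd a b = normalProd b a := by
  refine mode_ext fun n => ?_
  have h1 := (hasLSum_normalProd_of_comm h n).comp_equiv (Equiv.subLeft n)
  refine (h1.congr fun k => ?_).unique (hasLSum_normalProd_of_comm h.symm n)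
  simp only [Equiv.subLeft_apply, sub_sub_cancel]
  exact (h _ _).eq.symm

theorem FComm.normalProd_left {a b c : RField V} (h : FComm a c) (h' : FComm b c) :
    FComm (normalProd a b) c := fun m n =>
  (hasLSum_normalProd a b m).commute fun k => by
    unfold normalTerm
    split_ifs
    · exact (h _ _).mul_left (h' _ _)
    · exact (h' _ _).mul_left (h _ _)

theorem FComm.normalProd_right {a b c : RField V} (h : FComm c a) (h' : FComm c b) :
    FComm c (normalProd a b) := (h.symm.normalProd_left h'.symm).symm

theorem FComm.deriv_left {a b : RField V} (h : FComm a b) : FComm (fieldDeriv a) b :=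
  fun m n => (h m n).smul_left _

theorem FComm.smul_left {a b : RField V} (c : ℂ) (h : FComm a b) : FComm (c • a) b :=
  fun m n => (h m n).smul_left c

theorem FComm.zero_left (b : RField V) : FComm 0 b := fun _ _ => Commute.zero_left _

theorem FComm.sum_left {α : Type*} {s : Finset α} {a : α → RField V} {b : RField V}
    (h : ∀ i ∈ s, FComm (a i) b) : FComm (∑ i ∈ s, a i) b := fun m n => by
  rw [mode_sum]
  exact Commute.sum_left _ _ _ fun i hi => h i hi m n

theorem FComm.one_left (b : RField V) : FComm oneField b := fun m n => by
  rw [mode_oneField]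
  split_ifs
  · exact Commute.one_left _
  · exact Commute.zero_left _

/-- By commutativity each of the three modes can be made to act on the vector first, so each mode
number is bounded above. Their sum is `n`, so they are bounded below as well. -/
theorem locFin_mul_mul {a b c : RField V} (hab : FComm a b) (hac : FComm a c) (hbc : FComm b c)
    (n : ℤ) : LocFin (fun x : ℤ × ℤ => mode a x.1 * (mode b x.2 * mode c (n - x.1 - x.2))) := by
  intro v
  obtain ⟨A, hA⟩ := exists_mode_eq_zero a v
  obtain ⟨B, hB⟩ := exists_mode_eq_zero b v
  obtain ⟨C, hC⟩ := exists_mode_eq_zero c v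
  refine ((Set.finite_Icc (n - C - B) A).prod (Set.finite_Icc (n - C - A) B)).subset ?_
  rintro ⟨j, k⟩ hx
  simp only [Function.mem_support] at hx
  have h1 : j ≤ A := by
    by_contra h0
    apply hx
    rw [((hab j k).mul_right (hac j _)).eq, Module.End.mul_apply, hA j (by omega), map_zero]
  have h2 : k ≤ B := by
    by_contra h0
    apply hx
    rw [(hbc k _).eq, Module.End.mul_apply, Module.End.mul_apply, hB k (by omega), map_zero,
      map_zero]
  have h3 : n - j - k ≤ C := by
    by_contra h0
    apply hx
    rw [Module.End.mul_apply, Module.End.mul_apply, hC _ (by omega), map_zero, map_zero]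
  simp only [Set.mem_prod, Set.mem_Icc]
  omega

/-- Both bracketings are iterated sums of the same locally finite double series. -/
theorem normalProd_assoc {a b c : RField V} (hab : FComm a b) (hac : FComm a c)
    (hbc : FComm b c) :
    normalProd (normalProd a b) c = normalProd a (normalProd b c) := by
  refine mode_ext fun n => ?_
  obtain ⟨X, hX⟩ := (locFin_mul_mul hab hac hbc n).exists_hasLSum
  have h1 : HasLSum (fun j => mode a j * mode (normalProd b c) (n - j)) X := by
    refine hX.fiberwise fun j => ?_
    exact (hasLSum_normalProd_of_comm hbc (n - j)).mul_left (mode a j)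
  have e1 := h1.unique (hasLSum_normalProd_of_comm (hab.normalProd_right hac) n)
  -- The new outer index is the total mode number of `a` and `b`; the inner index is that of `a`.
  let e : ℤ × ℤ ≃ ℤ × ℤ :=
    { toFun := fun x => (x.2, x.1 - x.2)
      invFun := fun x => (x.1 + x.2, x.1)
      left_inv := fun x => by simp
      right_inv := fun x => by simp }
  have h2 : HasLSum (fun m => mode (normalProd a b) m * mode c (n - m)) X := by
    refine (hX.comp_equiv e).fiberwise fun m => ?_
    refine ((hasLSum_normalProd_of_comm hab m).mul_right _).congr fun j => ?_
    simp only [e, Equiv.coe_fn_mk]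
    rw [mul_assoc, show n - j - (m - j) = n - m by ring]
  have e2 := h2.unique (hasLSum_normalProd_of_comm (hac.normalProd_left hbc) n)
  rw [← e1, ← e2]

theorem normalProd_left_comm {a b c : RField V} (hab : FComm a b) (hac : FComm a c)
    (hbc : FComm b c) :
    normalProd a (normalProd b c) = normalProd b (normalProd a c) := by
  rw [← normalProd_assoc hab hac hbc, normalProd_comm hab, normalProd_assoc hab.symm hbc hac]

theorem oneField_normalProd (b : RField V) : normalProd oneField b = b := by
  refine mode_ext fun n => ?_
  refine (hasLSum_normalProd_of_comm (FComm.one_left b) n).unique ?_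
  have := HasLSum.single (T := fun k => mode (oneField : RField V) k * mode b (n - k)) 0
    (fun k hk => by simp [mode_oneField, hk])
  simpa [mode_oneField] using this

/-- Termwise this is `n = k + (n - k)`. The operator order in a summand depends only on the sign of
`k`, so no commutativity is needed. -/
theorem fieldDeriv_normalProd (a b : RField V) :
    fieldDeriv (normalProd a b) = normalProd (fieldDeriv a) b + normalProd a (fieldDeriv b) := by
  refine mode_ext fun n => ?_
  have h1 := (hasLSum_normalProd a b n).smul (Complex.I * n)
  have h2 := (hasLSum_normalProd (fieldDeriv a) b n).add (hasLSum_normalProd a (fieldDeriv b) n)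
  refine h1.unique (h2.congr fun k => ?_)
  unfold normalTerm
  split_ifs
  · simp only [mode_fieldDeriv, smul_mul_assoc, mul_smul_comm, ← add_smul]
    push_cast; ring_nf
  · simp only [mode_fieldDeriv, smul_mul_assoc, mul_smul_comm, ← add_smul]
    push_cast; ring_nf

/-- The derivative as a linear map. -/
def fieldDerivL (V : Type*) [AddCommGroup V] [Module ℂ V] : RField V →ₗ[ℂ] RField V where
  toFun := fieldDeriv
  map_add' a b := mode_ext fun n => by simp
  map_smul' c a := mode_ext fun n => smul_comm _ c (mode a n)

/-- The field with modes `[Y, aₙ]`. -/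
def adField (Y : Module.End ℂ V) : RField V →ₗ[ℂ] RField V where
  toFun a := ⟨fun n => ⁅Y, mode a n⁆, fun v => by
    obtain ⟨K, hK⟩ := exists_mode_eq_zero a v
    obtain ⟨M, hM⟩ := exists_mode_eq_zero a (Y v)
    refine ⟨max K M, fun n hn => ?_⟩
    change ⁅Y, mode a n⁆ v = 0
    rw [Ring.lie_def, LinearMap.sub_apply, Module.End.mul_apply, Module.End.mul_apply,
      hK n (by omega), hM n (by omega)]
    simp⟩
  map_add' a b := mode_ext fun n => by
    change ⁅Y, mode a n + mode b n⁆ = ⁅Y, mode a n⁆ + ⁅Y, mode b n⁆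
    simp only [Ring.lie_def]; noncomm_ring
  map_smul' c a := mode_ext fun n => by
    change ⁅Y, c • mode a n⁆ = c • ⁅Y, mode a n⁆
    simp [Ring.lie_def, smul_sub]

theorem mode_adField (Y : Module.End ℂ V) (a : RField V) (n : ℤ) :
    mode (adField Y a) n = ⁅Y, mode a n⁆ := rfl

/-- The order of the factors is governed by `k` alone and is unchanged when a factor is replaced by
its commutator with `Y`; hence Leibniz holds in each summand. -/
theorem adField_normalProd (Y : Module.End ℂ V) (a b : RField V) :
    adField Y (normalProd a b) = normalProd (adField Y a) b + normalProd a (adField Y b) := by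
  refine mode_ext fun n => ?_
  have h1 := (hasLSum_normalProd a b n).lie_left Y
  have h2 := (hasLSum_normalProd (adField Y a) b n).add (hasLSum_normalProd a (adField Y b) n)
  refine h1.unique (h2.congr fun k => ?_)
  unfold normalTerm
  split_ifs
  · simp only [mode_adField, Ring.lie_def]; noncomm_ring
  · simp only [mode_adField, Ring.lie_def]; noncomm_ring

theorem adField_eq_zero {Y : Module.End ℂ V} {a : RField V} (h : ∀ n, Commute Y (mode a n)) :
    adField Y a = 0 := mode_ext fun n => by
  rw [mode_adField, Ring.lie_def, (h n).eq, sub_self, mode_zero]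

/-- `∫ a(t) dt` as a linear map. -/
def fieldIntL (V : Type*) [AddCommGroup V] [Module ℂ V] : RField V →ₗ[ℂ] Module.End ℂ V :=
  (2 * Real.pi : ℂ) • modeL V 0

theorem fieldInt_eq (a : RField V) : fieldInt a = fieldIntL V a := rfl

theorem lie_fieldInt (Y : Module.End ℂ V) (a : RField V) :
    ⁅Y, fieldInt a⁆ = fieldInt (adField Y a) := by
  simp [fieldInt, mode_adField, Ring.lie_def, smul_sub]

theorem fieldInt_fieldDeriv (a : RField V) : fieldInt (fieldDeriv a) = 0 := by
  simp [fieldInt]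

/-! ### Trigonometric polynomials as fields -/

/-- A trigonometric polynomial as a scalar field. -/
def trig (V : Type*) [AddCommGroup V] [Module ℂ V] (f : ℂ[T;T⁻¹]) : RField V :=
  ⟨fun n => f.coeff n • 1, fun v => by
    obtain ⟨K, hK⟩ := f.coeff.support.bddAbove
    refine ⟨K, fun n hn => ?_⟩
    have : f.coeff n = 0 := by
      by_contra h0
      exact absurd (hK (Finsupp.mem_support_iff.mpr h0)) (by omega)
    simp [this]⟩

theorem mode_trig (f : ℂ[T;T⁻¹]) (n : ℤ) : mode (trig V f) n = f.coeff n • 1 := rfl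

theorem FComm.trig_left (f : ℂ[T;T⁻¹]) (b : RField V) : FComm (trig V f) b := fun m n => by
  rw [mode_trig]
  exact (Commute.one_left _).smul_left _

theorem FComm.trig_right (f : ℂ[T;T⁻¹]) (b : RField V) : FComm b (trig V f) :=
  (FComm.trig_left f b).symm

/-- Treating the test function as a scalar field puts smeared operators under the same product
calculus as all other fields. -/
theorem smear_eq (f : ℂ[T;T⁻¹]) (a : RField V) :
    smear f a = fieldInt (normalProd (trig V f) a) := by
  have h1 := hasLSum_normalProd_of_comm (FComm.trig_left f a) 0
  have h2 : HasLSum (fun k => mode (trig V f) k * mode a (0 - k))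
      (∑ k ∈ f.coeff.support, f.coeff k • mode a (-k)) := by
    have := HasLSum.of_finset (T := fun k => mode (trig V f) k * mode a (0 - k)) f.coeff.support
      (fun k hk => by simp [mode_trig, Finsupp.notMem_support_iff.mp hk])
    simpa [mode_trig] using this
  unfold smear fieldInt
  rw [h1.unique h2, Finset.smul_sum, Finsupp.sum]
  simp only [mul_smul]

theorem coeff_circDeriv (f : ℂ[T;T⁻¹]) (n : ℤ) :
    (circDeriv f).coeff n = Complex.I * n * f.coeff n := by
  unfold circDeriv
  rw [Finsupp.sum, AddMonoidAlgebra.coeff_sum, Finsupp.finsetSum_apply]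
  simp only [← LaurentPolynomial.single_eq_C_mul_T, AddMonoidAlgebra.coeff_single,
    Finsupp.single_apply]
  rw [Finset.sum_ite_eq' f.coeff.support n]
  split_ifs with h
  · rfl
  · rw [Finsupp.notMem_support_iff.mp h, mul_zero]

theorem fieldDeriv_trig (f : ℂ[T;T⁻¹]) : fieldDeriv (trig V f) = trig V (circDeriv f) :=
  mode_ext fun n => by rw [mode_fieldDeriv, mode_trig, mode_trig, coeff_circDeriv, smul_smul]

/-- `trig` as a linear map. -/
def trigL (V : Type*) [AddCommGroup V] [Module ℂ V] : ℂ[T;T⁻¹] →ₗ[ℂ] RField V where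
  toFun := trig V
  map_add' f g := mode_ext fun n => by simp [mode_trig, add_smul]
  map_smul' c f := mode_ext fun n => by simp [mode_trig, mul_smul]

theorem coeff_T (j n : ℤ) :
    (LaurentPolynomial.T j : ℂ[T;T⁻¹]).coeff n = if j = n then 1 else 0 := by
  rw [LaurentPolynomial.T, AddMonoidAlgebra.coeff_single, Finsupp.single_apply]

theorem mode_trig_T_normalProd (j : ℤ) (a : RField V) (n : ℤ) :
    mode (normalProd (trig V (LaurentPolynomial.T j)) a) n = mode a (n - j) := by
  have h1 := hasLSum_normalProd_of_comm (FComm.trig_left (LaurentPolynomial.T j) a) n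
  have h2 := HasLSum.single
    (T := fun k => mode (trig V (LaurentPolynomial.T j)) k * mode a (n - k)) j
    (fun k hk => by simp [mode_trig, hk.symm])
  rw [h1.unique h2]
  simp [mode_trig]

theorem smear_T (j : ℤ) (a : RField V) :
    smear (LaurentPolynomial.T j) a = (2 * Real.pi : ℂ) • mode a (-j) := by
  rw [smear_eq, fieldInt, mode_trig_T_normalProd, zero_sub]

theorem coeff_T_mul (j : ℤ) (g : ℂ[T;T⁻¹]) (n : ℤ) :
    (LaurentPolynomial.T j * g).coeff n = g.coeff (n - j) := by
  rw [LaurentPolynomial.T, AddMonoidAlgebra.coeff_single_mul_apply, one_mul, neg_add_eq_sub]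

theorem trig_mul (f g : ℂ[T;T⁻¹]) : trig V (f * g) = normalProd (trig V f) (trig V g) := by
  change trigL V (f * g) = normalProdL V (trigL V f) (trig V g)
  induction f using LaurentPolynomial.induction_on' with
  | add p q hp hq => rw [add_mul, map_add, map_add, hp, hq, map_add, LinearMap.add_apply]
  | C_mul_T n a =>
    have h : LaurentPolynomial.C a * LaurentPolynomial.T n = a • (LaurentPolynomial.T n) := by
      rw [LaurentPolynomial.smul_eq_C_mul]
    rw [h, smul_mul_assoc, map_smul, map_smul, map_smul, LinearMap.smul_apply]
    congr 1
    refine mode_ext fun m => ?_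
    refine Eq.trans ?_ (mode_trig_T_normalProd n (trig V g) m).symm
    change mode (trig V _) m = _
    rw [mode_trig, mode_trig, coeff_T_mul]

end FieldCalculus

/-! ### Iterated products of commuting maps -/

section PowFold

variable {N : ℕ} {α : Type*} {g : Fin N → α → α} {P : α → Prop}

theorem foldr_iterate_mem (hP : ∀ μ x, P x → P (g μ x)) (s : Fin N → ℕ) (l : List (Fin N)) {x : α}
    (hx : P x) : P (l.foldr (fun μ acc => (g μ)^[s μ] acc) x) := by
  induction l with
  | nil => exact hx
  | cons a l ih =>
    rw [List.foldr_cons]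
    generalize l.foldr (fun μ acc => (g μ)^[s μ] acc) x = y at ih
    generalize s a = n
    induction n with
    | zero => exact ih
    | succ n ihn => rw [Function.iterate_succ_apply']; exact hP _ _ ihn

theorem foldr_iterate_comm (hP : ∀ μ x, P x → P (g μ x))
    (hg : ∀ μ ν x, P x → g μ (g ν x) = g ν (g μ x)) (s : Fin N → ℕ) (l : List (Fin N)) (μ : Fin N)
    {x : α} (hx : P x) :
    l.foldr (fun μ acc => (g μ)^[s μ] acc) (g μ x) =
      g μ (l.foldr (fun μ acc => (g μ)^[s μ] acc) x) := by
  induction l with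
  | nil => rfl
  | cons a l ih =>
    rw [List.foldr_cons, List.foldr_cons, ih]
    have hy := foldr_iterate_mem hP s l hx
    generalize l.foldr (fun μ acc => (g μ)^[s μ] acc) x = y at hy
    have : ∀ n : ℕ, (g a)^[n] (g μ y) = g μ ((g a)^[n] y) ∧ P ((g a)^[n] y) := by
      intro n
      induction n with
      | zero => exact ⟨rfl, hy⟩
      | succ n ihn =>
        rw [Function.iterate_succ_apply', Function.iterate_succ_apply', ihn.1, hg a μ _ ihn.2]
        exact ⟨rfl, hP _ _ ihn.2⟩
    exact (this _).1

/-- The extra factor is pulled to the front through the other maps. The same fold defines monomials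
in the trajectory and iterated partial derivatives; the invariant `P` is there because
multiplications by `q^μ` are only known to commute on fields that commute with `q`. -/
theorem foldr_iterate_succ (hP : ∀ μ x, P x → P (g μ x))
    (hg : ∀ μ ν x, P x → g μ (g ν x) = g ν (g μ x)) (s s' : Fin N → ℕ) (μ : Fin N)
    (hs : ∀ ν, s' ν = s ν + if ν = μ then 1 else 0) {x : α} (hx : P x) :
    (List.finRange N).foldr (fun μ acc => (g μ)^[s' μ] acc) x =
      g μ ((List.finRange N).foldr (fun μ acc => (g μ)^[s μ] acc) x) := by
  have key : ∀ l : List (Fin N), l.Nodup → l.foldr (fun μ acc => (g μ)^[s' μ] acc) x =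
      if μ ∈ l then g μ (l.foldr (fun μ acc => (g μ)^[s μ] acc) x)
      else l.foldr (fun μ acc => (g μ)^[s μ] acc) x := by
    intro l
    induction l with
    | nil => simp
    | cons a l ih =>
      intro hl
      rw [List.nodup_cons] at hl
      simp only [List.foldr_cons]
      rw [ih hl.2, hs a]
      by_cases ha : a = μ
      · subst ha
        rw [if_neg hl.1, if_pos rfl, if_pos (List.mem_cons_self ..),
          Function.iterate_succ_apply']
      · have hmem : (μ ∈ a :: l) ↔ μ ∈ l := by
          rw [List.mem_cons]
          exact ⟨fun h => h.resolve_left fun h => ha h.symm, Or.inr⟩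
        simp only [hmem, if_neg ha, add_zero]
        split_ifs
        · have hy := foldr_iterate_mem hP s l hx
          generalize l.foldr (fun μ acc => (g μ)^[s μ] acc) x = y at hy
          have : ∀ n : ℕ, (g a)^[n] (g μ y) = g μ ((g a)^[n] y) ∧ P ((g a)^[n] y) := by
            intro n
            induction n with
            | zero => exact ⟨rfl, hy⟩
            | succ n ihn =>
              rw [Function.iterate_succ_apply', Function.iterate_succ_apply', ihn.1,
                hg a μ _ ihn.2]
              exact ⟨rfl, hP _ _ ihn.2⟩
          exact (this _).1
        · rfl
  rw [key _ (List.nodup_finRange N), if_pos (List.mem_finRange μ)]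

end PowFold

/-! ### Functions of the trajectory -/

section Trajectory

variable {V : Type*} [AddCommGroup V] [Module ℂ V] {N : ℕ} {q : Fin N → RField V}

theorem onTrajectory_eq_sum (q : Fin N → RField V) (f : MvPolynomial (Fin N) ℂ)
    (t : Finset (Fin N →₀ ℕ)) (h : f.support ⊆ t) :
    onTrajectory q f = ∑ s ∈ t, f.coeff s • fieldMonomial q s := by
  unfold onTrajectory
  refine Finset.sum_subset h fun s _ hs => ?_
  rw [MvPolynomial.notMem_support_iff.mp hs, zero_smul]

/-- `f ↦ f(q(t))` as a linear map. -/
def onTrajectoryL (q : Fin N → RField V) : MvPolynomial (Fin N) ℂ →ₗ[ℂ] RField V where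
  toFun := onTrajectory q
  map_add' f g := by
    classical
    rw [onTrajectory_eq_sum q f (f.support ∪ g.support) Finset.subset_union_left,
      onTrajectory_eq_sum q g (f.support ∪ g.support) Finset.subset_union_right,
      onTrajectory_eq_sum q (f + g) (f.support ∪ g.support) MvPolynomial.support_add,
      ← Finset.sum_add_distrib]
    simp only [MvPolynomial.coeff_add, add_smul]
  map_smul' c f := by
    rw [onTrajectory_eq_sum q (c • f) f.support MvPolynomial.support_smul]
    simp only [MvPolynomial.coeff_smul, smul_eq_mul, mul_smul, ← Finset.smul_sum, RingHom.id_apply]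
    rfl

theorem onTrajectory_eq (q : Fin N → RField V) (f : MvPolynomial (Fin N) ℂ) :
    onTrajectory q f = onTrajectoryL q f := rfl

theorem onTrajectory_monomial (q : Fin N → RField V) (s : Fin N →₀ ℕ) (c : ℂ) :
    onTrajectory q (MvPolynomial.monomial s c) = c • fieldMonomial q s := by
  classical
  rw [onTrajectory_eq_sum q _ {s} MvPolynomial.support_monomial_subset]
  simp

theorem FComm.fieldMonomial_left {b : RField V} (h : ∀ μ, FComm (q μ) b) (s : Fin N →₀ ℕ) :
    FComm (fieldMonomial q s) b :=
  foldr_iterate_mem (P := fun c => FComm c b) (fun μ _ hx => (h μ).normalProd_left hx) s _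
    (FComm.one_left b)

theorem FComm.onTrajectory_left {b : RField V} (h : ∀ μ, FComm (q μ) b)
    (f : MvPolynomial (Fin N) ℂ) : FComm (onTrajectory q f) b :=
  FComm.sum_left fun s _ => (FComm.fieldMonomial_left h s).smul_left _

theorem FComm.onTrajectory_right {b : RField V} (h : ∀ μ, FComm (q μ) b)
    (f : MvPolynomial (Fin N) ℂ) : FComm b (onTrajectory q f) := (FComm.onTrajectory_left h f).symm

theorem fieldMonomial_add_single (hq : ∀ μ ν, FComm (q μ) (q ν)) (s : Fin N →₀ ℕ) (μ : Fin N) :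
    fieldMonomial q (s + Finsupp.single μ 1) = normalProd (q μ) (fieldMonomial q s) := by
  refine foldr_iterate_succ (P := fun b => ∀ ν, FComm (q ν) b) ?_ ?_ s _ μ ?_ ?_
  · exact fun μ x hx ν => (hq ν μ).normalProd_right (hx ν)
  · exact fun μ ν x hx => normalProd_left_comm (hq μ ν) (hx μ) (hx ν)
  · intro ν
    simp [Finsupp.single_apply, eq_comm]
  · exact fun ν => (FComm.one_left _).symm

theorem onTrajectory_X_mul (hq : ∀ μ ν, FComm (q μ) (q ν)) (μ : Fin N)
    (f : MvPolynomial (Fin N) ℂ) :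
    onTrajectory q (MvPolynomial.X μ * f) = normalProd (q μ) (onTrajectory q f) := by
  induction f using MvPolynomial.induction_on' with
  | monomial s c =>
    rw [MvPolynomial.X, MvPolynomial.monomial_mul, one_mul, onTrajectory_monomial,
      onTrajectory_monomial, add_comm, fieldMonomial_add_single hq, normalProd_eq, normalProd_eq,
      map_smul]
  | add f g hf hg =>
    simp only [onTrajectory_eq, normalProd_eq] at hf hg ⊢
    rw [mul_add, map_add, hf, hg, map_add, map_add]

theorem onTrajectory_C (q : Fin N → RField V) (c : ℂ) :
    onTrajectory q (MvPolynomial.C c) = c • oneField := by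
  rw [MvPolynomial.C_apply, onTrajectory_monomial]
  congr 1
  have : ∀ l : List (Fin N), l.foldr (fun μ acc => (normalProd (q μ))^[(0 : Fin N →₀ ℕ) μ] acc)
      (oneField : RField V) = oneField := by
    intro l
    induction l with
    | nil => rfl
    | cons a l ih => rw [List.foldr_cons, ih]; rfl
  exact this _

theorem onTrajectory_mul (hq : ∀ μ ν, FComm (q μ) (q ν)) (f g : MvPolynomial (Fin N) ℂ) :
    onTrajectory q (f * g) = normalProd (onTrajectory q f) (onTrajectory q g) := by
  have hqg : ∀ g μ, FComm (q μ) (onTrajectory q g) :=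
    fun g μ => FComm.onTrajectory_right (fun ν => hq ν μ) g
  induction f using MvPolynomial.induction_on with
  | C c =>
    rw [onTrajectory_C, MvPolynomial.C_mul']
    rw [onTrajectory_eq, map_smul, ← onTrajectory_eq, normalProd_eq, map_smul,
      LinearMap.smul_apply, ← normalProd_eq, oneField_normalProd]
  | add f f' hf hf' =>
    rw [add_mul, onTrajectory_eq, map_add, ← onTrajectory_eq, ← onTrajectory_eq, hf, hf']
    simp only [onTrajectory_eq, normalProd_eq, map_add, LinearMap.add_apply]
  | mul_X f μ hf =>
    rw [mul_comm f, mul_assoc, onTrajectory_X_mul hq, hf, onTrajectory_X_mul hq,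
      normalProd_assoc (hqg f μ) (hqg g μ) (FComm.onTrajectory_left (fun ν => hqg g ν) f)]

/-- Derivations of the normal ordered product. -/
structure IsFieldDer (D : RField V →ₗ[ℂ] RField V) : Prop where
  one : D oneField = 0
  leibniz : ∀ a b, D (normalProd a b) = normalProd (D a) b + normalProd a (D b)

theorem isFieldDer_adField (Y : Module.End ℂ V) : IsFieldDer (adField Y) where
  one := adField_eq_zero fun n => by
    rw [mode_oneField]
    split_ifs
    · exact Commute.one_right _
    · exact Commute.zero_right _
  leibniz := adField_normalProd Y

theorem isFieldDer_fieldDeriv : IsFieldDer (fieldDerivL V) where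
  one := mode_ext fun n => by
    change mode (fieldDeriv oneField) n = 0
    rw [mode_fieldDeriv, mode_oneField]
    split_ifs with h
    · simp [h]
    · simp
  leibniz := fieldDeriv_normalProd

/-- The chain rule. -/
theorem IsFieldDer.onTrajectory {D : RField V →ₗ[ℂ] RField V} (hD : IsFieldDer D)
    (hq : ∀ μ ν, FComm (q μ) (q ν)) (hDq : ∀ μ ν, FComm (D (q μ)) (q ν))
    (f : MvPolynomial (Fin N) ℂ) :
    D (onTrajectory q f) =
      ∑ μ, normalProd (D (q μ)) (onTrajectory q (MvPolynomial.pderiv μ f)) := by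
  induction f using MvPolynomial.induction_on with
  | C c =>
    rw [onTrajectory_C, map_smul, hD.one, smul_zero]
    simp [onTrajectory_eq, normalProd_eq]
  | add f g hf hg =>
    simp only [onTrajectory_eq, normalProd_eq, map_add, Finset.sum_add_distrib] at hf hg ⊢
    rw [hf, hg]
  | mul_X f ν hf =>
    rw [mul_comm f, onTrajectory_X_mul hq, hD.leibniz, hf, normalProd_eq (q ν), map_sum]
    simp only [Derivation.leibniz, MvPolynomial.pderiv_X, smul_eq_mul]
    have hqg : ∀ g μ, FComm (q μ) (DGRO.onTrajectory q g) :=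
      fun g μ => FComm.onTrajectory_right (fun ν => hq ν μ) g
    have hqD : ∀ g μ, FComm (D (q μ)) (DGRO.onTrajectory q g) :=
      fun g μ => FComm.onTrajectory_right (fun ν => (hDq μ ν).symm) g
    have : ∀ μ, normalProd (D (q μ)) (DGRO.onTrajectory q (MvPolynomial.X ν *
        MvPolynomial.pderiv μ f + f * (Pi.single μ 1 : Fin N → MvPolynomial (Fin N) ℂ) ν)) =
        (if μ = ν then normalProd (D (q μ)) (DGRO.onTrajectory q f) else 0) +
        normalProdL V (q ν) (normalProd (D (q μ)) (DGRO.onTrajectory q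
          (MvPolynomial.pderiv μ f))) := by
      intro μ
      rw [onTrajectory_eq, map_add, ← onTrajectory_eq, ← onTrajectory_eq, normalProd_eq, map_add,
        ← normalProd_eq, ← normalProd_eq, ← normalProd_eq, onTrajectory_X_mul hq,
        normalProd_left_comm (hDq μ ν) (hqD _ μ) (hqg _ ν), add_comm]
      congr 1
      by_cases h : μ = ν
      · subst h; simp
      · rw [Pi.single_eq_of_ne (Ne.symm h), mul_zero, if_neg h]
        simp [onTrajectory_eq, normalProd_eq]
    rw [Finset.sum_congr rfl fun μ _ => this μ, Finset.sum_add_distrib]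
    simp

end Trajectory

/-! ### Normal ordered first order operators -/

section Weyl

variable {V : Type*} [AddCommGroup V] [Module ℂ V] {κ : Type*}

/-- The normal ordered product of `p k` and `a k`; the creators `p k`, `neg k`, stand to the
left. -/
def ordTerm (neg : κ → Prop) [DecidablePred neg] (p a : κ → Module.End ℂ V) (k : κ) :
    Module.End ℂ V := if neg k then p k * a k else a k * p k

/-- The sign with which a pair contributes to the double contraction. -/
def contrSign (neg : κ → Prop) [DecidablePred neg] (k j : κ) : ℂ :=
  (if ¬neg k ∧ neg j then 1 else 0) - (if neg k ∧ ¬neg j then 1 else 0)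

variable {neg : κ → Prop} {p a b : κ → Module.End ℂ V}

/-- A commutator that moves `v` needs `a j` to be nonzero on `v` or on `p k v`. -/
theorem finite_support_lie {k : κ} (ha : ∀ v, {j | neg j ∧ a j v ≠ 0}.Finite) (v : V) :
    {j | neg j ∧ ⁅p k, a j⁆ v ≠ 0}.Finite := by
  refine ((ha v).union (ha (p k v))).subset fun j hj => ?_
  by_contra hn
  simp only [Set.mem_union, Set.mem_ofPred_eq, not_or, not_and, not_not] at hn
  apply hj.2
  rw [Ring.lie_def, LinearMap.sub_apply, Module.End.mul_apply, Module.End.mul_apply,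
    hn.1 hj.1, hn.2 hj.1, map_zero, sub_zero]

theorem finite_support_lie' (hp : ∀ v, {k | ¬neg k ∧ p k v ≠ 0}.Finite) {j : κ} (v : V) :
    {k | ¬neg k ∧ ⁅p k, a j⁆ v ≠ 0}.Finite := by
  refine ((hp v).union (hp (a j v))).subset fun k hk => ?_
  by_contra hn
  simp only [Set.mem_union, Set.mem_ofPred_eq, not_or, not_and, not_not] at hn
  apply hk.2
  rw [Ring.lie_def, LinearMap.sub_apply, Module.End.mul_apply, Module.End.mul_apply,
    hn.1 hk.1, hn.2 hk.1, map_zero, sub_zero]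

/-- If `p k` and `a j` both kill `v`, so does their commutator. Hence one of the two indices lies in
a finite set, and for each value of it the other index has finitely many choices. -/
theorem finite_support_lie_pair (hp : ∀ v, {k | ¬neg k ∧ p k v ≠ 0}.Finite)
    (ha : ∀ v, {j | neg j ∧ a j v ≠ 0}.Finite) (v : V) :
    {x : κ × κ | ¬neg x.1 ∧ neg x.2 ∧ ⁅p x.1, a x.2⁆ v ≠ 0}.Finite := by
  have h1 : (⋃ k ∈ {k | ¬neg k ∧ p k v ≠ 0},
      Prod.mk k '' {j | neg j ∧ ⁅p k, a j⁆ v ≠ 0}).Finite :=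
    (hp v).biUnion fun k _ => (finite_support_lie ha v).image _
  have h2 : (⋃ j ∈ {j | neg j ∧ a j v ≠ 0},
      (fun k => (k, j)) '' {k | ¬neg k ∧ ⁅p k, a j⁆ v ≠ 0}).Finite :=
    (ha v).biUnion fun k _ => (finite_support_lie' hp v).image _
  refine (h1.union h2).subset ?_
  rintro ⟨k, j⟩ ⟨hk, hj, hx⟩
  by_cases h3 : p k v = 0
  · by_cases h4 : a j v = 0
    · exact absurd (by
        rw [Ring.lie_def, LinearMap.sub_apply, Module.End.mul_apply, Module.End.mul_apply,
          h3, h4, map_zero, map_zero, sub_zero]) hx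
    · right
      exact Set.mem_biUnion (x := j) ⟨hj, h4⟩ ⟨k, ⟨hk, hx⟩, rfl⟩
  · left
    exact Set.mem_biUnion (x := k) ⟨hk, h3⟩ ⟨j, ⟨hj, hx⟩, rfl⟩

variable [DecidablePred neg]

theorem lie_ordTerm (Y : Module.End ℂ V) (p a : κ → Module.End ℂ V) (k : κ) :
    ⁅Y, ordTerm neg p a k⁆ = (if neg k then ⁅Y, p k⁆ * a k else a k * ⁅Y, p k⁆) +
      ordTerm neg p (fun k => ⁅Y, a k⁆) k := by
  unfold ordTerm
  split_ifs <;> simp only [Ring.lie_def] <;> noncomm_ring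

/-- Only the factor `p k` fails to commute with `x`, and what it leaves behind commutes with `a k`,
so the ordering disappears. -/
theorem hasLSum_lie_ordTerm {A x : Module.End ℂ V} (hA : HasLSum (ordTerm neg p a) A)
    (hax : ∀ k, Commute (a k) x) (hpx : ∀ k, Commute ⁅p k, x⁆ (a k)) :
    HasLSum (fun k => a k * ⁅p k, x⁆) ⁅A, x⁆ := by
  refine (hA.lie_right x).congr fun k => ?_
  have h1 := (hax k).eq
  have h2 := (hpx k).eq
  unfold ordTerm
  split_ifs
  · rw [← h2]
    simp only [Ring.lie_def, sub_mul, mul_assoc]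
    rw [h1]
  · simp only [Ring.lie_def, mul_sub, ← mul_assoc]
    rw [← h1]

theorem hasLSum_lie_ordTerm_mom {A x : Module.End ℂ V} (hA : HasLSum (ordTerm neg p a) A)
    (hpx : ∀ k, Commute (p k) x) :
    HasLSum (ordTerm neg p (fun j => -⁅x, a j⁆)) ⁅A, x⁆ := by
  refine (hA.lie_right x).congr fun k => ?_
  have h1 := (hpx k).eq
  unfold ordTerm
  split_ifs
  · simp only [Ring.lie_def, neg_sub, mul_sub, ← mul_assoc]
    rw [h1]
  · simp only [Ring.lie_def, neg_sub, sub_mul, mul_assoc]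
    rw [h1]

/-- Finiteness for the double series `∑ :p j [p k, a j] b k:`, which has to be summed in both
orders. An annihilator `p j` acts first and leaves finitely many `j`; with a creator `p j`, either
`b k` or the pair finiteness of `[p k, a j]` gives the bound. -/
theorem locFin_ordTerm_pair (hp : ∀ v, {k | ¬neg k ∧ p k v ≠ 0}.Finite)
    (ha : ∀ v, {j | neg j ∧ a j v ≠ 0}.Finite) (hb : ∀ v, {j | neg j ∧ b j v ≠ 0}.Finite)
    (hXb : ∀ k j i, Commute ⁅p k, a j⁆ (b i)) :
    LocFin (fun x : κ × κ => ordTerm neg p (fun j => ⁅p x.1, a j⁆ * b x.1) x.2) := by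
  intro v
  have h0 : ∀ w : V, ∀ j, {k | (⁅p k, a j⁆ * b k) w ≠ 0}.Finite := by
    intro w j
    refine ((hb w).union (finite_support_lie' (j := j) hp (a := a) w)).subset fun k hk => ?_
    by_contra hn
    simp only [Set.mem_union, Set.mem_ofPred_eq, not_or, not_and, not_not] at hn hk
    by_cases hneg : neg k
    · exact hk (by rw [Module.End.mul_apply, hn.1 hneg, map_zero])
    · exact hk (by rw [(hXb k j k).eq, Module.End.mul_apply, hn.2 hneg, map_zero])
  have h1 : {x : κ × κ | neg x.2 ∧ (⁅p x.1, a x.2⁆ * b x.1) v ≠ 0}.Finite := by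
    have hfin : (⋃ k ∈ {k | neg k ∧ b k v ≠ 0},
        Prod.mk k '' {j | neg j ∧ ⁅p k, a j⁆ v ≠ 0}).Finite :=
      (hb v).biUnion fun k _ => (finite_support_lie ha v).image _
    refine (hfin.union (finite_support_lie_pair hp ha v)).subset ?_
    rintro ⟨k, j⟩ ⟨hj, hx⟩
    have hX : ⁅p k, a j⁆ v ≠ 0 := fun h => hx (by
      simp only [(hXb k j k).eq, Module.End.mul_apply, h, map_zero])
    by_cases hneg : neg k
    · left
      refine Set.mem_biUnion (x := k) ⟨hneg, fun h => hx ?_⟩ ⟨j, ⟨hj, hX⟩, rfl⟩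
      simp only [Module.End.mul_apply, h, map_zero]
    · exact Or.inr ⟨hneg, hj, hX⟩
  have h2 : (⋃ j ∈ {j | ¬neg j ∧ p j v ≠ 0},
      (fun k => (k, j)) '' {k | (⁅p k, a j⁆ * b k) (p j v) ≠ 0}).Finite :=
    (hp v).biUnion fun j _ => (h0 _ j).image _
  refine (h1.union h2).subset ?_
  rintro ⟨k, j⟩ hx
  simp only [Function.mem_support, ordTerm] at hx
  by_cases hj : neg j
  · left
    rw [if_pos hj, Module.End.mul_apply] at hx
    exact ⟨hj, fun h => hx (by rw [h, map_zero])⟩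
  · right
    rw [if_neg hj, Module.End.mul_apply] at hx
    exact Set.mem_biUnion (x := j) ⟨hj, fun h => hx (by rw [h, map_zero])⟩ ⟨k, hx, rfl⟩

/-- The commutator of two normal ordered first order operators. -/
theorem lie_of_hasLSum_ordTerm (hp : ∀ v, {k | ¬neg k ∧ p k v ≠ 0}.Finite)
    (ha : ∀ v, {j | neg j ∧ a j v ≠ 0}.Finite) (hb : ∀ v, {j | neg j ∧ b j v ≠ 0}.Finite)
    (hpp : ∀ k j, Commute (p k) (p j)) (hab : ∀ k j, Commute (a k) (b j))
    (hXb : ∀ k j i, Commute ⁅p k, a j⁆ (b i))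
    (hXY : ∀ k j i l, Commute ⁅p k, a j⁆ ⁅p i, b l⁆)
    {A B Z W : Module.End ℂ V} (hA : HasLSum (ordTerm neg p a) A)
    (hB : HasLSum (ordTerm neg p b) B)
    (hZ : HasLSum (ordTerm neg p (fun k => ⁅A, b k⁆ - ⁅B, a k⁆)) Z)
    (hW : HasLSum (fun x : κ × κ =>
      contrSign neg x.1 x.2 • (⁅p x.1, a x.2⁆ * ⁅p x.2, b x.1⁆)) W) :
    ⁅A, B⁆ = Z + W := by
  -- `Q` cancels in the end. Summed over `k` first it is the normal ordered operator with
  -- coefficients `[B, a j]`; summed over `j` first it is `-∑ [A, p k] b k`, correctly ordered.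
  obtain ⟨Q, hQ⟩ := (locFin_ordTerm_pair hp ha hb hXb).exists_hasLSum
  have hQ1 : HasLSum (ordTerm neg p (fun j => ⁅B, a j⁆)) Q := by
    refine (hQ.comp_equiv (Equiv.prodComm κ κ)).fiberwise fun j => ?_
    have h1 := hasLSum_lie_ordTerm hB (x := a j) (fun k => (hab j k).symm) (fun k => hXb k j k)
    unfold ordTerm
    by_cases hj : neg j
    · rw [if_pos hj]
      refine (h1.mul_left (p j)).congr fun k => ?_
      simp only [Equiv.prodComm_apply, Prod.swap, if_pos hj, (hXb k j k).eq]
    · rw [if_neg hj]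
      refine (h1.mul_right (p j)).congr fun k => ?_
      simp only [Equiv.prodComm_apply, Prod.swap, if_neg hj, (hXb k j k).eq]
  -- The product is already normal ordered when `k` and `j` have the same sign. If the signs differ,
  -- reordering `p j` and `b k` leaves a contraction, with opposite signs in the two cases.
  have hR : HasLSum (fun k => if neg k then ⁅A, p k⁆ * b k else b k * ⁅A, p k⁆) (W - Q) := by
    refine (hW.sub hQ).fiberwise fun k => ?_
    have h1 := hasLSum_lie_ordTerm_mom hA (x := p k) (fun j => hpp j k)
    have hY : ∀ j, p j * b k = b k * p j + ⁅p j, b k⁆ := fun j => by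
      rw [Ring.lie_def]; abel
    by_cases hk : neg k
    · rw [if_pos hk]
      refine (h1.mul_right (b k)).congr fun j => ?_
      unfold ordTerm contrSign
      by_cases hj : neg j
      · simp [hk, hj, mul_assoc]
      · simp only [hk, hj, not_true_eq_false, not_false_eq_true, and_self,
          if_true, if_false, zero_sub, neg_smul, one_smul, neg_mul, mul_assoc, hY]
        noncomm_ring
    · rw [if_neg hk]
      refine (h1.mul_left (b k)).congr fun j => ?_
      unfold ordTerm contrSign
      have hbX : b k * ⁅p k, a j⁆ = ⁅p k, a j⁆ * b k := (hXb k j k).eq.symm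
      by_cases hj : neg j
      · have hY' : b k * p j = p j * b k - ⁅p j, b k⁆ := by rw [hY j]; abel
        simp only [hk, hj, not_true_eq_false, not_false_eq_true, and_self,
          if_true, if_false, sub_zero, one_smul, mul_neg]
        rw [← mul_assoc (b k), hY', sub_mul, mul_assoc, hbX, (hXY k j j k).eq]
        abel
      · simp [hk, hj, ← mul_assoc, hbX]
  have hAB := hB.lie_left A
  have h3 : HasLSum (ordTerm neg p (fun k => ⁅A, b k⁆)) (Z + Q) := by
    refine (hZ.add hQ1).congr fun k => ?_
    unfold ordTerm
    split_ifs
    · rw [← mul_add, sub_add_cancel]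
    · rw [← add_mul, sub_add_cancel]
  have h4 := (hR.add h3).congr fun k => lie_ordTerm A p b k
  rw [hAB.unique h4]
  abel

end Weyl

/-! ### Summing double contractions by telescoping along diagonals -/

section Contraction

variable {V : Type*} [AddCommGroup V] [Module ℂ V]

theorem HasLSum.of_fibers {V : Type*} [AddCommGroup V] [Module ℂ V] {α β : Type*} [Fintype α]
    {T : α × β → Module.End ℂ V} {Y : α → Module.End ℂ V}
    (h : ∀ a, HasLSum (fun b => T (a, b)) (Y a)) : HasLSum T (∑ a, Y a) := by
  have hfin : LocFin T := by
    intro v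
    refine (Set.finite_iUnion fun a => ((h a v).1.image (Prod.mk a))).subset ?_
    rintro ⟨a, b⟩ hx
    exact Set.mem_iUnion.mpr ⟨a, b, hx, rfl⟩
  obtain ⟨X, hX⟩ := hfin.exists_hasLSum
  rwa [(hX.fiberwise h).unique (HasLSum.of_finset Finset.univ (fun k hk =>
    absurd (Finset.mem_univ k) hk))] at hX

/-- On the diagonal `k - j = l` the sign is the oriented indicator of the integers from `0` to `l`;
raising `l` by one adds the single point `k = l`. -/
theorem contrSign_step (k l : ℤ) :
    contrSign (fun k : ℤ => k < 0) k (k - (l + 1)) =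
      contrSign (fun k : ℤ => k < 0) k (k - l) + if k = l then 1 else 0 := by
  unfold contrSign
  by_cases h1 : k < 0 <;> by_cases h2 : k = l <;> by_cases h3 : k - l < 0 <;>
    by_cases h4 : k - (l + 1) < 0 <;> first | omega | simp [h1, h2, h4]; try simp_all

/-- An oriented sum of first differences from `0` to `l`, including negative `l`. -/
theorem hasLSum_contrSign_telescope (F : ℤ → ℂ) (X : Module.End ℂ V) (l : ℤ) :
    HasLSum (fun k : ℤ => (contrSign (fun k : ℤ => k < 0) k (k - l) * (F (k + 1) - F k)) • X)
      ((F l - F 0) • X) := by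
  have hs : ∀ l : ℤ, HasLSum (fun k : ℤ => (if k = l then F (k + 1) - F k else 0) • X)
      ((F (l + 1) - F l) • X) := by
    intro l
    have := HasLSum.single (T := fun k : ℤ => (if k = l then F (k + 1) - F k else 0) • X) l
      (fun k hk => by simp [hk])
    simpa using this
  have hc : ∀ k l : ℤ, contrSign (fun k : ℤ => k < 0) k (k - (l + 1)) * (F (k + 1) - F k) =
      contrSign (fun k : ℤ => k < 0) k (k - l) * (F (k + 1) - F k) +
        if k = l then F (k + 1) - F k else 0 := by
    intro k l
    rw [contrSign_step, add_mul, ite_mul, one_mul, zero_mul]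
  induction l using Int.induction_on with
  | zero =>
    rw [sub_self, zero_smul]
    refine HasLSum.zero.congr fun k => ?_
    have : contrSign (fun k : ℤ => k < 0) k (k - 0) = 0 := by
      unfold contrSign
      rw [sub_zero, if_neg (by tauto), if_neg (by tauto), sub_zero]
    rw [this, zero_mul, zero_smul]
  | succ n ih =>
    have h := ih.add (hs n)
    rw [← add_smul] at h
    convert h.congr (T' := fun k : ℤ => (contrSign (fun k : ℤ => k < 0) k (k - (n + 1)) *
      (F (k + 1) - F k)) • X) (fun k => by rw [hc, add_smul]) using 2
    ring
  | pred n ih =>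
    have h := ih.sub (hs (-n - 1))
    rw [← sub_smul] at h
    convert h.congr (T' := fun k : ℤ => (contrSign (fun k : ℤ => k < 0) k (k - (-n - 1)) *
      (F (k + 1) - F k)) • X) (fun k => ?_) using 2
    · rw [sub_add_cancel]; ring
    · have := hc k (-n - 1)
      rw [sub_add_cancel] at this
      rw [this, add_smul, add_sub_cancel_right]

theorem contrSign_eq_zero {k l : ℤ} (h : contrSign (fun k : ℤ => k < 0) k (k - l) ≠ 0) :
    k ∈ Set.Icc (-|l|) |l| := by
  unfold contrSign at h
  rw [Set.mem_Icc]
  by_contra hn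
  apply h
  rw [if_neg, if_neg, sub_zero]
  · rintro ⟨h1, h2⟩
    rcases abs_cases l with h3 | h3 <;> omega
  · rintro ⟨h1, h2⟩
    rcases abs_cases l with h3 | h3 <;> omega

/-- Summation of a double contraction along its diagonals. -/
theorem hasLSum_contraction {G : ℤ → Module.End ℂ V} {W : Module.End ℂ V} (w : ℤ → ℤ → ℂ)
    (F : ℤ → ℤ → ℂ) (hF : ∀ l k, F l (k + 1) - F l k = w k (k - l)) (hG : LocFin G)
    (hW : HasLSum (fun l => (F l l - F l 0) • G l) W) :
    HasLSum (fun x : ℤ × ℤ => (contrSign (fun k : ℤ => k < 0) x.1 x.2 * w x.1 x.2) •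
      G (x.1 - x.2)) W := by
  let e : ℤ × ℤ ≃ ℤ × ℤ :=
    { toFun := fun x => (x.1 - x.2, x.1)
      invFun := fun x => (x.2, x.2 - x.1)
      left_inv := fun x => by simp
      right_inv := fun x => by simp }
  let T : ℤ × ℤ → Module.End ℂ V := fun y =>
    (contrSign (fun k : ℤ => k < 0) y.2 (y.2 - y.1) * w y.2 (y.2 - y.1)) • G y.1
  have hT : LocFin T := by
    intro v
    have : (⋃ l ∈ (Function.support fun l => G l v),
        Prod.mk l '' Set.Icc (-|l|) |l|).Finite :=
      (hG v).biUnion fun l _ => (Set.finite_Icc _ _).image _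
    refine this.subset ?_
    rintro ⟨l, k⟩ hx
    simp only [T, Function.mem_support, LinearMap.smul_apply] at hx
    refine Set.mem_biUnion (x := l) (fun h => hx (by
      change G l v = 0 at h
      rw [h, smul_zero])) ⟨k, ?_, rfl⟩
    exact contrSign_eq_zero fun h => hx (by rw [h, zero_mul, zero_smul])
  obtain ⟨W', hW'⟩ := hT.exists_hasLSum
  -- Along a diagonal the operator factor is constant, so only the scalar kernel is summed.
  have h1 := hW'.fiberwise (Y := fun l => (F l l - F l 0) • G l) fun l => by
    refine (hasLSum_contrSign_telescope (F l) (G l) l).congr fun k => ?_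
    simp only [T, hF]
  rw [hW.unique h1]
  refine (hW'.comp_equiv e).congr fun x => ?_
  simp [T, e]

end Contraction

/-! ### The contribution of the trajectory -/

section TrajectoryOperators

variable {V : Type*} [AddCommGroup V] [Module ℂ V] {N : ℕ} {q p : Fin N → RField V}

/-- The canonical commutation relations of the trajectory and its momentum. -/
structure IsHeisenberg (q p : Fin N → RField V) : Prop where
  qq : ∀ μ ν, FComm (q μ) (q ν)
  pp : ∀ μ ν, FComm (p μ) (p ν)
  pq : ∀ μ ν k, adField (mode (p μ) k) (q ν) =
    if μ = ν then (1 / (2 * Real.pi) : ℂ) • trig V (LaurentPolynomial.T (-k)) else 0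

/-- `∫ :a^μ(t) p_μ(t): dt`. -/
def trajOp (p a : Fin N → RField V) : Module.End ℂ V := fieldInt (∑ μ, normalProd (p μ) (a μ))

/-- The modes of a vector of fields, in the order in which they are paired with momentum modes. -/
def dualModes (a : Fin N → RField V) (x : Fin N × ℤ) : Module.End ℂ V :=
  (2 * Real.pi : ℂ) • mode (a x.1) (-x.2)

theorem hasLSum_trajOp (p a : Fin N → RField V) :
    HasLSum (ordTerm (fun x : Fin N × ℤ => x.2 < 0) (fun x => mode (p x.1) x.2) (dualModes a))
      (trajOp p a) := by
  rw [trajOp, fieldInt_eq, map_sum]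
  refine HasLSum.of_fibers fun μ => ?_
  refine ((hasLSum_normalProd (p μ) (a μ) 0).smul (2 * Real.pi)).congr fun k => ?_
  unfold ordTerm normalTerm dualModes
  simp only [zero_sub]
  split_ifs <;> simp

theorem finite_mom_modes (p : Fin N → RField V) (v : V) :
    {x : Fin N × ℤ | ¬x.2 < 0 ∧ mode (p x.1) x.2 v ≠ 0}.Finite := by
  choose K hK using fun μ => exists_mode_eq_zero (p μ) v
  refine (Set.finite_iUnion fun μ => ((Set.finite_Icc 0 (K μ)).image (Prod.mk μ))).subset ?_
  rintro ⟨μ, k⟩ ⟨h1, h2⟩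
  refine Set.mem_iUnion.mpr ⟨μ, k, ⟨by simpa using h1, ?_⟩, rfl⟩
  by_contra h
  exact h2 (hK μ k (by omega))

theorem finite_dualModes (a : Fin N → RField V) (v : V) :
    {x : Fin N × ℤ | x.2 < 0 ∧ dualModes a x v ≠ 0}.Finite := by
  choose K hK using fun μ => exists_mode_eq_zero (a μ) v
  refine (Set.finite_iUnion fun μ => ((Set.finite_Icc (-K μ) 0).image (Prod.mk μ))).subset ?_
  rintro ⟨μ, k⟩ ⟨h1, h2⟩
  refine Set.mem_iUnion.mpr ⟨μ, k, ⟨?_, by simpa using h1.le⟩, rfl⟩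
  by_contra h
  exact h2 (by simp [dualModes, hK μ (-k) (by omega)])

theorem two_pi_ne_zero : (2 * Real.pi : ℂ) ≠ 0 := by
  simp [Real.pi_ne_zero]

/-- The canonical commutation relation selects the single momentum mode `(ν, -n)`; the factor `2π`
from the integral cancels that of the delta function. -/
theorem adField_trajOp_q (h : IsHeisenberg q p) {a : Fin N → RField V}
    (ha : ∀ μ ν, FComm (a μ) (q ν)) (ν : Fin N) : adField (trajOp p a) (q ν) = a ν := by
  refine mode_ext fun n => ?_
  have h1 : ∀ x : Fin N × ℤ, ⁅mode (p x.1) x.2, mode (q ν) n⁆ =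
      if x = (ν, -n) then (1 / (2 * Real.pi) : ℂ) • 1 else 0 := by
    rintro ⟨μ, k⟩
    rw [← mode_adField, h.pq]
    by_cases hμ : μ = ν
    · subst hμ
      simp only [if_true, mode_smul, mode_trig, coeff_T, Prod.mk.injEq, true_and]
      by_cases hk : -k = n
      · rw [if_pos hk, if_pos (by omega), one_smul]
      · rw [if_neg hk, if_neg (by omega), zero_smul, smul_zero]
    · simp [hμ]
  have h2 := hasLSum_lie_ordTerm (hasLSum_trajOp p a) (x := mode (q ν) n)
    (fun k => (ha k.1 ν _ _).smul_left _) (fun k => by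
      rw [h1]
      split_ifs
      · exact (Commute.one_left _).smul_left _
      · exact Commute.zero_left _)
  have h3 := HasLSum.single (T := fun k => dualModes a k * ⁅mode (p k.1) k.2, mode (q ν) n⁆)
    (ν, -n) (fun k hk => by simp only [h1, if_neg hk, mul_zero])
  rw [mode_adField, h2.unique h3, h1]
  rw [if_pos rfl, dualModes, smul_mul_smul_comm, mul_one_div_cancel two_pi_ne_zero, one_smul,
    mul_one, neg_neg]

theorem commute_fieldInt {a c : RField V} (h : FComm a c) (n : ℤ) :
    Commute (fieldInt a) (mode c n) := (h 0 n).smul_left _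

theorem adField_trajOp_eq_zero {a : Fin N → RField V} {c : RField V} (hp : ∀ μ, FComm (p μ) c)
    (ha : ∀ μ, FComm (a μ) c) : adField (trajOp p a) c = 0 :=
  adField_eq_zero fun n => commute_fieldInt
    (FComm.sum_left fun μ _ => (hp μ).normalProd_left (ha μ)) n

/-- The abstract commutator formula with pairs (component, mode number) as indices. The contraction
is prescribed separately for each pair of components, which leaves a purely integer double sum. -/
theorem lie_trajOp (h : IsHeisenberg q p) {a b : Fin N → RField V}
    (hab : ∀ μ ν, FComm (a μ) (b ν))
    (hXb : ∀ μ k ν σ, FComm (adField (mode (p μ) k) (a ν)) (b σ))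
    (hXY : ∀ μ k ν σ j τ,
      FComm (adField (mode (p μ) k) (a ν)) (adField (mode (p σ) j) (b τ)))
    {W : Fin N × Fin N → Module.End ℂ V}
    (hW : ∀ μ ν, HasLSum (fun x : ℤ × ℤ => contrSign (fun k : ℤ => k < 0) x.1 x.2 •
      (((2 * Real.pi : ℂ) • mode (adField (mode (p μ) x.1) (a ν)) (-x.2)) *
        ((2 * Real.pi : ℂ) • mode (adField (mode (p ν) x.2) (b μ)) (-x.1)))) (W (μ, ν))) :
    ⁅trajOp p a, trajOp p b⁆ =
      trajOp p (fun μ => adField (trajOp p a) (b μ) - adField (trajOp p b) (a μ)) + ∑ x, W x := by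
  have hl : ∀ (Y : Module.End ℂ V) (a : Fin N → RField V) (x : Fin N × ℤ),
      ⁅Y, dualModes a x⁆ = (2 * Real.pi : ℂ) • mode (adField Y (a x.1)) (-x.2) := by
    intro Y a x
    rw [mode_adField]
    simp [dualModes, Ring.lie_def, smul_sub]
  refine lie_of_hasLSum_ordTerm (finite_mom_modes p) (finite_dualModes a) (finite_dualModes b)
    (fun k j => h.pp _ _ _ _) (fun k j => ((hab _ _ _ _).smul_left _).smul_right _) ?_ ?_
    (hasLSum_trajOp p a) (hasLSum_trajOp p b) ?_ ?_
  · intro k j i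
    rw [hl]
    exact ((hXb _ _ _ _ _ _).smul_left _).smul_right _
  · intro k j i l
    rw [hl, hl]
    exact ((hXY _ _ _ _ _ _ _ _).smul_left _).smul_right _
  · refine (hasLSum_trajOp p _).congr fun x => ?_
    congr 1
    funext k
    rw [hl, hl, dualModes, mode_sub, smul_sub]
  · let e : (Fin N × ℤ) × (Fin N × ℤ) ≃ (Fin N × Fin N) × (ℤ × ℤ) := Equiv.prodProdProdComm _ _ _ _
    have h1 := (HasLSum.of_fibers (T := fun y : (Fin N × Fin N) × (ℤ × ℤ) =>
      contrSign (fun k : ℤ => k < 0) y.2.1 y.2.2 •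
      (((2 * Real.pi : ℂ) • mode (adField (mode (p y.1.1) y.2.1) (a y.1.2)) (-y.2.2)) *
        ((2 * Real.pi : ℂ) • mode (adField (mode (p y.1.2) y.2.2) (b y.1.1)) (-y.2.1))))
      (fun x => hW x.1 x.2)).comp_equiv e
    refine h1.congr fun x => ?_
    rw [hl, hl]
    rfl

end TrajectoryOperators

/-! ### Brackets of diffeomorphisms and reparametrizations on the trajectory -/

section TrajectoryBrackets

variable {V : Type*} [AddCommGroup V] [Module ℂ V] {N : ℕ} {q p : Fin N → RField V}

theorem hasLSum_fieldInt {a b : RField V} (h : FComm a b) :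
    HasLSum (fun l => (2 * Real.pi : ℂ) • (mode a l * mode b (-l)))
      (fieldInt (normalProd a b)) := by
  simpa only [zero_sub, fieldInt] using (hasLSum_normalProd_of_comm h 0).smul (2 * Real.pi)

theorem locFin_mul_neg {a b : RField V} (h : FComm a b) :
    LocFin (fun l : ℤ => mode a l * mode b (-l)) := by
  simpa only [zero_sub] using (hasLSum_normalProd_of_comm h 0).locFin

/-- `∫ (d/dt f(q(t))) g(q(t)) dt`. -/
def trajForm (q : Fin N → RField V) (f g : MvPolynomial (Fin N) ℂ) : Module.End ℂ V :=
  fieldInt (normalProd (fieldDeriv (onTrajectory q f)) (onTrajectory q g))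

theorem IsHeisenberg.fcomm_onTrajectory (h : IsHeisenberg q p) (f g : MvPolynomial (Fin N) ℂ) :
    FComm (onTrajectory q f) (onTrajectory q g) :=
  FComm.onTrajectory_left (fun μ => FComm.onTrajectory_right (fun ν => h.qq ν μ) g) f

theorem IsHeisenberg.fcomm_q_onTrajectory (h : IsHeisenberg q p) (μ : Fin N)
    (f : MvPolynomial (Fin N) ℂ) : FComm (q μ) (onTrajectory q f) :=
  FComm.onTrajectory_right (fun ν => h.qq ν μ) f

theorem adField_mom_onTrajectory (h : IsHeisenberg q p) (μ : Fin N) (k : ℤ)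
    (f : MvPolynomial (Fin N) ℂ) :
    adField (mode (p μ) k) (onTrajectory q f) = (1 / (2 * Real.pi) : ℂ) •
      normalProd (trig V (LaurentPolynomial.T (-k)))
        (onTrajectory q (MvPolynomial.pderiv μ f)) := by
  rw [(isFieldDer_adField _).onTrajectory h.qq ?_ f]
  · simp only [h.pq]
    rw [Finset.sum_eq_single μ]
    · rw [if_pos rfl, normalProd_eq, map_smul, LinearMap.smul_apply, ← normalProd_eq]
    · intro ν _ hν
      rw [if_neg (Ne.symm hν), normalProd_eq, map_zero, LinearMap.zero_apply]
    · simp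
  · intro ν σ
    rw [h.pq]
    split_ifs
    · exact (FComm.trig_left _ _).smul_left _
    · exact FComm.zero_left _

theorem mode_adField_mom_onTrajectory (h : IsHeisenberg q p) (μ : Fin N) (k n : ℤ)
    (f : MvPolynomial (Fin N) ℂ) :
    (2 * Real.pi : ℂ) • mode (adField (mode (p μ) k) (onTrajectory q f)) n =
      mode (onTrajectory q (MvPolynomial.pderiv μ f)) (n + k) := by
  rw [adField_mom_onTrajectory h, mode_smul, smul_smul, mul_one_div_cancel two_pi_ne_zero,
    one_smul, mode_trig_T_normalProd, sub_neg_eq_add]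

theorem FComm.adField_mom_onTrajectory_left (h : IsHeisenberg q p) (μ : Fin N) (k : ℤ)
    (f : MvPolynomial (Fin N) ℂ) {c : RField V} (hc : ∀ μ, FComm (q μ) c) :
    FComm (adField (mode (p μ) k) (onTrajectory q f)) c := by
  rw [adField_mom_onTrajectory h]
  exact ((FComm.trig_left _ _).normalProd_left (FComm.onTrajectory_left hc _)).smul_left _

theorem adField_trajOp_onTrajectory (h : IsHeisenberg q p) {a : Fin N → RField V}
    (ha : ∀ μ ν, FComm (a μ) (q ν)) (f : MvPolynomial (Fin N) ℂ) :
    adField (trajOp p a) (onTrajectory q f) =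
      ∑ μ, normalProd (a μ) (onTrajectory q (MvPolynomial.pderiv μ f)) := by
  rw [(isFieldDer_adField _).onTrajectory h.qq ?_ f]
  · simp only [adField_trajOp_q h ha]
  · intro μ ν
    rw [adField_trajOp_q h ha]
    exact ha μ ν

/-- The commutator of two vector fields along the trajectory. -/
theorem lie_trajOp_onTrajectory (h : IsHeisenberg q p) (ξ η : VecField N) :
    ⁅trajOp p (fun μ => onTrajectory q (ξ μ)), trajOp p (fun μ => onTrajectory q (η μ))⁆ =
      trajOp p (fun μ => onTrajectory q (vecBracket ξ η μ)) +
        (1 / (2 * Real.pi * Complex.I) : ℂ) • ∑ μ, ∑ ν,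
          trajForm q (MvPolynomial.pderiv ν (ξ μ)) (MvPolynomial.pderiv μ (η ν)) := by
  have hξ : ∀ (ξ : VecField N) μ ν, FComm (onTrajectory q (ξ μ)) (q ν) :=
    fun ξ μ ν => (h.fcomm_q_onTrajectory ν _).symm
  rw [lie_trajOp h (fun μ ν => h.fcomm_onTrajectory _ _)
    (fun μ k ν σ => FComm.adField_mom_onTrajectory_left h _ _ _ fun μ =>
      h.fcomm_q_onTrajectory μ _)
    (fun μ k ν σ j τ => FComm.adField_mom_onTrajectory_left h _ _ _ fun μ =>
      (FComm.adField_mom_onTrajectory_left h _ _ _ fun ν => h.qq ν μ).symm)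
    (W := fun x => (1 / (2 * Real.pi * Complex.I) : ℂ) • trajForm q
      (MvPolynomial.pderiv x.1 (ξ x.2)) (MvPolynomial.pderiv x.2 (η x.1))) ?_]
  · congr 1
    · congr 1
      funext μ
      rw [adField_trajOp_onTrajectory h (hξ ξ), adField_trajOp_onTrajectory h (hξ η),
        ← Finset.sum_sub_distrib, vecBracket, onTrajectory_eq, map_sum]
      refine Finset.sum_congr rfl fun ν _ => ?_
      rw [map_sub, ← onTrajectory_eq, ← onTrajectory_eq, onTrajectory_mul h.qq,
        onTrajectory_mul h.qq]
    · rw [Fintype.sum_prod_type_right, Finset.smul_sum]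
      simp only [Finset.smul_sum]
  · intro μ ν
    have hc := h.fcomm_onTrajectory (MvPolynomial.pderiv μ (ξ ν)) (MvPolynomial.pderiv ν (η μ))
    -- The kernel is constant, so the diagonal `l` yields the factor `l`: up to `i`, a time
    -- derivative on the first function.
    have h1 := hasLSum_contraction (fun _ _ => 1) (fun _ k => (k : ℂ)) (by simp)
      (locFin_mul_neg hc) (((hasLSum_fieldInt hc.deriv_left).smul
        (1 / (2 * Real.pi * Complex.I))).congr fun l => ?_)
    · refine h1.congr fun x => ?_
      rw [mode_adField_mom_onTrajectory h, mode_adField_mom_onTrajectory h, mul_one,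
        show -x.2 + x.1 = x.1 - x.2 by ring, show -x.1 + x.2 = -(x.1 - x.2) by ring]
    · rw [mode_fieldDeriv, smul_mul_assoc, smul_smul, smul_smul]
      congr 1
      have := two_pi_ne_zero
      have := Complex.I_ne_zero
      field_simp
      simp

/-- The components of the vector field on the trajectory that generates reparametrizations. -/
def reparField (q : Fin N → RField V) (f : ℂ[T;T⁻¹]) (μ : Fin N) : RField V :=
  -normalProd (trig V f) (fieldDeriv (q μ))

theorem FComm.reparField_left {c : RField V} (f : ℂ[T;T⁻¹]) (μ : Fin N) (hc : FComm (q μ) c) :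
    FComm (reparField q f μ) c :=
  fun m n => ((FComm.trig_left f c).normalProd_left hc.deriv_left m n).neg_left

theorem adField_trig (Y : Module.End ℂ V) (f : ℂ[T;T⁻¹]) : adField Y (trig V f) = 0 :=
  adField_eq_zero fun n => by
    rw [mode_trig]
    exact (Commute.one_right _).smul_right _

theorem adField_fieldDeriv (Y : Module.End ℂ V) (a : RField V) :
    adField Y (fieldDeriv a) = fieldDeriv (adField Y a) := mode_ext fun n => by
  simp [mode_adField, Ring.lie_def, smul_sub]

theorem adField_reparField (Y : Module.End ℂ V) (f : ℂ[T;T⁻¹]) (μ : Fin N) :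
    adField Y (reparField q f μ) = -normalProd (trig V f) (fieldDeriv (adField Y (q μ))) := by
  rw [reparField, map_neg, adField_normalProd, adField_trig, adField_fieldDeriv, normalProd_eq 0,
    map_zero, LinearMap.zero_apply, zero_add]

theorem adField_mom_reparField (h : IsHeisenberg q p) (f : ℂ[T;T⁻¹]) (μ ν : Fin N) (k : ℤ) :
    adField (mode (p μ) k) (reparField q f ν) =
      if μ = ν then (1 / (2 * Real.pi) * (Complex.I * k) : ℂ) •
        normalProd (trig V (LaurentPolynomial.T (-k))) (trig V f) else 0 := by
  rw [adField_reparField, h.pq]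
  split_ifs
  · have h1 : fieldDeriv ((1 / (2 * Real.pi) : ℂ) • trig V (LaurentPolynomial.T (-k))) =
        -(1 / (2 * Real.pi) * (Complex.I * k) : ℂ) • trig V (LaurentPolynomial.T (-k)) := by
      refine mode_ext fun n => ?_
      simp only [mode_fieldDeriv, mode_smul, mode_trig, coeff_T]
      split_ifs with hn
      · subst hn
        rw [smul_smul]
        push_cast
        ring_nf
      · simp
    rw [h1, normalProd_comm (FComm.trig_left _ _), normalProd_eq, map_smul, LinearMap.smul_apply,
      neg_smul, neg_neg, normalProd_eq]
  · have h1 : fieldDeriv (0 : RField V) = 0 := mode_ext fun n => by simp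
    rw [h1, normalProd_eq, map_zero, neg_zero]

theorem mode_adField_mom_reparField (h : IsHeisenberg q p) (f : ℂ[T;T⁻¹]) (μ ν : Fin N)
    (k n : ℤ) :
    (2 * Real.pi : ℂ) • mode (adField (mode (p μ) k) (reparField q f ν)) n =
      if μ = ν then (Complex.I * k : ℂ) • mode (trig V f) (n + k) else 0 := by
  rw [adField_mom_reparField h]
  split_ifs
  · rw [mode_smul, smul_smul, mode_trig_T_normalProd, sub_neg_eq_add, ← mul_assoc,
      mul_one_div_cancel two_pi_ne_zero, one_mul]
  · simp

theorem FComm.adField_mom_reparField_left (h : IsHeisenberg q p) (f : ℂ[T;T⁻¹]) (μ ν : Fin N)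
    (k : ℤ) (c : RField V) : FComm (adField (mode (p μ) k) (reparField q f ν)) c := by
  rw [adField_mom_reparField h]
  split_ifs
  · exact ((FComm.trig_left _ _).normalProd_left (FComm.trig_left _ _)).smul_left _
  · exact FComm.zero_left _

theorem adField_trajOp_reparField_onTrajectory (h : IsHeisenberg q p) (f : ℂ[T;T⁻¹])
    (g : MvPolynomial (Fin N) ℂ) :
    adField (trajOp p (reparField q f)) (onTrajectory q g) =
      -normalProd (trig V f) (fieldDeriv (onTrajectory q g)) := by
  rw [adField_trajOp_onTrajectory h (fun μ ν => FComm.reparField_left f μ (h.qq μ ν))]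
  have h1 := isFieldDer_fieldDeriv.onTrajectory h.qq (fun μ ν => (h.qq μ ν).deriv_left) g
  change fieldDeriv _ = ∑ μ, normalProd (fieldDeriv (q μ)) _ at h1
  rw [h1, normalProd_eq (trig V f), map_sum, ← Finset.sum_neg_distrib]
  refine Finset.sum_congr rfl fun μ _ => ?_
  rw [reparField, normalProd_eq (-_), map_neg, LinearMap.neg_apply, ← normalProd_eq,
    ← normalProd_eq, normalProd_assoc (FComm.trig_left _ _) (FComm.trig_left _ _)
      (h.fcomm_q_onTrajectory μ _).deriv_left]

/-- The commutator of reparametrizations and vector fields along the trajectory. -/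
theorem lie_trajOp_reparField_onTrajectory (h : IsHeisenberg q p) (f : ℂ[T;T⁻¹])
    (ξ : VecField N) :
    ⁅trajOp p (reparField q f), trajOp p (fun μ => onTrajectory q (ξ μ))⁆ =
      (1 / (4 * Real.pi * Complex.I) : ℂ) •
        smear (circDeriv (circDeriv f) - Complex.I • circDeriv f)
          (onTrajectory q (∑ μ, MvPolynomial.pderiv μ (ξ μ))) := by
  have hξ : ∀ μ ν, FComm (onTrajectory q (ξ μ)) (q ν) :=
    fun μ ν => (h.fcomm_q_onTrajectory ν _).symm
  rw [lie_trajOp h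
    (fun μ ν => FComm.reparField_left f μ (h.fcomm_q_onTrajectory μ _))
    (fun μ k ν σ => FComm.adField_mom_reparField_left h _ _ _ _ _)
    (fun μ k ν σ j τ => FComm.adField_mom_reparField_left h _ _ _ _ _)
    (W := fun x => if x.1 = x.2 then (1 / (4 * Real.pi * Complex.I) : ℂ) •
        smear (circDeriv (circDeriv f) - Complex.I • circDeriv f)
          (onTrajectory q (MvPolynomial.pderiv x.1 (ξ x.2))) else 0) ?_]
  · have h0 : (fun μ => adField (trajOp p (reparField q f)) (onTrajectory q (ξ μ)) -
        adField (trajOp p fun μ => onTrajectory q (ξ μ)) (reparField q f μ)) = fun _ => 0 := by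
      funext μ
      rw [adField_trajOp_reparField_onTrajectory h, adField_reparField, adField_trajOp_q h hξ,
        sub_self]
    have h1 : trajOp p (fun _ => 0) = 0 := by
      simp [trajOp, normalProd_eq, fieldInt_eq]
    rw [h0, h1, zero_add, Fintype.sum_prod_type]
    simp only [Finset.sum_ite_eq, Finset.mem_univ, if_true]
    simp only [smear_eq, fieldInt_eq, normalProd_eq, onTrajectory_eq, map_sum, Finset.smul_sum]
  · intro μ ν
    simp only [mode_adField_mom_onTrajectory h, mode_adField_mom_reparField h]
    by_cases hμ : μ = ν
    · subst hμ
      simp only [if_true]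
      have hc := FComm.trig_left f (onTrajectory q (MvPolynomial.pderiv μ (ξ μ)))
      rw [smear_eq]
      -- Here `F(l,l) - F(l,0) = i l(l-1)/2`, which is the symbol of `f̈ - i ḟ` up to the prefactor.
      -- The linear term comes from starting the sum at the creation/annihilation boundary.
      have h1 := hasLSum_contraction (fun k _ => Complex.I * k)
        (fun _ k => Complex.I * (k * (k - 1) / 2)) (by intro l k; push_cast; ring)
        (locFin_mul_neg hc) (((hasLSum_fieldInt (FComm.trig_left (circDeriv (circDeriv f) -
          Complex.I • circDeriv f) (onTrajectory q (MvPolynomial.pderiv μ (ξ μ))))).smul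
          (1 / (4 * Real.pi * Complex.I))).congr fun l => ?_)
      · refine h1.congr fun x => ?_
        rw [show -x.2 + x.1 = x.1 - x.2 by ring, show -x.1 + x.2 = -(x.1 - x.2) by ring,
          smul_mul_assoc, smul_smul]
      · simp only [mode_trig, smul_mul_assoc, smul_smul]
        congr 1
        rw [AddMonoidAlgebra.coeff_sub, AddMonoidAlgebra.coeff_smul, Finsupp.sub_apply,
          Finsupp.smul_apply, coeff_circDeriv, coeff_circDeriv]
        have := two_pi_ne_zero
        have := Complex.I_ne_zero
        simp only [smul_eq_mul]
        field_simp
        ring_nf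
    · simp only [if_neg hμ, zero_mul, smul_zero]
      exact HasLSum.zero

/-- The commutator of two reparametrizations of the trajectory. -/
theorem lie_trajOp_reparField (h : IsHeisenberg q p) (f g : ℂ[T;T⁻¹]) :
    ⁅trajOp p (reparField q f), trajOp p (reparField q g)⁆ =
      trajOp p (reparField q (circBracket f g)) +
        ((2 * N) / (24 * Real.pi * Complex.I) *
          circInt (circDeriv (circDeriv f) * circDeriv g - circDeriv f * g) : ℂ) • 1 := by
  have hq : ∀ (f : ℂ[T;T⁻¹]) μ ν, FComm (reparField q f μ) (q ν) :=
    fun f μ ν => FComm.reparField_left f μ (h.qq μ ν)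
  rw [lie_trajOp h
    (fun μ ν => FComm.reparField_left f μ (FComm.reparField_left g ν (h.qq ν μ)).symm)
    (fun μ k ν σ => FComm.adField_mom_reparField_left h _ _ _ _ _)
    (fun μ k ν σ j τ => FComm.adField_mom_reparField_left h _ _ _ _ _)
    (W := fun x => if x.1 = x.2 then (2 / (24 * Real.pi * Complex.I) *
          circInt (circDeriv (circDeriv f) * circDeriv g - circDeriv f * g) : ℂ) • 1 else 0) ?_]
  · congr 1
    · congr 1
      funext μ
      -- The term with `q̈` is symmetric in `f` and `g` and drops out of the difference.
      have key : ∀ f g : ℂ[T;T⁻¹], adField (trajOp p (reparField q f)) (reparField q g μ) =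
          normalProd (trig V (g * circDeriv f)) (fieldDeriv (q μ)) +
            normalProd (trig V (g * f)) (fieldDeriv (fieldDeriv (q μ))) := by
        intro f g
        have h1 : fieldDeriv (reparField q f μ) =
            -fieldDeriv (normalProd (trig V f) (fieldDeriv (q μ))) :=
          map_neg (fieldDerivL V) _
        rw [adField_reparField, adField_trajOp_q h (hq f), h1, fieldDeriv_normalProd,
          fieldDeriv_trig, normalProd_eq (trig V g), map_neg, neg_neg, map_add, ← normalProd_eq,
          ← normalProd_eq, ← normalProd_assoc (FComm.trig_left _ _) (FComm.trig_left _ _)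
          (FComm.trig_left _ _), ← normalProd_assoc (FComm.trig_left _ _) (FComm.trig_left _ _)
          (FComm.trig_left _ _), trig_mul, trig_mul]
      rw [key, key, mul_comm f g, add_sub_add_right_eq_sub, reparField, circBracket]
      change _ = -normalProd (trigL V _) _
      rw [map_sub, normalProd_eq (_ - _), map_sub, LinearMap.sub_apply, neg_sub]
      rfl
    · rw [Fintype.sum_prod_type]
      simp only [Finset.sum_ite_eq, Finset.mem_univ, if_true, Finset.sum_const, Finset.card_univ,
        Fintype.card_fin]
      rw [← Nat.cast_smul_eq_nsmul ℂ, smul_smul]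
      congr 1
      ring
  · intro μ ν
    simp only [mode_adField_mom_reparField h]
    by_cases hμ : μ = ν
    · subst hμ
      simp only [if_true]
      have hc := FComm.trig_left f (trig V g)
      have hI : ∀ f g : ℂ[T;T⁻¹], fieldInt (normalProd (trig V f) (trig V g)) =
          circInt (f * g) • 1 := by
        intro f g
        rw [← trig_mul, fieldInt, mode_trig, smul_smul, circInt]
      have hsum := ((hasLSum_fieldInt (FComm.trig_left (circDeriv (circDeriv f))
        (trig V (circDeriv g)))).sub (hasLSum_fieldInt (FComm.trig_left (circDeriv f)
        (trig V g)))).smul (2 / (24 * Real.pi * Complex.I))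
      have hcirc : circInt (circDeriv (circDeriv f) * circDeriv g - circDeriv f * g) =
          circInt (circDeriv (circDeriv f) * circDeriv g) - circInt (circDeriv f * g) := by
        unfold circInt
        rw [AddMonoidAlgebra.coeff_sub, Finsupp.sub_apply, mul_sub]
      rw [hI, hI, ← sub_smul, ← hcirc, smul_smul] at hsum
      -- With `j = k - l` the discrete primitive gives `F(l,l) - F(l,0) = (l³ - l)/6`, the Virasoro
      -- cocycle; each of the `N` components contributes `2` to `c₄`.
      have h1 := hasLSum_contraction (fun k j => -(k * j : ℂ))
        (fun l k => -(k * (k - 1) * (2 * k - 1) / 6 - l * (k * (k - 1)) / 2))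
        (by intro l k; push_cast; ring)
        (locFin_mul_neg hc) (hsum.congr fun l => ?_)
      · refine h1.congr fun x => ?_
        rw [show -x.2 + x.1 = x.1 - x.2 by ring, show -x.1 + x.2 = -(x.1 - x.2) by ring,
          smul_mul_smul_comm, smul_smul]
        congr 2
        linear_combination (x.1 * x.2 : ℂ) * Complex.I_mul_I
      · simp only [mode_trig, smul_mul_smul_comm, smul_smul, ← sub_smul, coeff_circDeriv, mul_one]
        congr 1
        have := two_pi_ne_zero
        have := Complex.I_ne_zero
        field_simp
        push_cast
        linear_combination (l ^ 3 * f.coeff l * g.coeff (-l) * 48 : ℂ) * Complex.I_sq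
    · simp only [if_neg hμ, zero_mul, smul_zero]
      exact HasLSum.zero

end TrajectoryBrackets

/-! ### Multi-indices -/

section MultiIndex

variable {N : ℕ}

theorem mem_jets {q : ℕ} {m : Fin N → ℕ} : m ∈ jets N q ↔ ∑ μ, m μ ≤ q := by
  unfold jets
  rw [Finset.mem_filter, Fintype.mem_piFinset]
  refine ⟨fun h => h.2, fun h => ⟨fun μ => ?_, h⟩⟩
  rw [Finset.mem_range]
  exact Nat.lt_succ_of_le ((Finset.single_le_sum (fun ν _ => Nat.zero_le (m ν))
    (Finset.mem_univ μ)).trans h)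

theorem multiIndex_induction {P : (Fin N → ℕ) → Prop} (h0 : P 0)
    (hs : ∀ m μ, P m → P (m + Pi.single μ 1)) (m : Fin N → ℕ) : P m := by
  induction h : ∑ μ, m μ generalizing m with
  | zero =>
    have : m = 0 := funext fun μ => (Finset.sum_eq_zero_iff.mp h) μ (Finset.mem_univ μ)
    rwa [this]
  | succ n ih =>
    obtain ⟨μ, -, hμ⟩ : ∃ μ ∈ Finset.univ, m μ ≠ 0 :=
      Finset.exists_ne_zero_of_sum_ne_zero (by omega)
    have hm : m = (m - Pi.single μ 1) + Pi.single μ 1 := by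
      funext ν
      by_cases hν : ν = μ
      · subst hν; simp; omega
      · simp [hν]
    rw [hm]
    refine hs _ _ (ih _ ?_)
    have h2 : ∑ ν, m ν = ∑ ν, (m - Pi.single μ 1 : Fin N → ℕ) ν + 1 := by
      conv_lhs => rw [hm]
      simp [Finset.sum_add_distrib]
    omega

/-- The commutator of two derivations is a derivation, and this one kills the generators. -/
theorem pderiv_comm {R : Type*} [CommRing R] (μ ν : Fin N) (f : MvPolynomial (Fin N) R) :
    MvPolynomial.pderiv μ (MvPolynomial.pderiv ν f) =
      MvPolynomial.pderiv ν (MvPolynomial.pderiv μ f) := by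
  have h : ⁅(MvPolynomial.pderiv μ : Derivation R (MvPolynomial (Fin N) R)
      (MvPolynomial (Fin N) R)), (MvPolynomial.pderiv ν : Derivation R (MvPolynomial (Fin N) R)
      (MvPolynomial (Fin N) R))⁆ = 0 := by
    refine MvPolynomial.derivation_ext fun i => ?_
    rw [Derivation.commutator_apply, MvPolynomial.pderiv_X, MvPolynomial.pderiv_X]
    simp only [Pi.single_apply]
    split_ifs <;> simp
  have := DFunLike.congr_fun h f
  rwa [Derivation.commutator_apply, Derivation.zero_apply, sub_eq_zero] at this

theorem multiDeriv_zero (f : MvPolynomial (Fin N) ℂ) : multiDeriv 0 f = f := by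
  have : ∀ l : List (Fin N), l.foldr (fun μ g => (MvPolynomial.pderiv μ)^[(0 : Fin N → ℕ) μ] g) f
      = f := by
    intro l
    induction l with
    | nil => rfl
    | cons a l ih => rw [List.foldr_cons, ih]; rfl
  exact this _

theorem multiDeriv_add_single (m : Fin N → ℕ) (μ : Fin N) (f : MvPolynomial (Fin N) ℂ) :
    multiDeriv (m + Pi.single μ 1) f = MvPolynomial.pderiv μ (multiDeriv m f) :=
  foldr_iterate_succ (P := fun _ => True) (g := fun μ => MvPolynomial.pderiv μ) (by simp)
    (fun μ ν x _ => pderiv_comm μ ν x) m _ μ (fun _ => by simp [Pi.single_apply]) trivial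

theorem multiDeriv_pderiv (m : Fin N → ℕ) (μ : Fin N) (f : MvPolynomial (Fin N) ℂ) :
    multiDeriv m (MvPolynomial.pderiv μ f) = MvPolynomial.pderiv μ (multiDeriv m f) :=
  foldr_iterate_comm (P := fun _ => True) (g := fun μ => MvPolynomial.pderiv μ) (by simp)
    (fun μ ν x _ => pderiv_comm μ ν x) m _ μ trivial

/-- The product of the factorials. -/
def multiFact (m : Fin N → ℕ) : ℂ := ∏ μ, ((m μ).factorial : ℂ)

theorem multiFact_ne_zero (m : Fin N → ℕ) : multiFact m ≠ 0 :=
  Finset.prod_ne_zero_iff.mpr fun _ _ => Nat.cast_ne_zero.mpr (Nat.factorial_ne_zero _)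

theorem multiFact_zero : multiFact (0 : Fin N → ℕ) = 1 := by simp [multiFact]

theorem multiFact_add_single (m : Fin N → ℕ) (μ : Fin N) :
    multiFact (m + Pi.single μ 1) = (m μ + 1) * multiFact m := by
  unfold multiFact
  rw [← Finset.mul_prod_erase _ _ (Finset.mem_univ μ), ← Finset.mul_prod_erase (Finset.univ)
    (fun μ => ((m μ).factorial : ℂ)) (Finset.mem_univ μ), ← mul_assoc]
  congr 1
  · simp [Nat.factorial_succ]
  · refine Finset.prod_congr rfl fun ν hν => ?_
    simp [Finset.ne_of_mem_erase hν]

theorem multiFact_div {m n : Fin N → ℕ} (h : n ≤ m) :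
    multiFact m / multiFact n = multiChoose m n * multiFact (m - n) := by
  rw [div_eq_iff (multiFact_ne_zero n)]
  unfold multiFact multiChoose
  rw [Nat.cast_prod, ← Finset.prod_mul_distrib, ← Finset.prod_mul_distrib]
  refine Finset.prod_congr rfl fun μ _ => ?_
  rw [← Nat.choose_mul_factorial_mul_factorial (h μ)]
  push_cast
  rw [Pi.sub_apply]
  ring

theorem multiChoose_eq_zero {m n : Fin N → ℕ} (h : ¬n ≤ m) : multiChoose m n = 0 := by
  rw [Pi.le_def, not_forall] at h
  obtain ⟨μ, hμ⟩ := h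
  exact Finset.prod_eq_zero (Finset.mem_univ μ) (Nat.choose_eq_zero_of_lt (not_le.mp hμ))

theorem multiChoose_self (m : Fin N → ℕ) : multiChoose m m = 1 := by simp [multiChoose]

/-- A multi-index as a finitely supported function. -/
abbrev expo (m : Fin N → ℕ) : Fin N →₀ ℕ := Finsupp.equivFunOnFinite.symm m

theorem expo_add_single (m : Fin N → ℕ) (μ : Fin N) :
    expo (m + Pi.single μ 1) = expo m + Finsupp.single μ 1 := by
  ext ν
  simp [Finsupp.single_apply, Pi.single_apply, eq_comm]

theorem expo_sub (m n : Fin N → ℕ) : expo (m - n) = expo m - expo n := by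
  ext ν; simp

theorem expo_sub_single (m : Fin N → ℕ) (μ : Fin N) :
    expo (m - Pi.single μ 1) = expo m - Finsupp.single μ 1 := by
  ext ν
  simp [Finsupp.single_apply, Pi.single_apply, eq_comm]

end MultiIndex

/-! ### Taylor expansion -/

section Taylor

open MvPolynomial

variable {N : ℕ}

section PolyDer

variable {A : Type*} [CommRing A]

/-- The vector field with components `a`. -/
def polyDer (a : Fin N → MvPolynomial (Fin N) A) :
    Derivation A (MvPolynomial (Fin N) A) (MvPolynomial (Fin N) A) := mkDerivation A a

theorem polyDer_apply (a : Fin N → MvPolynomial (Fin N) A) (G : MvPolynomial (Fin N) A) :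
    polyDer a G = ∑ μ, a μ * pderiv μ G := by
  have : polyDer a = ∑ μ, a μ •
      (pderiv μ : Derivation A (MvPolynomial (Fin N) A) (MvPolynomial (Fin N) A)) := by
    refine derivation_ext fun ν => ?_
    rw [polyDer, mkDerivation_X, ← Derivation.coeFnAddMonoidHom_apply, map_sum, Finset.sum_apply]
    simp [pderiv_X, Pi.single_apply]
  rw [this, ← Derivation.coeFnAddMonoidHom_apply, map_sum, Finset.sum_apply]
  rfl

theorem polyDer_lie (a b : Fin N → MvPolynomial (Fin N) A) (G : MvPolynomial (Fin N) A) :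
    polyDer a (polyDer b G) - polyDer b (polyDer a G) =
      polyDer (fun ν => polyDer a (b ν) - polyDer b (a ν)) G := by
  have key : ⁅polyDer a, polyDer b⁆ = polyDer (fun ν => polyDer a (b ν) - polyDer b (a ν)) := by
    refine derivation_ext fun ν => ?_
    rw [Derivation.commutator_apply]
    simp only [polyDer, mkDerivation_X]
  rw [← key, Derivation.commutator_apply]

end PolyDer

section Base

variable {A : Type*} [CommRing A] [Algebra ℂ A]

/-- The expansion of a polynomial function at the point `x`. -/
def taylorAt (x : Fin N → A) : MvPolynomial (Fin N) ℂ →ₐ[ℂ] MvPolynomial (Fin N) A :=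
  aeval fun μ => C (x μ) + X μ

theorem taylorAt_C (x : Fin N → A) (c : ℂ) : taylorAt x (C c) = C (algebraMap ℂ A c) := by
  rw [← MvPolynomial.algebraMap_eq, AlgHom.commutes, MvPolynomial.algebraMap_apply]

theorem pderiv_taylorAt (x : Fin N → A) (μ : Fin N) (f : MvPolynomial (Fin N) ℂ) :
    pderiv μ (taylorAt x f) = taylorAt x (pderiv μ f) := by
  induction f using MvPolynomial.induction_on with
  | C c => rw [pderiv_C, map_zero, taylorAt_C, pderiv_C]
  | add f g hf hg => rw [map_add, map_add, hf, hg, map_add, map_add]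
  | mul_X f ν hf =>
    rw [map_mul, Derivation.leibniz, Derivation.leibniz, hf, map_add, smul_eq_mul, smul_eq_mul,
      smul_eq_mul, smul_eq_mul, map_mul, map_mul]
    congr 2
    rw [taylorAt, aeval_X, map_add, pderiv_C, zero_add, pderiv_X, pderiv_X]
    simp only [Pi.single_apply]
    split_ifs <;> simp

theorem constantCoeff_taylorAt (x : Fin N → A) (f : MvPolynomial (Fin N) ℂ) :
    constantCoeff (taylorAt x f) = aeval x f := by
  induction f using MvPolynomial.induction_on with
  | C c => rw [taylorAt_C, constantCoeff_C, aeval_C]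
  | add f g hf hg => rw [map_add, map_add, hf, hg, map_add]
  | mul_X f ν hf =>
    rw [map_mul, map_mul, hf, taylorAt, aeval_X, map_add, constantCoeff_C, constantCoeff_X,
      add_zero, map_mul, aeval_X]

/-- The entry of the matrix of `T` in the basis of the divided powers. -/
def jetEntry (T : Module.End A (MvPolynomial (Fin N) A)) (m n : Fin N → ℕ) : A :=
  (multiFact m / multiFact n) • coeff (expo m) (T (monomial (expo n) 1))

/-- The matrix of `T` on jets of order `q`. -/
def jetMat (q : ℕ) (T : Module.End A (MvPolynomial (Fin N) A)) :
    Matrix (jets N q) (jets N q) A :=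
  Matrix.of fun m n => jetEntry T m n

/-- `T` does not lower the degree. -/
def IsFiltered (T : Module.End A (MvPolynomial (Fin N) A)) : Prop :=
  ∀ m n : Fin N → ℕ, jetEntry T m n ≠ 0 → ∑ μ, n μ ≤ ∑ μ, m μ

/-- `jetMat` as a linear map. -/
def jetMatL (N q : ℕ) (A : Type*) [CommRing A] [Algebra ℂ A] :
    Module.End A (MvPolynomial (Fin N) A) →ₗ[A] Matrix (jets N q) (jets N q) A where
  toFun := jetMat q
  map_add' T T' := by ext1 m n; simp [jetMat, jetEntry, smul_add]
  map_smul' c T := by ext1 m n; simp [jetMat, jetEntry]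

/-- If the left factor does not lower the degree, a row `m` with `|m| ≤ q` only meets intermediate
indices `n` with `|n| ≤ |m|`, so cutting off at `q` loses nothing. No condition on the right factor
is needed. -/
theorem jetMat_mul (q : ℕ) {T T' : Module.End A (MvPolynomial (Fin N) A)}
    (hT : IsFiltered T) : jetMat q (T * T') = jetMat q T * jetMat q T' := by
  classical
  ext1 m s
  rw [Matrix.mul_apply]
  change jetEntry _ _ _ = ∑ n : jets N q, jetEntry T m n * jetEntry T' n s
  rw [Finset.sum_coe_sort (jets N q) fun n => jetEntry T m n * jetEntry T' n s]
  have h1 : ∀ n : Fin N → ℕ, jetEntry T m n * jetEntry T' n s =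
      (multiFact (m : Fin N → ℕ) / multiFact (s : Fin N → ℕ)) •
        (coeff (expo m) (T (monomial (expo n) 1)) *
          coeff (expo n) (T' (monomial (expo s) 1))) := by
    intro n
    unfold jetEntry
    rw [smul_mul_smul_comm]
    congr 1
    field_simp [multiFact_ne_zero]
  rw [Finset.sum_congr rfl fun n _ => h1 n, ← Finset.smul_sum]
  unfold jetEntry
  congr 1
  rw [Module.End.mul_apply]
  set G := T' (monomial (expo s) 1) with hG
  have h2 : coeff (expo m) (T G) =
      ∑ v ∈ G.support, coeff (expo m) (T (monomial v 1)) * coeff v G := by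
    conv_lhs => rw [G.as_sum, map_sum, coeff_sum]
    refine Finset.sum_congr rfl fun v _ => ?_
    have : (monomial v) (coeff v G) = coeff v G • (monomial v 1 : MvPolynomial (Fin N) A) := by
      rw [smul_monomial, smul_eq_mul, mul_one]
    rw [this, map_smul, coeff_smul, smul_eq_mul, mul_comm]
  have h3 : ∑ n ∈ jets N q, coeff (expo (m : Fin N → ℕ)) (T (monomial (expo n) 1)) *
        coeff (expo n) G =
      ∑ v ∈ (jets N q).map Finsupp.equivFunOnFinite.symm.toEmbedding,
        coeff (expo (m : Fin N → ℕ)) (T (monomial v 1)) * coeff v G := by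
    rw [Finset.sum_map]; rfl
  rw [h2, h3]
  set t := (jets N q).map Finsupp.equivFunOnFinite.symm.toEmbedding
  trans ∑ v ∈ G.support ∪ t, coeff (expo (m : Fin N → ℕ)) (T (monomial v 1)) * coeff v G
  · refine Finset.sum_subset Finset.subset_union_left fun v _ hv => ?_
    rw [notMem_support_iff.mp hv, mul_zero]
  · refine (Finset.sum_subset Finset.subset_union_right fun v _ hv => ?_).symm
    -- An intermediate exponent outside the truncation would have larger degree than `m`.
    have h4 : coeff (expo (m : Fin N → ℕ)) (T (monomial v 1)) = 0 := by
      by_contra h0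
      apply hv
      have h5 := hT m (Finsupp.equivFunOnFinite v) (by
        unfold jetEntry
        rw [expo, expo, Equiv.symm_apply_apply]
        exact smul_ne_zero (div_ne_zero (multiFact_ne_zero _) (multiFact_ne_zero _)) h0)
      rw [Finset.mem_map]
      exact ⟨Finsupp.equivFunOnFinite v, mem_jets.mpr (h5.trans (mem_jets.mp m.2)), by simp⟩
    rw [h4, zero_mul]

end Base

/-- The Taylor expansion `f(x + y)`, a polynomial in `y` over the polynomials in `x`. -/
def taylor : MvPolynomial (Fin N) ℂ →ₐ[ℂ] MvPolynomial (Fin N) (MvPolynomial (Fin N) ℂ) :=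
  taylorAt X

theorem pderiv_taylor (μ : Fin N) (f : MvPolynomial (Fin N) ℂ) :
    pderiv μ (taylor f) = taylor (pderiv μ f) := pderiv_taylorAt X μ f

theorem constantCoeff_taylor (f : MvPolynomial (Fin N) ℂ) : constantCoeff (taylor f) = f :=
  (constantCoeff_taylorAt X f).trans (aeval_X_left_apply f)

/-- Differentiation in `y` of `f(x+y)` is the expansion of the derivative of `f`; inductively every
Taylor coefficient reduces to the value at `y = 0`. -/
theorem multiFact_smul_coeff_taylor (m : Fin N → ℕ) (f : MvPolynomial (Fin N) ℂ) :
    multiFact m • coeff (expo m) (taylor f) = multiDeriv m f := by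
  induction m using multiIndex_induction generalizing f with
  | h0 =>
    rw [multiFact_zero, one_smul, multiDeriv_zero]
    conv_rhs => rw [← constantCoeff_taylor f]
    rw [constantCoeff_eq]
    congr 1
    ext ν
    rfl
  | hs m μ ih =>
    rw [multiDeriv_add_single, ← multiDeriv_pderiv, ← ih, ← pderiv_taylor, coeff_pderiv,
      expo_add_single, multiFact_add_single, mul_comm (_ + 1), mul_smul]
    congr 1
    rw [mul_comm, Algebra.smul_def]
    simp

end Taylor

/-! ### Jet matrices -/

section JetMatrices

open MvPolynomial

variable {N : ℕ}

/-- Polynomials in `y` over the polynomials in `x`. -/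
abbrev JetPoly (N : ℕ) := MvPolynomial (Fin N) (MvPolynomial (Fin N) ℂ)

/-- The action of a function on jets. -/
def mulOp (f : MvPolynomial (Fin N) ℂ) : Module.End (MvPolynomial (Fin N) ℂ) (JetPoly N) :=
  LinearMap.mulLeft _ (taylor f)

/-- The action of a vector field on jets, in the frame moving with the base point. -/
def vecDer (ξ : VecField N) : Derivation (MvPolynomial (Fin N) ℂ) (JetPoly N) (JetPoly N) :=
  polyDer fun μ => taylor (ξ μ) - C (ξ μ)

/-- The action of a vector field on jets as a linear map. -/
def vecOp (ξ : VecField N) : Module.End (MvPolynomial (Fin N) ℂ) (JetPoly N) :=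
  (vecDer ξ : JetPoly N →ₗ[MvPolynomial (Fin N) ℂ] JetPoly N)

theorem smul_coeff_taylor_mul (m n : Fin N → ℕ) (f : MvPolynomial (Fin N) ℂ) :
    (multiFact m / multiFact n) • coeff (expo m) (taylor f * monomial (expo n) 1) =
      (multiChoose m n : ℂ) • multiDeriv (m - n) f := by
  rw [coeff_mul_monomial']
  by_cases h : n ≤ m
  · have h' : expo n ≤ expo m := h
    rw [if_pos h', multiFact_div h, mul_one, ← expo_sub, mul_smul, multiFact_smul_coeff_taylor]
  · have h' : ¬expo n ≤ expo m := h
    rw [if_neg h', multiChoose_eq_zero h, Nat.cast_zero, zero_smul, smul_zero]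

theorem jetEntry_mulOp (f : MvPolynomial (Fin N) ℂ) (m n : Fin N → ℕ) :
    jetEntry (mulOp f) m n = (multiChoose m n : ℂ) • multiDeriv (m - n) f :=
  smul_coeff_taylor_mul m n f

theorem vecDer_apply (ξ : VecField N) (G : JetPoly N) :
    vecDer ξ G = ∑ μ, (taylor (ξ μ) - C (ξ μ)) * pderiv μ G := polyDer_apply _ G

/-- The entry with `s = m + μ` is absent because `ξ(x)` has been subtracted. The condition `s μ = 0`
is separate: there `∂_μ` kills the monomial, while truncated subtraction would leave `s` unchanged.
-/
theorem jetEntry_vecOp (ξ : VecField N) (m s : Fin N → ℕ) :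
    jetEntry (vecOp ξ) m s = ∑ μ, if s μ = 0 ∨ s - Pi.single μ 1 = m then 0 else
      (multiChoose m (s - Pi.single μ 1) : ℂ) •
        multiDeriv (m - (s - Pi.single μ 1)) (ξ μ) := by
  unfold jetEntry
  change _ • coeff (expo m) (vecDer ξ _) = _
  rw [vecDer_apply, coeff_sum, Finset.smul_sum]
  refine Finset.sum_congr rfl fun μ _ => ?_
  rw [pderiv_monomial, ← expo_sub_single, one_mul]
  by_cases hs : s μ = 0
  · rw [if_pos (Or.inl hs)]
    simp [hs]
  · have hm : (monomial (expo (s - Pi.single μ 1)) ((expo s μ : ℕ) : MvPolynomial (Fin N) ℂ) :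
        JetPoly N) = (s μ : ℂ) • monomial (expo (s - Pi.single μ 1)) 1 := by
      rw [smul_monomial]
      congr 1
      simp [Algebra.smul_def]
    have hs' : s = (s - Pi.single μ 1) + Pi.single μ 1 := by
      funext ν
      by_cases hν : ν = μ
      · subst hν; simp; omega
      · simp [hν]
    -- The factor `s μ` produced by differentiation is absorbed by passing from `s!` to `(s - μ)!`.
    have hf : multiFact m / multiFact s * (s μ : ℂ) =
        multiFact m / multiFact (s - Pi.single μ 1) := by
      have h1 := multiFact_add_single (s - Pi.single μ 1) μ
      rw [← hs'] at h1
      have h2 : (((s - Pi.single μ 1 : Fin N → ℕ) μ : ℕ) : ℂ) + 1 = s μ := by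
        rw [Pi.sub_apply, Pi.single_eq_same, Nat.cast_sub (by omega)]; simp
      rw [h2] at h1
      rw [h1]
      have := multiFact_ne_zero (s - Pi.single μ 1)
      have : (s μ : ℂ) ≠ 0 := Nat.cast_ne_zero.mpr hs
      field_simp
    rw [hm, mul_smul_comm, coeff_smul, smul_smul, hf, sub_mul, coeff_sub, smul_sub,
      smul_coeff_taylor_mul, C_mul_monomial, coeff_monomial]
    by_cases hsm : s - Pi.single μ 1 = m
    · rw [if_pos (Or.inr hsm), hsm, if_pos rfl, div_self (multiFact_ne_zero m), multiChoose_self,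
        tsub_self, multiDeriv_zero]
      simp
    · rw [if_neg fun h => hsm (Finsupp.equivFunOnFinite.symm.injective h),
        if_neg (not_or.mpr ⟨hs, hsm⟩), smul_zero, sub_zero]

theorem isFiltered_mulOp (f : MvPolynomial (Fin N) ℂ) : IsFiltered (mulOp f) := by
  intro m n h
  rw [jetEntry_mulOp] at h
  by_contra hn
  refine h ?_
  rw [multiChoose_eq_zero fun hle => hn (Finset.sum_le_sum fun μ _ => hle μ), Nat.cast_zero,
    zero_smul]

/-- The coefficients `ξ(x+y) - ξ(x)` have no constant term in `y`, which compensates the degree lost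
to `∂_y`. -/
theorem isFiltered_vecOp (ξ : VecField N) : IsFiltered (vecOp ξ) := by
  intro m s h
  rw [jetEntry_vecOp] at h
  obtain ⟨μ, -, hμ⟩ := Finset.exists_ne_zero_of_sum_ne_zero h
  rw [ne_eq, ite_eq_left_iff, Classical.not_imp, not_or] at hμ
  obtain ⟨⟨h1, h2⟩, h3⟩ := hμ
  have h4 : s - Pi.single μ 1 ≤ m := by
    by_contra hle
    exact h3 (by rw [multiChoose_eq_zero hle, Nat.cast_zero, zero_smul])
  have h5 : ∑ ν, (s - Pi.single μ 1 : Fin N → ℕ) ν < ∑ ν, m ν := by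
    have h6 := lt_of_le_of_ne h4 h2
    rw [Pi.lt_def] at h6
    exact Finset.sum_lt_sum (fun ν _ => h6.1 ν) (by simpa using h6.2)
  have h7 : s = (s - Pi.single μ 1) + Pi.single μ 1 := by
    funext ν
    by_cases hν : ν = μ
    · subst hν; simp; omega
    · simp [hν]
  rw [h7]
  simp only [Pi.add_apply, Finset.sum_add_distrib]
  have : ∑ ν, (Pi.single μ 1 : Fin N → ℕ) ν = 1 := by simp
  omega

/-- Multiplication by a function on jets. -/
def jetJ (q : ℕ) (f : MvPolynomial (Fin N) ℂ) :
    Matrix (jets N q) (jets N q) (MvPolynomial (Fin N) ℂ) := jetMat q (mulOp f)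

/-- The action of a vector field on jets. -/
def jetV (q : ℕ) (ξ : VecField N) :
    Matrix (jets N q) (jets N q) (MvPolynomial (Fin N) ℂ) := jetMat q (vecOp ξ)

theorem jetJ_mul (q : ℕ) (f g : MvPolynomial (Fin N) ℂ) : jetJ q f * jetJ q g = jetJ q (f * g) := by
  unfold jetJ
  rw [← jetMat_mul q (isFiltered_mulOp f)]
  refine congrArg (jetMat q) (LinearMap.ext fun G => ?_)
  simp [mulOp]

/-- Leibniz for `(ξ(x+y) - ξ(x)) ∂_y` applied to `f(x+y)`. The part with `ξ(x)` is the motion of the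
base point, to be cancelled by the momentum. -/
theorem jetV_lie_jetJ (q : ℕ) (ξ : VecField N) (f : MvPolynomial (Fin N) ℂ) :
    jetV q ξ * jetJ q f - jetJ q f * jetV q ξ =
      jetJ q (∑ μ, ξ μ * pderiv μ f) - ∑ μ, ξ μ • jetJ q (pderiv μ f) := by
  unfold jetV jetJ
  rw [← jetMat_mul q (isFiltered_vecOp ξ), ← jetMat_mul q (isFiltered_mulOp f)]
  change jetMatL N q _ _ - jetMatL N q _ _ = jetMatL N q _ _ - ∑ μ, ξ μ • jetMatL N q _ _
  simp only [← map_smul, ← map_sum, ← map_sub]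
  refine congrArg (jetMatL N q _) (LinearMap.ext fun G => ?_)
  change vecDer ξ (taylor f * G) - taylor f * vecDer ξ G =
    taylor (∑ μ, ξ μ * pderiv μ f) * G - (∑ μ, ξ μ • mulOp (pderiv μ f)) G
  rw [Derivation.leibniz, vecDer_apply ξ (taylor f), smul_eq_mul, smul_eq_mul, map_sum,
    LinearMap.sum_apply, Finset.sum_mul, add_sub_cancel_left, ← Finset.sum_sub_distrib,
    Finset.mul_sum]
  refine Finset.sum_congr rfl fun μ _ => ?_
  rw [pderiv_taylor, map_mul, LinearMap.smul_apply]
  change _ = _ - ξ μ • (taylor _ * G)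
  rw [smul_eq_C_mul]
  ring

/-- The commutator in `y` with the base point frozen; the two correction terms are the derivatives
of the coefficients along `η(x)` and `ξ(x)`. -/
theorem jetV_lie_jetV (q : ℕ) (ξ η : VecField N) :
    jetV q ξ * jetV q η - jetV q η * jetV q ξ =
      jetV q (vecBracket ξ η) - ∑ μ, ξ μ • jetV q (fun ν => pderiv μ (η ν)) +
        ∑ μ, η μ • jetV q (fun ν => pderiv μ (ξ ν)) := by
  unfold jetV
  rw [← jetMat_mul q (isFiltered_vecOp ξ), ← jetMat_mul q (isFiltered_vecOp η)]
  change jetMatL N q _ _ - jetMatL N q _ _ = jetMatL N q _ _ - ∑ μ, ξ μ • jetMatL N q _ _ +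
    ∑ μ, η μ • jetMatL N q _ _
  simp only [← map_smul, ← map_sum, ← map_sub, ← map_add]
  refine congrArg (jetMatL N q _) (LinearMap.ext fun G => ?_)
  rw [LinearMap.add_apply, LinearMap.sub_apply, LinearMap.sub_apply, LinearMap.sum_apply,
    LinearMap.sum_apply]
  change vecDer ξ (vecDer η G) - vecDer η (vecDer ξ G) = vecDer (vecBracket ξ η) G -
    ∑ μ, ξ μ • vecDer (fun ν => pderiv μ (η ν)) G + ∑ μ, η μ • vecDer (fun ν => pderiv μ (ξ ν)) G
  refine (polyDer_lie _ _ G).trans ?_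
  simp only [polyDer_apply, vecDer_apply, smul_eq_C_mul, Finset.mul_sum]
  rw [Finset.sum_comm (γ := Fin N) (s := Finset.univ) (t := Finset.univ)
    (f := fun μ ν => C (ξ μ) * _), Finset.sum_comm (γ := Fin N) (s := Finset.univ)
    (t := Finset.univ) (f := fun μ ν => C (η μ) * _), ← Finset.sum_sub_distrib,
    ← Finset.sum_add_distrib]
  refine Finset.sum_congr rfl fun ν _ => ?_
  simp only [vecBracket, map_sum, map_sub, map_mul, pderiv_taylor, pderiv_C,
      sub_zero, ← Finset.sum_sub_distrib, ← Finset.sum_add_distrib, Finset.sum_mul]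
  refine Finset.sum_congr rfl fun μ _ => ?_
  ring

end JetMatrices

/-! ### Counting multi-indices -/

section Counting

/-- This counts subsets of size `a + b + 1` by the position of their `(a+1)`-st element; the
induction uses Pascal's rule on the second factor. -/
theorem sum_choose_mul_choose (n a b : ℕ) :
    ∑ j ∈ Finset.range (n + 1), j.choose a * (n - j).choose b = (n + 1).choose (a + b + 1) := by
  induction n generalizing b with
  | zero =>
    cases a <;> cases b <;> simp [Nat.choose_eq_zero_of_lt]
  | succ n ih =>
    cases b with
    | zero =>
      have h := ih 0
      simp only [Nat.choose_zero_right, mul_one, add_zero] at h ⊢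
      rw [Finset.sum_range_succ, h, add_comm]
      exact (Nat.choose_succ_succ _ _).symm
    | succ b =>
      rw [Finset.sum_range_succ, Nat.sub_self, Nat.choose_zero_succ, mul_zero, add_zero]
      have : ∀ j ∈ Finset.range (n + 1), j.choose a * (n + 1 - j).choose (b + 1) =
          j.choose a * (n - j).choose b + j.choose a * (n - j).choose (b + 1) := by
        intro j hj
        rw [Finset.mem_range] at hj
        rw [show n + 1 - j = (n - j) + 1 by omega, Nat.choose_succ_succ, mul_add]
      rw [Finset.sum_congr rfl this, Finset.sum_add_distrib, ih, ih]
      exact (Nat.choose_succ_succ _ _).symm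

theorem sum_jets_succ {M : Type*} [AddCommMonoid M] (N q : ℕ) (F : (Fin (N + 1) → ℕ) → M) :
    ∑ m ∈ jets (N + 1) q, F m =
      ∑ j ∈ Finset.range (q + 1), ∑ m ∈ jets N (q - j), F (Fin.cons j m) := by
  rw [Finset.sum_sigma']
  refine Finset.sum_nbij' (fun m => ⟨m 0, Fin.tail m⟩) (fun x => Fin.cons x.1 x.2) ?_ ?_ ?_ ?_ ?_
  · intro m hm
    rw [mem_jets, Fin.sum_univ_succ] at hm
    rw [Finset.mem_sigma, Finset.mem_range, mem_jets]
    simp only [Fin.tail]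
    omega
  · rintro ⟨j, m⟩ hx
    rw [Finset.mem_sigma, Finset.mem_range, mem_jets] at hx
    rw [mem_jets, Fin.sum_univ_succ]
    simp only [Fin.cons_zero, Fin.cons_succ]
    simp only at hx
    omega
  · intro m _
    exact Fin.cons_self_tail m
  · rintro ⟨j, m⟩ _
    simp
  · intro m _
    rw [Fin.cons_self_tail]

/-- Splitting off the first exponent reduces the count to the one-variable convolution. All trace
coefficients are instances with `|a| = 0, 1, 2`. -/
theorem sum_jets_multiChoose (N q : ℕ) (a : Fin N → ℕ) :
    ∑ m ∈ jets N q, multiChoose m a = (N + q).choose (N + ∑ μ, a μ) := by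
  induction N generalizing q with
  | zero =>
    have : jets 0 q = {0} := by
      ext m
      simp [mem_jets, Subsingleton.elim m 0]
    rw [this]
    simp [multiChoose]
  | succ N ih =>
    rw [sum_jets_succ]
    have h1 : ∀ j (m : Fin N → ℕ), multiChoose (Fin.cons j m : Fin (N + 1) → ℕ) a =
        j.choose (a 0) * multiChoose m (Fin.tail a) := by
      intro j m
      simp [multiChoose, Fin.prod_univ_succ, Fin.tail]
    simp only [h1, ← Finset.mul_sum, ih]
    have h2 : ∀ j ∈ Finset.range (q + 1),
        j.choose (a 0) * (N + (q - j)).choose (N + ∑ μ, Fin.tail a μ) =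
        j.choose (a 0) * (N + q - j).choose (N + ∑ μ, Fin.tail a μ) := by
      intro j hj
      rw [Finset.mem_range] at hj
      rw [show N + (q - j) = N + q - j by omega]
    rw [Finset.sum_congr rfl h2, Fin.sum_univ_succ]
    -- For `j > q` the upper entry `N + q - j` is smaller than `N`, so the added terms vanish.
    have h3 : ∑ j ∈ Finset.range (q + 1),
        j.choose (a 0) * (N + q - j).choose (N + ∑ μ, Fin.tail a μ) =
        ∑ j ∈ Finset.range (N + q + 1),
        j.choose (a 0) * (N + q - j).choose (N + ∑ μ, Fin.tail a μ) := by
      refine Finset.sum_subset (Finset.range_mono (by omega)) fun j hj' hj => ?_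
      rw [Finset.mem_range] at hj hj'
      rw [Nat.choose_eq_zero_of_lt (n := N + q - j) (by omega), mul_zero]
    rw [h3, sum_choose_mul_choose]
    congr 1
    · omega
    · simp only [Fin.tail]; omega

theorem card_jets (N q : ℕ) : (jets N q).card = (N + q).choose N := by
  have := sum_jets_multiChoose N q 0
  simpa [multiChoose] using this

theorem multiChoose_single {N : ℕ} (m : Fin N → ℕ) (μ : Fin N) :
    multiChoose m (Pi.single μ 1) = m μ := by
  unfold multiChoose
  rw [Fintype.prod_eq_single μ (fun ν hν => by simp [hν])]
  simp

theorem sum_jets_apply (N q : ℕ) (μ : Fin N) :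
    ∑ m ∈ jets N q, m μ = (N + q).choose (N + 1) := by
  have := sum_jets_multiChoose N q (Pi.single μ 1)
  simpa [multiChoose_single] using this

theorem sum_jets_multiChoose_add_single (N q : ℕ) (μ ν : Fin N) :
    ∑ m ∈ jets N q, multiChoose m (Pi.single μ 1 + Pi.single ν 1) = (N + q).choose (N + 2) := by
  have := sum_jets_multiChoose N q (Pi.single μ 1 + Pi.single ν 1)
  simpa [Finset.sum_add_distrib] using this

/-- The extra factor `2` for `μ = ν` is the same factor that appears in the second derivative of
`y_μ y_ν`, so it cancels in the trace formulas. -/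
theorem mul_sub_single {N : ℕ} (m : Fin N → ℕ) (μ ν : Fin N) :
    m μ * (m - Pi.single μ 1 : Fin N → ℕ) ν =
      multiChoose m (Pi.single μ 1 + Pi.single ν 1) * ((Pi.single μ 1 : Fin N → ℕ) ν + 1) := by
  unfold multiChoose
  by_cases h : μ = ν
  · subst h
    rw [Fintype.prod_eq_single μ (fun σ hσ => by simp [hσ])]
    simp only [Pi.sub_apply, Pi.add_apply, Pi.single_eq_same]
    rw [show 1 + 1 = 2 from rfl, Nat.choose_two_right, Nat.div_mul_cancel]
    exact (Nat.even_mul_pred_self _).two_dvd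
  · rw [Fintype.prod_eq_mul μ ν h (fun σ hσ => by simp [hσ.1, hσ.2])]
    simp [h, Ne.symm h]

end Counting

/-! ### Traces of jet matrices -/

section Traces

open MvPolynomial

variable {N : ℕ} {A : Type*} [CommRing A]

/-- On the diagonal `G` must restore the lost power of `y_μ`, so only its linear coefficient counts;
the next lemma is the quadratic analogue. -/
theorem coeff_mul_pderiv_monomial (G : MvPolynomial (Fin N) A) (m : Fin N → ℕ) (μ : Fin N) :
    coeff (expo m) (G * pderiv μ (monomial (expo m) 1)) =
      (m μ : A) * constantCoeff (pderiv μ G) := by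
  rw [pderiv_monomial, coeff_mul_monomial', constantCoeff_eq, coeff_pderiv, if_pos tsub_le_self]
  by_cases h : m μ = 0
  · simp [h]
  · have : expo m - (expo m - Finsupp.single μ 1) = Finsupp.single μ 1 := by
      refine tsub_tsub_cancel_of_le ?_
      rw [Finsupp.single_le_iff]
      exact Nat.one_le_iff_ne_zero.mpr h
    rw [this]
    simp [mul_comm]

theorem coeff_mul_pderiv_pderiv_monomial (G : MvPolynomial (Fin N) A) (m : Fin N → ℕ)
    (μ ν : Fin N) :
    coeff (expo m) (G * pderiv ν (pderiv μ (monomial (expo m) 1))) =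
      (multiChoose m (Pi.single μ 1 + Pi.single ν 1) : A) *
        constantCoeff (pderiv μ (pderiv ν G)) := by
  have hw := congrArg (Nat.cast (R := A)) (mul_sub_single m μ ν)
  push_cast at hw
  rw [pderiv_monomial, pderiv_monomial, coeff_mul_monomial', constantCoeff_eq, coeff_pderiv,
    coeff_pderiv, if_pos (tsub_le_self.trans tsub_le_self), one_mul, zero_add]
  have e1 : (((expo m) μ : ℕ) : A) * (((expo m - Finsupp.single μ 1 : Fin N →₀ ℕ) ν : ℕ) : A) =
      (m μ : A) * ((m - Pi.single μ 1 : Fin N → ℕ) ν : A) := by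
    rw [← expo_sub_single]; rfl
  rw [e1, hw]
  have e2 : (((Finsupp.single μ 1 : Fin N →₀ ℕ) ν : ℕ) : A) =
      (((Pi.single μ 1 : Fin N → ℕ) ν : ℕ) : A) := by
    simp [Finsupp.single_apply, Pi.single_apply, eq_comm]
  rw [e2]
  by_cases h : Finsupp.single μ 1 + Finsupp.single ν 1 ≤ expo m
  · rw [tsub_tsub, tsub_tsub_cancel_of_le h]
    simp
    ring
  · have : multiChoose m (Pi.single μ 1 + Pi.single ν 1) = 0 := by
      refine multiChoose_eq_zero fun hle => h ?_
      intro σ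
      have := hle σ
      simpa [Finsupp.single_apply, Pi.single_apply, eq_comm] using this
    simp [this]

variable [Algebra ℂ A]

theorem trace_jetMat (q : ℕ) (T : Module.End A (MvPolynomial (Fin N) A)) :
    (jetMat q T).trace = ∑ m ∈ jets N q, coeff (expo m) (T (monomial (expo m) 1)) := by
  rw [Matrix.trace, ← Finset.sum_coe_sort (jets N q)
    fun m => coeff (expo m) (T (monomial (expo m) 1))]
  refine Finset.sum_congr rfl fun m _ => ?_
  rw [Matrix.diag_apply]
  simp [jetMat, jetEntry, div_self (multiFact_ne_zero _)]

theorem trace_jetMat_polyDer_mul (q : ℕ) (a : Fin N → MvPolynomial (Fin N) A)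
    (ha : ∀ μ, constantCoeff (a μ) = 0) (G : MvPolynomial (Fin N) A) :
    (jetMat q ((polyDer a : MvPolynomial (Fin N) A →ₗ[A] MvPolynomial (Fin N) A) ∘ₗ
      LinearMap.mulLeft A G)).trace =
      ((N + q).choose (N + 1) : A) *
        ∑ μ, constantCoeff (pderiv μ (a μ)) * constantCoeff G := by
  rw [trace_jetMat]
  have h1 : ∀ m : Fin N → ℕ, coeff (expo m) (((polyDer a : MvPolynomial (Fin N) A →ₗ[A]
      MvPolynomial (Fin N) A) ∘ₗ LinearMap.mulLeft A G) (monomial (expo m) 1)) =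
      ∑ μ, (m μ : A) * (constantCoeff (pderiv μ (a μ)) * constantCoeff G) := by
    intro m
    rw [LinearMap.comp_apply, LinearMap.mulLeft_apply, Derivation.coeFn_coe, polyDer_apply,
      coeff_sum]
    refine Finset.sum_congr rfl fun μ _ => ?_
    rw [Derivation.leibniz, smul_eq_mul, smul_eq_mul, mul_add, coeff_add, ← mul_assoc,
      coeff_mul_pderiv_monomial, mul_comm (monomial _ _), ← mul_assoc, coeff_mul_monomial',
      if_pos le_rfl, tsub_self, ← constantCoeff_eq, map_mul constantCoeff (a μ), ha, zero_mul,
      zero_mul, add_zero, Derivation.leibniz, smul_eq_mul, smul_eq_mul, map_add, map_mul, map_mul,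
      ha, zero_mul, zero_add, mul_comm (constantCoeff G)]
  simp only [h1]
  rw [Finset.sum_comm, Finset.mul_sum]
  refine Finset.sum_congr rfl fun μ _ => ?_
  rw [← Finset.sum_mul, ← sum_jets_apply N q μ]
  push_cast
  rfl

/-- The second order part gives both contractions with `C(N+q,N+2)`; the first order part adds
`C(N+q,N+1)` to the mixed one. Pascal's rule combines them, whence the shifted coefficient
`C(N+q+1,N+2)`. -/
theorem trace_jetMat_polyDer_polyDer (q : ℕ) (a b : Fin N → MvPolynomial (Fin N) A)
    (ha : ∀ μ, constantCoeff (a μ) = 0) (hb : ∀ μ, constantCoeff (b μ) = 0) :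
    (jetMat q ((polyDer a : MvPolynomial (Fin N) A →ₗ[A] MvPolynomial (Fin N) A) ∘ₗ
      (polyDer b : MvPolynomial (Fin N) A →ₗ[A] MvPolynomial (Fin N) A))).trace =
      ((N + q + 1).choose (N + 2) : A) *
        ∑ μ, ∑ ν, constantCoeff (pderiv ν (a μ)) * constantCoeff (pderiv μ (b ν)) +
      ((N + q).choose (N + 2) : A) *
        ∑ μ, ∑ ν, constantCoeff (pderiv μ (a μ)) * constantCoeff (pderiv ν (b ν)) := by
  rw [trace_jetMat]
  have h1 : ∀ m : Fin N → ℕ, coeff (expo m) (((polyDer a : MvPolynomial (Fin N) A →ₗ[A]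
      MvPolynomial (Fin N) A) ∘ₗ (polyDer b : MvPolynomial (Fin N) A →ₗ[A]
      MvPolynomial (Fin N) A)) (monomial (expo m) 1)) =
      ∑ μ, ∑ ν, ((m ν : A) * (constantCoeff (pderiv ν (a μ)) * constantCoeff (pderiv μ (b ν))) +
        (multiChoose m (Pi.single ν 1 + Pi.single μ 1) : A) *
        (constantCoeff (pderiv ν (a μ)) * constantCoeff (pderiv μ (b ν)) +
          constantCoeff (pderiv μ (a μ)) * constantCoeff (pderiv ν (b ν)))) := by
    intro m
    rw [LinearMap.comp_apply, Derivation.coeFn_coe, Derivation.coeFn_coe, polyDer_apply,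
      coeff_sum]
    refine Finset.sum_congr rfl fun μ _ => ?_
    rw [polyDer_apply, map_sum, Finset.mul_sum, coeff_sum]
    refine Finset.sum_congr rfl fun ν _ => ?_
    rw [Derivation.leibniz, smul_eq_mul, smul_eq_mul, mul_add, coeff_add, ← mul_assoc,
      coeff_mul_pderiv_pderiv_monomial, mul_comm (pderiv ν _), ← mul_assoc,
      coeff_mul_pderiv_monomial, add_comm]
    simp [ha, hb]
    ring
  simp only [h1]
  rw [Finset.sum_comm, Finset.mul_sum, Finset.mul_sum, ← Finset.sum_add_distrib]
  refine Finset.sum_congr rfl fun μ _ => ?_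
  rw [Finset.sum_comm, Finset.mul_sum, Finset.mul_sum, ← Finset.sum_add_distrib]
  refine Finset.sum_congr rfl fun ν _ => ?_
  rw [Finset.sum_add_distrib, ← Finset.sum_mul, ← Finset.sum_mul, ← Nat.cast_sum, ← Nat.cast_sum,
    sum_jets_apply, sum_jets_multiChoose_add_single, Nat.choose_succ_succ (N + q) (N + 1)]
  push_cast
  ring

end Traces

/-! ### Traces that determine the abelian charges -/

section JetTraces

open MvPolynomial

variable {N : ℕ}

theorem constantCoeff_vecComp (ξ : VecField N) (μ : Fin N) :
    constantCoeff (taylor (ξ μ) - C (ξ μ)) = 0 := by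
  rw [map_sub, constantCoeff_taylor, constantCoeff_C, sub_self]

theorem constantCoeff_pderiv_vecComp (ξ : VecField N) (μ ν : Fin N) :
    constantCoeff (pderiv ν (taylor (ξ μ) - C (ξ μ))) = pderiv ν (ξ μ) := by
  rw [map_sub, pderiv_taylor, pderiv_C, sub_zero, constantCoeff_taylor]

theorem trace_jetJ (q : ℕ) (f : MvPolynomial (Fin N) ℂ) :
    (jetJ q f).trace = ((N + q).choose N : ℂ) • f := by
  rw [Matrix.trace]
  have h1 : ∀ m : jets N q, (jetJ q f).diag m = f := by
    intro m
    rw [Matrix.diag_apply]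
    change jetEntry _ _ _ = _
    rw [jetEntry_mulOp, multiChoose_self, tsub_self, multiDeriv_zero, Nat.cast_one, one_smul]
  simp only [h1, Finset.sum_const, Finset.card_univ, Fintype.card_coe, card_jets]
  rw [Nat.cast_smul_eq_nsmul]

theorem trace_jetV_mul_jetJ (q : ℕ) (ξ : VecField N) (f : MvPolynomial (Fin N) ℂ) :
    (jetV q ξ * jetJ q f).trace = ((N + q).choose (N + 1) : ℂ) • ∑ μ, pderiv μ (ξ μ) * f := by
  rw [jetV, jetJ, ← jetMat_mul q (isFiltered_vecOp ξ)]
  refine (trace_jetMat_polyDer_mul q _ (constantCoeff_vecComp ξ) (taylor f)).trans ?_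
  rw [constantCoeff_taylor, Nat.cast_smul_eq_nsmul, nsmul_eq_mul]
  simp only [constantCoeff_pderiv_vecComp]

theorem trace_jetV (q : ℕ) (ξ : VecField N) :
    (jetV q ξ).trace = ((N + q).choose (N + 1) : ℂ) • ∑ μ, pderiv μ (ξ μ) := by
  have h := trace_jetV_mul_jetJ q ξ 1
  have h1 : jetV q ξ * jetJ q 1 = jetV q ξ := by
    rw [jetV, jetJ, ← jetMat_mul q (isFiltered_vecOp ξ)]
    refine congrArg (jetMat q) (LinearMap.ext fun G => ?_)
    simp [mulOp]
  rw [h1] at h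
  simpa using h

theorem trace_jetV_mul_jetV (q : ℕ) (ξ η : VecField N) :
    (jetV q ξ * jetV q η).trace =
      ((N + q + 1).choose (N + 2) : ℂ) • ∑ μ, ∑ ν, pderiv ν (ξ μ) * pderiv μ (η ν) +
      ((N + q).choose (N + 2) : ℂ) • ∑ μ, ∑ ν, pderiv μ (ξ μ) * pderiv ν (η ν) := by
  rw [jetV, jetV, ← jetMat_mul q (isFiltered_vecOp ξ)]
  refine (trace_jetMat_polyDer_polyDer q _ _ (constantCoeff_vecComp ξ)
    (constantCoeff_vecComp η)).trans ?_
  rw [Nat.cast_smul_eq_nsmul, nsmul_eq_mul, Nat.cast_smul_eq_nsmul, nsmul_eq_mul]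
  simp only [constantCoeff_pderiv_vecComp]

theorem pderiv_jetJ_apply (q : ℕ) (ρ : Fin N) (f : MvPolynomial (Fin N) ℂ) (m n : jets N q) :
    pderiv ρ (jetJ q f m n) = jetJ q (pderiv ρ f) m n := by
  change pderiv ρ (jetEntry _ _ _) = jetEntry _ _ _
  rw [jetEntry_mulOp, jetEntry_mulOp, Derivation.map_smul, multiDeriv_pderiv]

theorem pderiv_jetV_apply (q : ℕ) (ρ : Fin N) (ξ : VecField N) (m n : jets N q) :
    pderiv ρ (jetV q ξ m n) = jetV q (fun μ => pderiv ρ (ξ μ)) m n := by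
  change pderiv ρ (jetEntry _ _ _) = jetEntry _ _ _
  rw [jetEntry_vecOp, jetEntry_vecOp, map_sum]
  refine Finset.sum_congr rfl fun μ _ => ?_
  split_ifs
  · rw [map_zero]
  · rw [Derivation.map_smul, multiDeriv_pderiv]

end JetTraces

/-! ### Commutators of smeared currents -/

section Currents

variable {V : Type*} [AddCommGroup V] [Module ℂ V]

/-- The Schwinger term is supported at opposite mode numbers and carries one power of the mode
number, so it returns the time derivative of the coefficient `a`. -/
theorem adField_fieldInt_normalProd {a c c' e : RField V} {κ : ℂ} (hac : FComm a c)
    (hac' : FComm a c') (hae : FComm a e)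
    (hcc' : ∀ s t, ⁅mode c s, mode c' t⁆ = (1 / (2 * Real.pi) : ℂ) •
      (mode e (s + t) + (if s + t = 0 then Complex.I * s * κ else 0) • 1)) :
    adField (fieldInt (normalProd a c)) c' = normalProd a e - κ • fieldDeriv a := by
  refine mode_ext fun n => ?_
  have h1 := (hasLSum_fieldInt hac).lie_right (mode c' n)
  have h2 := HasLSum.single (T := fun k : ℤ =>
    (if k = n then κ * (Complex.I * k) else 0) • mode a k) n (fun k hk => by
      rw [if_neg hk, zero_smul])
  have h3 := ((hasLSum_normalProd_of_comm hae n).sub h2).congr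
    (T' := fun k => ⁅(2 * Real.pi : ℂ) • (mode a k * mode c (-k)), mode c' n⁆) fun k => ?_
  · rw [mode_adField, h1.unique h3]
    simp only [if_true, mode_sub, mode_smul, mode_fieldDeriv, smul_smul]
  · have h4 : ⁅(2 * Real.pi : ℂ) • (mode a k * mode c (-k)), mode c' n⁆ =
        (2 * Real.pi : ℂ) • (mode a k * ⁅mode c (-k), mode c' n⁆) := by
      simp only [Ring.lie_def, smul_mul_assoc, mul_smul_comm, mul_sub, smul_sub]
      congr 2
      rw [← mul_assoc, ← (hac' k n).eq, mul_assoc]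
    rw [h4, hcc', mul_smul_comm, smul_smul, mul_one_div_cancel two_pi_ne_zero, one_smul,
      show -k + n = n - k by ring, mul_add]
    by_cases hk : k = n
    · subst hk
      rw [sub_self, if_pos rfl, if_pos rfl, mul_smul_comm, mul_one, sub_eq_add_neg _ (_ • mode a k),
        ← neg_smul]
      congr 2
      push_cast
      ring
    · rw [if_neg hk, if_neg (by omega), zero_smul, zero_smul, mul_zero, add_zero, sub_zero]

theorem lie_fieldInt_normalProd {a b c c' e : RField V} {κ : ℂ} (hab : FComm a b)
    (hac : FComm a c) (hac' : FComm a c') (hae : FComm a e) (hbc : FComm b c) (hbe : FComm b e)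
    (hcc' : ∀ s t, ⁅mode c s, mode c' t⁆ = (1 / (2 * Real.pi) : ℂ) •
      (mode e (s + t) + (if s + t = 0 then Complex.I * s * κ else 0) • 1)) :
    ⁅fieldInt (normalProd a c), fieldInt (normalProd b c')⁆ =
      fieldInt (normalProd (normalProd a b) e) -
        κ • fieldInt (normalProd (fieldDeriv a) b) := by
  have h1 : adField (fieldInt (normalProd a c)) b = 0 :=
    adField_eq_zero fun n => commute_fieldInt (hab.normalProd_left hbc.symm) n
  rw [lie_fieldInt, adField_normalProd, h1, adField_fieldInt_normalProd hac hac' hae hcc',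
    normalProd_assoc hab hae hbe, normalProd_left_comm hab hae hbe,
    normalProd_comm hab.deriv_left]
  simp only [normalProd_eq, fieldInt_eq, map_zero, map_sub, map_smul,
    LinearMap.zero_apply, zero_add]

theorem trajForm_eq_sum {N : ℕ} {q : Fin N → RField V} (hq : ∀ μ ν, FComm (q μ) (q ν))
    (f g : MvPolynomial (Fin N) ℂ) :
    trajForm q f g = ∑ ρ, fieldInt (normalProd (fieldDeriv (q ρ))
      (onTrajectory q (MvPolynomial.pderiv ρ f * g))) := by
  have h1 := isFieldDer_fieldDeriv.onTrajectory hq (fun μ ν => (hq μ ν).deriv_left) f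
  change fieldDeriv _ = ∑ μ, normalProd (fieldDeriv (q μ)) _ at h1
  have hqg : ∀ (g : MvPolynomial (Fin N) ℂ) μ, FComm (q μ) (onTrajectory q g) :=
    fun g μ => FComm.onTrajectory_right (fun ν => hq ν μ) g
  rw [trajForm, h1, normalProd_eq, map_sum, LinearMap.sum_apply, fieldInt_eq, map_sum]
  refine Finset.sum_congr rfl fun ρ _ => ?_
  rw [← normalProd_eq, normalProd_assoc (hqg _ ρ).deriv_left
    (hqg _ ρ).deriv_left (FComm.onTrajectory_left (hqg g) _), onTrajectory_mul hq]
  rfl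

theorem smear_add (f : ℂ[T;T⁻¹]) (a b : RField V) : smear f (a + b) = smear f a + smear f b := by
  simp only [smear_eq, normalProd_eq, fieldInt_eq, map_add]

theorem smear_sub (f : ℂ[T;T⁻¹]) (a b : RField V) : smear f (a - b) = smear f a - smear f b := by
  simp only [smear_eq, normalProd_eq, fieldInt_eq, map_sub]

theorem smear_neg (f : ℂ[T;T⁻¹]) (a : RField V) : smear f (-a) = -smear f a := by
  simp only [smear_eq, normalProd_eq, fieldInt_eq, map_neg]

theorem smear_zero (f : ℂ[T;T⁻¹]) : smear f (0 : RField V) = 0 := by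
  simp only [smear_eq, normalProd_eq, fieldInt_eq, map_zero]

theorem smear_sum {α : Type*} (s : Finset α) (f : ℂ[T;T⁻¹]) (a : α → RField V) :
    smear f (∑ i ∈ s, a i) = ∑ i ∈ s, smear f (a i) := by
  simp only [smear_eq, normalProd_eq, fieldInt_eq, map_sum]

theorem circInt_mul_T (f : ℂ[T;T⁻¹]) (n : ℤ) :
    circInt (f * LaurentPolynomial.T (-n)) = 2 * Real.pi * f.coeff n := by
  rw [circInt, mul_comm f, coeff_T_mul, sub_neg_eq_add, zero_add]

theorem circDeriv_T (n : ℤ) : circDeriv (LaurentPolynomial.T n) =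
    (Complex.I * n) • (LaurentPolynomial.T n : ℂ[T;T⁻¹]) := by
  ext k
  rw [coeff_circDeriv, AddMonoidAlgebra.coeff_smul, Finsupp.smul_apply, coeff_T, smul_eq_mul]
  split_ifs with h
  · rw [h]
  · simp

/-- A commutator of smeared currents in terms of modes. -/
theorem lie_mode_of_lie_smear {c c' e : RField V} {κ : ℂ}
    (h : ∀ f g, ⁅smear f c, smear g c'⁆ = smear (f * g) e +
      (κ * -circInt (circDeriv f * g)) • 1) (s t : ℤ) :
    ⁅mode c s, mode c' t⁆ = (1 / (2 * Real.pi) : ℂ) •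
      (mode e (s + t) + (if s + t = 0 then Complex.I * s * κ else 0) • 1) := by
  have h1 := h (LaurentPolynomial.T (-s)) (LaurentPolynomial.T (-t))
  rw [smear_T, smear_T, ← LaurentPolynomial.T_add, smear_T, circDeriv_T, smul_mul_assoc,
    ← LaurentPolynomial.T_add] at h1
  have h2 : circInt ((Complex.I * ((-s : ℤ) : ℂ)) •
      (LaurentPolynomial.T (-s + -t) : ℂ[T;T⁻¹])) =
      if s + t = 0 then -(2 * Real.pi * (Complex.I * s)) else 0 := by
    rw [circInt, AddMonoidAlgebra.coeff_smul, Finsupp.smul_apply, coeff_T]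
    by_cases hst : s + t = 0
    · rw [if_pos (by omega), if_pos hst]; simp
    · rw [if_neg (by omega), if_neg hst]; simp
  have hpi := two_pi_ne_zero
  have h3 : ⁅(2 * Real.pi : ℂ) • mode c (-(-s)), (2 * Real.pi : ℂ) • mode c' (-(-t))⁆ =
      ((2 * Real.pi) * (2 * Real.pi) : ℂ) • ⁅mode c s, mode c' t⁆ := by
    simp only [Ring.lie_def, smul_mul_smul_comm, smul_sub, neg_neg]
  rw [h2, h3, show -(-s + -t) = s + t by ring] at h1
  have h4 : ⁅mode c s, mode c' t⁆ = (1 / ((2 * Real.pi) * (2 * Real.pi)) : ℂ) •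
      (((2 * Real.pi) * (2 * Real.pi) : ℂ) • ⁅mode c s, mode c' t⁆) := by
    rw [smul_smul, one_div_mul_cancel (mul_ne_zero hpi hpi), one_smul]
  rw [h4, h1, smul_add, smul_add, smul_smul, smul_smul, smul_smul]
  congr 2
  · field_simp
  · split_ifs
    · field_simp
    · simp

end Currents

/-! ### Contraction of Kronecker deltas into matrix products and traces -/

section Sums

theorem lie_sum_sum {L J : Type*} [Ring L] [Fintype J] (X Y : J → J → L) :
    ⁅∑ m, ∑ n, X m n, ∑ m, ∑ n, Y m n⁆ = ∑ m, ∑ n, ∑ m', ∑ n', ⁅X m n, Y m' n'⁆ := by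
  simp only [Ring.lie_def, Finset.sum_sub_distrib]
  congr 1
  · rw [Finset.sum_mul]
    refine Finset.sum_congr rfl fun m _ => ?_
    rw [Finset.sum_mul]
    simp only [Finset.mul_sum]
  · rw [Finset.mul_sum]
    refine Finset.sum_congr rfl fun m _ => ?_
    rw [Finset.mul_sum]
    simp only [Finset.sum_mul]

variable {J R W : Type*} [Fintype J] [DecidableEq J] [CommRing R] [AddCommGroup W]

theorem sum_ite_mul_apply (G : J → J → R →+ W) (M M' : Matrix J J R) :
    (∑ m, ∑ n, ∑ m', ∑ n', if m' = n then G m n' (M m n * M' m' n') else 0) =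
      ∑ m, ∑ n', G m n' ((M * M') m n') := by
  simp only [Matrix.mul_apply, map_sum]
  refine Finset.sum_congr rfl fun m _ => ?_
  rw [Finset.sum_comm (γ := J) (s := Finset.univ) (t := Finset.univ)
    (f := fun n' n => G m n' (M m n * M' n n'))]
  refine Finset.sum_congr rfl fun n _ => ?_
  rw [Finset.sum_comm]
  refine Finset.sum_congr rfl fun n' _ => ?_
  rw [Finset.sum_ite_eq' Finset.univ n, if_pos (Finset.mem_univ n)]

theorem sum_ite_mul_apply' (G : J → J → R →+ W) (M M' : Matrix J J R) :
    (∑ m, ∑ n, ∑ m', ∑ n', if m = n' then G m' n (M m n * M' m' n') else 0) =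
      ∑ m', ∑ n, G m' n ((M' * M) m' n) := by
  simp only [Matrix.mul_apply, map_sum, Finset.sum_ite_eq, Finset.mem_univ, if_true]
  rw [Finset.sum_comm]
  conv_rhs => rw [Finset.sum_comm]
  refine Finset.sum_congr rfl fun n _ => ?_
  rw [Finset.sum_comm]
  refine Finset.sum_congr rfl fun m' _ => Finset.sum_congr rfl fun m _ => ?_
  rw [mul_comm]

theorem sum_ite_and (H : J → J → J → J → W) :
    (∑ m, ∑ n, ∑ m', ∑ n', if m' = n ∧ m = n' then H m n m' n' else 0) =
      ∑ m, ∑ n, H m n n m := by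
  refine Finset.sum_congr rfl fun m _ => Finset.sum_congr rfl fun n _ => ?_
  rw [Finset.sum_eq_single n, Finset.sum_eq_single m]
  · rw [if_pos ⟨rfl, rfl⟩]
  · intro n' _ h
    rw [if_neg fun h' => h h'.2.symm]
  · simp
  · intro m' _ h
    exact Finset.sum_eq_zero fun n' _ => if_neg fun h' => h h'.1
  · simp

end Sums

/-! ### Matrices of functions coupled to the currents -/

namespace CurrentSystem

variable {ι 𝔤 : Type*} [LieRing 𝔤] [LieAlgebra ℂ 𝔤] {N r p : ℕ} {Jb : Module.Basis ι ℂ 𝔤}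
  {B : LinearMap.BilinForm ℂ 𝔤} {l : 𝔤 →ₗ[ℂ] ℂ} {P : ℕ → CentralParams}
  {V : Type*} [AddCommGroup V] [Module ℂ V] (S : CurrentSystem N r p Jb B l P V)

theorem isHeisenberg : IsHeisenberg S.q S.mom where
  qq μ ν m n := by
    have := S.q_q μ ν m n
    rwa [Ring.lie_def, sub_eq_zero] at this
  pp μ ν m n := by
    have := S.mom_mom μ ν m n
    rwa [Ring.lie_def, sub_eq_zero] at this
  pq μ ν k := by
    refine mode_ext fun n => ?_
    -- The delta function is treated as a current bracket whose right-hand side is a constant field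
    -- and whose central term is zero.
    have h : ∀ f g, ⁅smear f (S.mom μ), smear g (S.q ν)⁆ = smear (f * g)
        ((if μ = ν then (1 / (2 * Real.pi) * (2 * Real.pi) : ℂ) else 0) • oneField) +
          ((0 : ℂ) * -circInt (circDeriv f * g)) • (1 : Module.End ℂ V) := by
      intro f g
      rw [S.mom_q, zero_mul, zero_smul, add_zero, smear_eq, normalProd_eq, map_smul,
        ← normalProd_eq, normalProd_comm (FComm.one_left _).symm, oneField_normalProd,
        fieldInt_eq, map_smul, ← fieldInt_eq, fieldInt, mode_trig, smul_smul, smul_smul,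
        one_div_mul_cancel two_pi_ne_zero, circInt]
      split_ifs <;> simp
    rw [mode_adField, lie_mode_of_lie_smear h, mul_zero, ite_self, zero_smul, add_zero]
    by_cases hμ : μ = ν
    · simp only [if_pos hμ, mode_smul, mode_trig, coeff_T, mode_oneField,
        one_div_mul_cancel two_pi_ne_zero, one_smul]
      by_cases hk : k + n = 0
      · rw [if_pos hk, if_pos (by omega), one_smul]
      · rw [if_neg hk, if_neg (by omega), zero_smul]
    · simp [if_neg hμ]

theorem fcomm_q_cur (i : Fin (r + 1)) (m n : Fin N → ℕ) (A : UEnv N 𝔤) (μ : Fin N) :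
    FComm (S.q μ) (S.cur i m n A) := fun s t => by
  have := S.cur_q i m n A μ t s
  rw [Ring.lie_def, sub_eq_zero] at this
  exact this.symm

theorem fcomm_mom_cur (i : Fin (r + 1)) (m n : Fin N → ℕ) (A : UEnv N 𝔤) (μ : Fin N) :
    FComm (S.mom μ) (S.cur i m n A) := fun s t => by
  have := S.cur_mom i m n A μ t s
  rw [Ring.lie_def, sub_eq_zero] at this
  exact this.symm

theorem fcomm_q_vir (i : Fin (r + 1)) (μ : Fin N) : FComm (S.q μ) (S.vir i) := fun s t => by
  have := S.vir_q i μ t s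
  rw [Ring.lie_def, sub_eq_zero] at this
  exact this.symm

theorem fcomm_mom_vir (i : Fin (r + 1)) (μ : Fin N) : FComm (S.mom μ) (S.vir i) := fun s t => by
  have := S.vir_mom i μ t s
  rw [Ring.lie_def, sub_eq_zero] at this
  exact this.symm

theorem fcomm_cur_cur {i j : Fin (r + 1)} (h : i ≠ j) (m n m' n' : Fin N → ℕ)
    (A A' : UEnv N 𝔤) : FComm (S.cur i m n A) (S.cur j m' n' A') := fun s t => by
  have := S.cur_cur_ne i j h m n m' n' A A' s t
  rwa [Ring.lie_def, sub_eq_zero] at this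

theorem fcomm_vir_vir {i j : Fin (r + 1)} (h : i ≠ j) : FComm (S.vir i) (S.vir j) := fun s t => by
  have := S.vir_vir_ne i j h s t
  rwa [Ring.lie_def, sub_eq_zero] at this

theorem fcomm_vir_cur {i j : Fin (r + 1)} (h : i ≠ j) (m n : Fin N → ℕ)
    (A : UEnv N 𝔤) : FComm (S.vir i) (S.cur j m n A) := fun s t => by
  have := S.vir_cur_ne i j h m n A s t
  rwa [Ring.lie_def, sub_eq_zero] at this

theorem fcomm_onTrajectory_cur (f : MvPolynomial (Fin N) ℂ) (i : Fin (r + 1)) (m n : Fin N → ℕ)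
    (A : UEnv N 𝔤) : FComm (onTrajectory S.q f) (S.cur i m n A) :=
  FComm.onTrajectory_left (S.fcomm_q_cur i m n A) f

/-- `∫ q̇^ρ(t) h(q(t)) dt`. -/
def lineInt (ρ : Fin N) : MvPolynomial (Fin N) ℂ →ₗ[ℂ] Module.End ℂ V :=
  (fieldIntL V).comp ((normalProdL V (fieldDeriv (S.q ρ))).comp (onTrajectoryL S.q))

theorem trajForm_eq (f g : MvPolynomial (Fin N) ℂ) :
    trajForm S.q f g = ∑ ρ, S.lineInt ρ (MvPolynomial.pderiv ρ f * g) :=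
  trajForm_eq_sum S.isHeisenberg.qq f g

/-- The matrix of functions `M` coupled to the currents `I^{mA}_n`. -/
def curOp (i : Fin (r + 1)) : Matrix (jets N (p - i)) (jets N (p - i)) (MvPolynomial (Fin N) ℂ)
    →ₗ[ℂ] UEnv N 𝔤 →ₗ[ℂ] Module.End ℂ V :=
  LinearMap.mk₂ ℂ (fun M A => ∑ m, ∑ n,
      fieldInt (normalProd (onTrajectory S.q (M m n)) (S.cur i m n A)))
    (fun M M' A => by
      simp only [Matrix.add_apply, onTrajectory_eq, normalProd_eq, fieldInt_eq, map_add,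
        LinearMap.add_apply, Finset.sum_add_distrib])
    (fun c M A => by
      simp only [Matrix.smul_apply, onTrajectory_eq, normalProd_eq, fieldInt_eq, map_smul,
        LinearMap.smul_apply, Finset.smul_sum])
    (fun M A A' => by
      simp only [normalProd_eq, fieldInt_eq, map_add, Finset.sum_add_distrib])
    (fun c M A => by
      simp only [normalProd_eq, fieldInt_eq, map_smul, Finset.smul_sum])

theorem curOp_apply (i : Fin (r + 1))
    (M : Matrix (jets N (p - i)) (jets N (p - i)) (MvPolynomial (Fin N) ℂ)) (A : UEnv N 𝔤) :
    S.curOp i M A = ∑ m, ∑ n,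
      fieldInt (normalProd (onTrajectory S.q (M m n)) (S.cur i m n A)) := rfl

theorem lie_cur (i : Fin (r + 1)) (m n m' n' : jets N (p - i)) (A A' : UEnv N 𝔤)
    (f g : MvPolynomial (Fin N) ℂ) :
    ⁅fieldInt (normalProd (onTrajectory S.q f) (S.cur i m n A)),
      fieldInt (normalProd (onTrajectory S.q g) (S.cur i m' n' A'))⁆ =
      (if m' = n then fieldInt (normalProd (onTrajectory S.q (f * g))
        (S.cur i m n' (A * A'))) else 0) -
      (if m = n' then fieldInt (normalProd (onTrajectory S.q (f * g))
        (S.cur i m' n (A' * A))) else 0) -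
      (if m' = n ∧ m = n' then (S.k i A A' / (2 * Real.pi * Complex.I)) • trajForm S.q f g
        else 0) := by
  have hq := S.isHeisenberg
  have hcur : ∀ f g, ⁅smear f (S.cur i m n A), smear g (S.cur i m' n' A')⁆ = smear (f * g)
      ((if m' = n then S.cur i m n' (A * A') else 0) -
        (if m = n' then S.cur i m' n (A' * A) else 0)) +
      ((if m' = n ∧ m = n' then S.k i A A' / (2 * Real.pi * Complex.I) else 0) *
        -circInt (circDeriv f * g)) • 1 := by
    intro f g
    rw [S.cur_cur i m m.2 n n.2 m' m'.2 n' n'.2, smear_sub]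
    simp only [Subtype.coe_inj]
    congr 1
    · congr 1 <;> split_ifs <;> simp [smear_zero]
    · rw [ite_mul, zero_mul]
  have he : ∀ f, FComm (onTrajectory S.q f) ((if m' = n then S.cur i m n' (A * A') else 0) -
        (if m = n' then S.cur i m' n (A' * A) else 0)) := by
    intro f s t
    have h1 : FComm (onTrajectory S.q f) (if m' = n then S.cur i m n' (A * A') else 0) := by
      split_ifs
      · exact S.fcomm_onTrajectory_cur f _ _ _ _
      · exact (FComm.zero_left _).symm
    have h2 : FComm (onTrajectory S.q f) (if m = n' then S.cur i m' n (A' * A) else 0) := by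
      split_ifs
      · exact S.fcomm_onTrajectory_cur f _ _ _ _
      · exact (FComm.zero_left _).symm
    exact (h1 s t).sub_right (h2 s t)
  rw [lie_fieldInt_normalProd (hq.fcomm_onTrajectory f g) (S.fcomm_onTrajectory_cur f _ _ _ _)
    (S.fcomm_onTrajectory_cur f _ _ _ _) (he f) (S.fcomm_onTrajectory_cur g _ _ _ _) (he g)
    (lie_mode_of_lie_smear hcur), ← onTrajectory_mul hq.qq, normalProd_eq, map_sub, fieldInt_eq,
    map_sub]
  congr 1
  · congr 1 <;> split_ifs <;> simp [fieldInt_eq, normalProd_eq]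
  · rw [ite_smul, zero_smul]
    rfl

/-- `∫ f(q(t)) I^{mA}_n(t) dt`. -/
def curInt (i : Fin (r + 1)) (A : UEnv N 𝔤) (m n : jets N (p - i)) :
    MvPolynomial (Fin N) ℂ →+ Module.End ℂ V :=
  ((fieldIntL V).comp
    (((normalProdL V).flip (S.cur i m n A)).comp (onTrajectoryL S.q))).toAddMonoidHom

/-- The deltas in the current algebra multiply the coefficient matrices, and the Schwinger term
contracts both index pairs, leaving a trace. Every anomaly of the currents in the diffeomorphism and
gauge brackets comes from this term. -/
theorem lie_curOp (i : Fin (r + 1))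
    (M M' : Matrix (jets N (p - i)) (jets N (p - i)) (MvPolynomial (Fin N) ℂ))
    (A A' : UEnv N 𝔤) :
    ⁅S.curOp i M A, S.curOp i M' A'⁆ = S.curOp i (M * M') (A * A') - S.curOp i (M' * M) (A' * A) -
      (S.k i A A' / (2 * Real.pi * Complex.I)) •
        ∑ ρ, S.lineInt ρ ((M.map (MvPolynomial.pderiv ρ)) * M').trace := by
  have h1 := sum_ite_mul_apply (S.curInt i (A * A')) M M'
  have h2 := sum_ite_mul_apply' (S.curInt i (A' * A)) M M'
  have h3 := sum_ite_and fun m n m' n' => (S.k i A A' / (2 * Real.pi * Complex.I)) •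
    trajForm S.q (M m n) (M' m' n')
  rw [curOp_apply, curOp_apply, lie_sum_sum]
  simp only [S.lie_cur, Finset.sum_sub_distrib]
  refine congrArg₂ _ (congrArg₂ _ h1 h2) (h3.trans ?_)
  simp only [← Finset.smul_sum, S.trajForm_eq]
  congr 1
  simp only [Matrix.trace, Matrix.diag_apply, Matrix.mul_apply, Matrix.map_apply, map_sum]
  rw [Finset.sum_comm]
  simp_rw [Finset.sum_comm (s := Finset.univ (α := jets N (p - i))) (t := Finset.univ (α := Fin N))]
  refine Finset.sum_congr rfl fun ρ _ => ?_
  exact Finset.sum_comm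

end CurrentSystem

/-! ### Commutators of sums of operators -/

section RingLie

variable {L : Type*} [Ring L]

theorem ring_lie_sum {J : Type*} (s : Finset J) (Y : L) (X : J → L) :
    ⁅Y, ∑ i ∈ s, X i⁆ = ∑ i ∈ s, ⁅Y, X i⁆ := by
  simp only [Ring.lie_def, Finset.mul_sum, Finset.sum_mul, Finset.sum_sub_distrib]

theorem ring_sum_lie {J : Type*} (s : Finset J) (Y : L) (X : J → L) :
    ⁅∑ i ∈ s, X i, Y⁆ = ∑ i ∈ s, ⁅X i, Y⁆ := by
  simp only [Ring.lie_def, Finset.mul_sum, Finset.sum_mul, Finset.sum_sub_distrib]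

theorem ring_lie_add (Y X X' : L) : ⁅Y, X + X'⁆ = ⁅Y, X⁆ + ⁅Y, X'⁆ := by
  simp only [Ring.lie_def]; noncomm_ring

theorem ring_add_lie (Y X X' : L) : ⁅X + X', Y⁆ = ⁅X, Y⁆ + ⁅X', Y⁆ := by
  simp only [Ring.lie_def]; noncomm_ring

theorem ring_lie_zero (X : L) : ⁅X, (0 : L)⁆ = 0 := by
  rw [Ring.lie_def, mul_zero, zero_mul, sub_zero]

theorem ring_zero_lie (X : L) : ⁅(0 : L), X⁆ = 0 := by
  rw [Ring.lie_def, mul_zero, zero_mul, sub_zero]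

theorem ring_lie_skew (X Y : L) : ⁅X, Y⁆ = -⁅Y, X⁆ := by
  simp only [Ring.lie_def]; noncomm_ring

/-- The bracket of two sums with mutually commuting summands. -/
theorem lie_add_sum {J : Type*} [Fintype J] (T T' : L) (C C' : J → L)
    (h : ∀ i j, i ≠ j → ⁅C i, C' j⁆ = 0) :
    ⁅T + ∑ i, C i, T' + ∑ i, C' i⁆ =
      ⁅T, T'⁆ + ∑ i, (⁅T, C' i⁆ - ⁅T', C i⁆ + ⁅C i, C' i⁆) := by
  have h1 : ∀ i, ⁅C i, ∑ j, C' j⁆ = ⁅C i, C' i⁆ := fun i => by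
    rw [ring_lie_sum]
    exact Fintype.sum_eq_single i fun j hj => h i j hj.symm
  rw [ring_add_lie, ring_lie_add, ring_lie_add, ring_sum_lie, ring_sum_lie, ring_lie_sum]
  simp only [h1, Finset.sum_add_distrib, Finset.sum_sub_distrib, ring_lie_skew _ T',
    Finset.sum_neg_distrib]
  abel

end RingLie

section Fields

variable {V : Type*} [AddCommGroup V] [Module ℂ V]

theorem lie_smear (Y : Module.End ℂ V) (f : ℂ[T;T⁻¹]) (a : RField V) :
    ⁅Y, smear f a⁆ = smear f (adField Y a) := by
  rw [smear_eq, lie_fieldInt, adField_normalProd, adField_trig, smear_eq, normalProd_eq 0, map_zero,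
    LinearMap.zero_apply, zero_add]

theorem smear_mul (f g : ℂ[T;T⁻¹]) (a : RField V) :
    smear (f * g) a = smear g (normalProd (trig V f) a) := by
  rw [mul_comm, smear_eq, smear_eq, trig_mul, normalProd_assoc (FComm.trig_left _ _)
    (FComm.trig_left _ _) (FComm.trig_left _ _)]

theorem smear_comm_of_fcomm {a b : RField V} (h : FComm a b) (f : ℂ[T;T⁻¹]) :
    adField (smear f a) b = 0 := by
  rw [smear_eq]
  exact adField_eq_zero fun n => commute_fieldInt ((FComm.trig_left f b).normalProd_left h) n

/-- The action of a smeared field on a field of weight one, from its smeared form. -/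
theorem adField_smear_of_lie_smear {a c : RField V} {κ : ℂ} {f h : ℂ[T;T⁻¹]}
    (hac : ∀ g, ⁅smear f a, smear g c⁆ = smear (f * circDeriv g) c + (κ * circInt (h * g)) • 1) :
    adField (smear f a) c = -fieldDeriv (normalProd (trig V f) c) + κ • trig V h := by
  refine mode_ext fun n => ?_
  have h1 := hac (LaurentPolynomial.T (-n))
  rw [circDeriv_T, smear_mul, lie_smear, smear_T, circInt_mul_T, neg_neg] at h1
  have h2 : ∀ (c : ℂ) (j : ℤ) (b : RField V), smear (c • LaurentPolynomial.T j) b =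
      c • ((2 * Real.pi : ℂ) • mode b (-j)) := by
    intro c j b
    rw [← smear_T, smear_eq, smear_eq, normalProd_eq, fieldInt_eq]
    change fieldIntL V (normalProdL V (trigL V (c • _)) b) = _
    rw [map_smul, map_smul, LinearMap.smul_apply, map_smul]
    rfl
  rw [h2, neg_neg] at h1
  have h3 := congrArg (fun Z : Module.End ℂ V => (1 / (2 * Real.pi) : ℂ) • Z) h1
  simp only [smul_smul, smul_add, one_div_mul_cancel two_pi_ne_zero, one_smul] at h3
  rw [h3, mode_add, mode_neg, mode_fieldDeriv, mode_smul, mode_trig, smul_smul, ← neg_smul]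
  have hpi := two_pi_ne_zero
  congr 2
  · push_cast; field_simp
  · field_simp

end Fields

/-! ### Action of the trajectory and of reparametrizations on coupled currents -/

namespace CurrentSystem

variable {ι 𝔤 : Type*} [LieRing 𝔤] [LieAlgebra ℂ 𝔤] {N r p : ℕ} {Jb : Module.Basis ι ℂ 𝔤}
  {B : LinearMap.BilinForm ℂ 𝔤} {l : 𝔤 →ₗ[ℂ] ℂ} {P : ℕ → CentralParams}
  {V : Type*} [AddCommGroup V] [Module ℂ V] (S : CurrentSystem N r p Jb B l P V)

theorem adField_curOp_of_fcomm {i : Fin (r + 1)}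
    (M : Matrix (jets N (p - i)) (jets N (p - i)) (MvPolynomial (Fin N) ℂ)) (A : UEnv N 𝔤)
    {b : RField V} (hb : ∀ μ, FComm (S.q μ) b) (h : ∀ m n A, FComm (S.cur i m n A) b) :
    adField (S.curOp i M A) b = 0 := by
  refine adField_eq_zero fun k => ?_
  rw [curOp_apply]
  exact Commute.sum_left _ _ _ fun m _ => Commute.sum_left _ _ _ fun n _ =>
    commute_fieldInt ((FComm.onTrajectory_left hb _).normalProd_left (h _ _ _)) k

theorem lie_curOp_of_ne {i j : Fin (r + 1)} (h : i ≠ j)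
    (M : Matrix (jets N (p - i)) (jets N (p - i)) (MvPolynomial (Fin N) ℂ))
    (M' : Matrix (jets N (p - j)) (jets N (p - j)) (MvPolynomial (Fin N) ℂ)) (A A' : UEnv N 𝔤) :
    ⁅S.curOp i M A, S.curOp j M' A'⁆ = 0 := by
  rw [S.curOp_apply j, ring_lie_sum]
  refine Finset.sum_eq_zero fun m _ => ?_
  rw [ring_lie_sum]
  refine Finset.sum_eq_zero fun n _ => ?_
  rw [lie_fieldInt, S.adField_curOp_of_fcomm M A
    (fun μ => (S.isHeisenberg.fcomm_q_onTrajectory μ _).normalProd_right (S.fcomm_q_cur _ _ _ _ μ))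
    (fun _ _ _ => (S.fcomm_onTrajectory_cur _ _ _ _ _).symm.normalProd_right
      (S.fcomm_cur_cur h _ _ _ _ _ _)), fieldInt_eq, map_zero]

/-- The momentum commutes with the currents and differentiates only their coefficients: this is the
motion of the base point missing from the jet matrices. -/
theorem lie_trajOp_curOp (ξ : VecField N) (i : Fin (r + 1))
    (M : Matrix (jets N (p - i)) (jets N (p - i)) (MvPolynomial (Fin N) ℂ)) (A : UEnv N 𝔤) :
    ⁅trajOp S.mom (fun μ => onTrajectory S.q (ξ μ)), S.curOp i M A⁆ =
      S.curOp i (∑ μ, ξ μ • M.map (MvPolynomial.pderiv μ)) A := by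
  rw [S.curOp_apply i, S.curOp_apply i, ring_lie_sum]
  refine Finset.sum_congr rfl fun m _ => ?_
  rw [ring_lie_sum]
  refine Finset.sum_congr rfl fun n _ => ?_
  rw [lie_fieldInt, adField_normalProd, adField_trajOp_onTrajectory S.isHeisenberg
    (fun μ ν => (S.isHeisenberg.fcomm_q_onTrajectory ν _).symm),
    adField_trajOp_eq_zero (fun μ => S.fcomm_mom_cur i _ _ _ μ)
    (fun μ => S.fcomm_onTrajectory_cur _ _ _ _ _), normalProd_eq _ 0, map_zero, add_zero]
  congr 2
  rw [Matrix.sum_apply, onTrajectory_eq, map_sum]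
  refine Finset.sum_congr rfl fun μ _ => ?_
  rw [← onTrajectory_mul S.isHeisenberg.qq]
  rfl

/-- The generator of reparametrizations, split into the contributions of the trajectory and of the
currents. -/
def reparOp (f : ℂ[T;T⁻¹]) : Module.End ℂ V :=
  trajOp S.mom (reparField S.q f) + ∑ i, smear f (S.vir i)

theorem adField_reparOp_cur (f : ℂ[T;T⁻¹]) (i : Fin (r + 1)) (m n : jets N (p - i))
    (A : UEnv N 𝔤) :
    adField (S.reparOp f) (S.cur i m n A) =
      -fieldDeriv (normalProd (trig V f) (S.cur i m n A)) +
        (if m = n then S.d i A / (4 * Real.pi * Complex.I) else 0) •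
          trig V (circDeriv (circDeriv f) - Complex.I • circDeriv f) := by
  have h1 : adField (smear f (S.vir i)) (S.cur i m n A) =
      -fieldDeriv (normalProd (trig V f) (S.cur i m n A)) +
        (if m = n then S.d i A / (4 * Real.pi * Complex.I) else 0) •
          trig V (circDeriv (circDeriv f) - Complex.I • circDeriv f) := by
    refine adField_smear_of_lie_smear fun g => ?_
    rw [S.vir_cur i m m.2 n n.2, ite_mul, zero_mul]
    simp only [Subtype.coe_inj]
  have h2 : adField (trajOp S.mom (reparField S.q f)) (S.cur i m n A) = 0 :=
    adField_trajOp_eq_zero (fun μ => S.fcomm_mom_cur i _ _ _ μ)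
      (fun μ => FComm.reparField_left f μ (S.fcomm_q_cur i _ _ _ μ))
  have h3 : ∀ j, j ≠ i → adField (smear f (S.vir j)) (S.cur i m n A) = 0 := fun j hj =>
    smear_comm_of_fcomm (S.fcomm_vir_cur hj _ _ _) f
  refine mode_ext fun k => ?_
  rw [mode_adField, reparOp, ring_add_lie, ring_sum_lie, Fintype.sum_eq_single i, ← mode_adField,
    ← mode_adField, h1, h2, mode_zero, zero_add]
  intro j hj
  rw [← mode_adField, h3 j hj, mode_zero]

theorem adField_reparOp_of_fcomm (f : ℂ[T;T⁻¹]) {b : RField V} (hb : ∀ i, FComm (S.vir i) b) :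
    adField (S.reparOp f) b = adField (trajOp S.mom (reparField S.q f)) b := by
  refine mode_ext fun k => ?_
  rw [mode_adField, reparOp, ring_add_lie, ring_sum_lie, Finset.sum_eq_zero, add_zero,
    ← mode_adField]
  intro j hj
  rw [← mode_adField, smear_comm_of_fcomm (hb j), mode_zero]

/-- A current has weight one and a function of the trajectory weight zero, so their product changes
by a total derivative. Only the central term is left, and it is diagonal in the multi-indices. -/
theorem lie_reparOp_curOp (f : ℂ[T;T⁻¹]) (i : Fin (r + 1))
    (M : Matrix (jets N (p - i)) (jets N (p - i)) (MvPolynomial (Fin N) ℂ)) (A : UEnv N 𝔤) :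
    ⁅S.reparOp f, S.curOp i M A⁆ = (S.d i A / (4 * Real.pi * Complex.I)) •
      smear (circDeriv (circDeriv f) - Complex.I • circDeriv f) (onTrajectory S.q M.trace) := by
  have hcur : ∀ m n : jets N (p - i),
      ⁅S.reparOp f, fieldInt (normalProd (onTrajectory S.q (M m n)) (S.cur i m n A))⁆ =
      (if m = n then S.d i A / (4 * Real.pi * Complex.I) else 0) •
        smear (circDeriv (circDeriv f) - Complex.I • circDeriv f) (onTrajectory S.q (M m n)) := by
    intro m n
    have hc := S.fcomm_onTrajectory_cur (M m n) i m n A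
    rw [lie_fieldInt, adField_normalProd, S.adField_reparOp_cur, S.adField_reparOp_of_fcomm f
      (fun j => FComm.onTrajectory_right (fun μ => S.fcomm_q_vir j μ) _),
      adField_trajOp_reparField_onTrajectory S.isHeisenberg]
    set κ : ℂ := if m = n then S.d i A / (4 * Real.pi * Complex.I) else 0
    set h := circDeriv (circDeriv f) - Complex.I • circDeriv f
    have h1 : normalProd (normalProd (trig V f) (fieldDeriv (onTrajectory S.q (M m n))))
        (S.cur i m n A) = normalProd (fieldDeriv (onTrajectory S.q (M m n)))
          (normalProd (trig V f) (S.cur i m n A)) := by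
      rw [normalProd_comm (FComm.trig_left f _), normalProd_assoc (FComm.trig_right _ _)
        hc.deriv_left (FComm.trig_left _ _)]
    -- The two noncentral terms are the two halves of the derivative of `f M(q) I`.
    have h2 := fieldInt_fieldDeriv (normalProd (onTrajectory S.q (M m n))
      (normalProd (trig V f) (S.cur i m n A)))
    rw [fieldDeriv_normalProd, ← h1] at h2
    have h3 : smear h (onTrajectory S.q (M m n)) =
        fieldInt (normalProd (onTrajectory S.q (M m n)) (trig V h)) := by
      rw [smear_eq, normalProd_comm (FComm.trig_left h _)]
    rw [h3]
    simp only [normalProd_eq, fieldInt_eq, map_add, map_neg, map_smul, LinearMap.neg_apply] at h2 ⊢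
    rw [← add_assoc, ← neg_add, h2, neg_zero, zero_add]
  rw [curOp_apply, ring_lie_sum]
  simp only [ring_lie_sum, hcur, ite_smul, zero_smul, Finset.sum_ite_eq, Finset.mem_univ, if_true]
  rw [← Finset.smul_sum, Matrix.trace, onTrajectory_eq, map_sum, smear_sum]
  rfl

theorem lie_reparOp_trajOp (f : ℂ[T;T⁻¹]) (ξ : VecField N) :
    ⁅S.reparOp f, trajOp S.mom (fun μ => onTrajectory S.q (ξ μ))⁆ =
      (1 / (4 * Real.pi * Complex.I) : ℂ) •
        smear (circDeriv (circDeriv f) - Complex.I • circDeriv f)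
          (onTrajectory S.q (∑ μ, MvPolynomial.pderiv μ (ξ μ))) := by
  rw [trajOp, lie_fieldInt, S.adField_reparOp_of_fcomm, ← lie_fieldInt]
  · exact lie_trajOp_reparField_onTrajectory S.isHeisenberg f ξ
  · exact fun i => (FComm.sum_left fun μ _ => (S.fcomm_mom_vir i μ).normalProd_left
      (FComm.onTrajectory_left (fun μ => S.fcomm_q_vir i μ) _)).symm

theorem lie_reparOp (f g : ℂ[T;T⁻¹]) :
    ⁅S.reparOp f, S.reparOp g⁆ = S.reparOp (circBracket f g) +
      ((2 * N + ∑ i : Fin (r + 1), (P i).c * (N + (p - (i : ℕ))).choose N) /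
        (24 * Real.pi * Complex.I) *
          circInt (circDeriv (circDeriv f) * circDeriv g - circDeriv f * g) : ℂ) • 1 := by
  have h1 : ∀ (f g : ℂ[T;T⁻¹]) i,
      ⁅trajOp S.mom (reparField S.q f), smear g (S.vir i)⁆ = 0 := fun f g i => by
    rw [lie_smear, adField_trajOp_eq_zero (fun μ => S.fcomm_mom_vir i μ)
      (fun μ => FComm.reparField_left f μ (S.fcomm_q_vir i μ)), smear_zero]
  rw [reparOp, reparOp, lie_add_sum, lie_trajOp_reparField S.isHeisenberg]
  · simp only [h1, S.vir_vir, sub_zero, zero_add, Finset.sum_add_distrib, ← Finset.sum_smul]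
    rw [reparOp, add_add_add_comm, ← add_smul]
    congr 2
    rw [← Finset.sum_mul, ← Finset.sum_div]
    ring
  · intro i j hij
    rw [lie_smear, smear_comm_of_fcomm (S.fcomm_vir_vir hij), smear_zero]

theorem lie_reparOp_q (f g : ℂ[T;T⁻¹]) (μ : Fin N) :
    ⁅S.reparOp f, smear g (S.q μ)⁆ = -smear (f * g) (fieldDeriv (S.q μ)) := by
  rw [lie_smear, S.adField_reparOp_of_fcomm f fun i => (S.fcomm_q_vir i μ).symm,
    adField_trajOp_q S.isHeisenberg fun μ ν => FComm.reparField_left f μ (S.isHeisenberg.qq μ ν),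
    reparField, smear_neg, smear_mul]

end CurrentSystem

/-! ### Commutation relations in the enveloping algebra -/

section Env

attribute [local instance 100] LieRing.ofAssociativeRing

variable {N : ℕ} {𝔤 : Type*} [LieRing 𝔤] [LieAlgebra ℂ 𝔤]

theorem uJ_mul_sub (x y : 𝔤) : uJ N x * uJ N y - uJ N y * uJ N x = uJ N ⁅x, y⁆ := by
  unfold uJ
  rw [← Ring.lie_def, ← LieHom.map_lie, LieAlgebra.Prod.bracket_apply]
  simp

theorem uT_mul_uJ_sub (μ ν : Fin N) (x : 𝔤) :
    uT 𝔤 μ ν * uJ N x - uJ N x * uT 𝔤 μ ν = 0 := by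
  unfold uJ uT
  rw [← Ring.lie_def, ← LieHom.map_lie, LieAlgebra.Prod.bracket_apply]
  simp only [zero_lie, lie_zero]
  exact map_zero _

theorem single_mul_single_eq_ite (μ ν ρ σ : Fin N) :
    Matrix.single μ ν (1 : ℂ) * Matrix.single ρ σ 1 =
      if ρ = ν then Matrix.single μ σ 1 else 0 := by
  split_ifs with h
  · rw [h, Matrix.single_mul_single_same, one_mul]
  · exact Matrix.single_mul_single_of_ne _ _ _ _ (fun h' => h h'.symm) _

theorem uT_mul_sub (μ ν ρ σ : Fin N) :
    uT 𝔤 μ ν * uT 𝔤 ρ σ - uT 𝔤 ρ σ * uT 𝔤 μ ν =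
      (if ρ = ν then uT 𝔤 μ σ else 0) - (if μ = σ then uT 𝔤 ρ ν else 0) := by
  have h : ∀ M : Matrix (Fin N) (Fin N) ℂ, UniversalEnvelopingAlgebra.ι ℂ ((0 : 𝔤), M) =
    ((UniversalEnvelopingAlgebra.ι ℂ :
      𝔤 × Matrix (Fin N) (Fin N) ℂ →ₗ⁅ℂ⁆ UEnv N 𝔤) : _ →ₗ[ℂ] UEnv N 𝔤)
      (LinearMap.inr ℂ 𝔤 (Matrix (Fin N) (Fin N) ℂ) M) := fun M => rfl
  unfold uT
  rw [← Ring.lie_def, ← LieHom.map_lie, LieAlgebra.Prod.bracket_apply, lie_zero, Ring.lie_def,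
    single_mul_single_eq_ite, single_mul_single_eq_ite, h, h, h, map_sub, map_sub]
  split_ifs <;> simp only [map_zero]

theorem uJ_sum {ι : Type*} (s : Finset ι) (c : ι → ℂ) (x : ι → 𝔤) :
    uJ N (∑ a ∈ s, c a • x a) = ∑ a ∈ s, c a • uJ N (x a) := by
  have h : ∀ x : 𝔤, uJ N x = ((UniversalEnvelopingAlgebra.ι ℂ :
    𝔤 × Matrix (Fin N) (Fin N) ℂ →ₗ⁅ℂ⁆ UEnv N 𝔤) : _ →ₗ[ℂ] UEnv N 𝔤)
      (LinearMap.inl ℂ 𝔤 (Matrix (Fin N) (Fin N) ℂ) x) := fun x => rfl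
  simp only [h, map_sum, map_smul]

end Env

/-! ### Linearity of the jet matrices -/

section Linear

variable {N : ℕ}

theorem multiDeriv_add (m : Fin N → ℕ) (f g : MvPolynomial (Fin N) ℂ) :
    multiDeriv m (f + g) = multiDeriv m f + multiDeriv m g := by
  induction m using multiIndex_induction with
  | h0 => simp only [multiDeriv_zero]
  | hs m μ ih => simp only [multiDeriv_add_single, ih, map_add]

theorem multiDeriv_smul (m : Fin N → ℕ) (c : ℂ) (f : MvPolynomial (Fin N) ℂ) :
    multiDeriv m (c • f) = c • multiDeriv m f := by
  induction m using multiIndex_induction with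
  | h0 => simp only [multiDeriv_zero]
  | hs m μ ih => simp only [multiDeriv_add_single, ih, Derivation.map_smul]

theorem jetJ_apply (q : ℕ) (f : MvPolynomial (Fin N) ℂ) (m n : jets N q) :
    jetJ q f m n = (multiChoose m.1 n.1 : ℂ) • multiDeriv (m.1 - n.1) f := jetEntry_mulOp f m n

theorem jetV_apply (q : ℕ) (ξ : VecField N) (m n : jets N q) :
    jetV q ξ m n = ∑ μ, if n.1 μ = 0 ∨ n.1 - Pi.single μ 1 = m.1 then 0 else
      (multiChoose m.1 (n.1 - Pi.single μ 1) : ℂ) •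
        multiDeriv (m.1 - (n.1 - Pi.single μ 1)) (ξ μ) := jetEntry_vecOp ξ m n

/-- `jetJ` as a linear map. -/
def jetJL (N q : ℕ) :
    MvPolynomial (Fin N) ℂ →ₗ[ℂ] Matrix (jets N q) (jets N q) (MvPolynomial (Fin N) ℂ) where
  toFun := jetJ q
  map_add' f g := Matrix.ext fun m n => by
    simp only [Matrix.add_apply, jetJ_apply, multiDeriv_add, smul_add]
  map_smul' c f := Matrix.ext fun m n => by
    simp only [Matrix.smul_apply, jetJ_apply, multiDeriv_smul, RingHom.id_apply,
      smul_comm c]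

/-- `jetV` as a linear map. -/
def jetVL (N q : ℕ) :
    VecField N →ₗ[ℂ] Matrix (jets N q) (jets N q) (MvPolynomial (Fin N) ℂ) where
  toFun := jetV q
  map_add' ξ η := Matrix.ext fun m n => by
    simp only [Matrix.add_apply, jetV_apply, Pi.add_apply, multiDeriv_add, smul_add,
      ← Finset.sum_add_distrib]
    exact Finset.sum_congr rfl fun μ _ => by split_ifs <;> simp
  map_smul' c ξ := Matrix.ext fun m n => by
    simp only [Matrix.smul_apply, jetV_apply, Pi.smul_apply, multiDeriv_smul, RingHom.id_apply,
      Finset.smul_sum]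
    exact Finset.sum_congr rfl fun μ _ => by
      split_ifs
      · rw [smul_zero]
      · rw [smul_comm c]

end Linear

/-- The matrix unit contractions in the commutator of two sums of `gl(N)` currents. -/
theorem sum_single_contraction {N : ℕ} {R W : Type*} [CommRing R] [AddCommGroup W]
    (G : Fin N → Fin N → R →+ W) (a b : Fin N → Fin N → R) :
    (∑ μ, ∑ ν, ∑ κ, ∑ σ, ((if σ = μ then G ν κ (a μ ν * b κ σ) else 0) -
      (if ν = κ then G σ μ (a μ ν * b κ σ) else 0))) =
      ∑ κ, ∑ ν, G ν κ (∑ μ, (a μ ν * b κ μ - b μ ν * a κ μ)) := by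
  simp only [Finset.sum_sub_distrib, map_sub, map_sum]
  congr 1
  · simp only [Finset.sum_ite_eq', Finset.mem_univ, if_true]
    rw [Finset.sum_comm]
    conv_rhs => rw [Finset.sum_comm]
    refine Finset.sum_congr rfl fun ν _ => ?_
    rw [Finset.sum_comm]
  · refine Finset.sum_congr rfl fun μ _ => ?_
    conv_rhs => rw [Finset.sum_comm]
    refine Finset.sum_congr rfl fun ν _ => ?_
    rw [Finset.sum_comm]
    refine Finset.sum_congr rfl fun σ _ => ?_
    rw [Finset.sum_ite_eq, if_pos (Finset.mem_univ _), mul_comm]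

/-! ### Brackets of jet operators within one system of currents -/

namespace CurrentSystem

variable {ι 𝔤 : Type*} [LieRing 𝔤] [LieAlgebra ℂ 𝔤] {N r p : ℕ} {Jb : Module.Basis ι ℂ 𝔤}
  {B : LinearMap.BilinForm ℂ 𝔤} {l : 𝔤 →ₗ[ℂ] ℂ} {P : ℕ → CentralParams}
  {V : Type*} [AddCommGroup V] [Module ℂ V] (S : CurrentSystem N r p Jb B l P V)

/-- `∫ q̇^ρ(t) h_ρ(q(t)) dt`. -/
def loopInt : (Fin N → MvPolynomial (Fin N) ℂ) →ₗ[ℂ] Module.End ℂ V :=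
  ∑ ρ, (S.lineInt ρ).comp (LinearMap.proj ρ)

theorem loopInt_apply (h : Fin N → MvPolynomial (Fin N) ℂ) :
    S.loopInt h = ∑ ρ, S.lineInt ρ (h ρ) := by
  rw [loopInt, LinearMap.sum_apply]
  rfl

theorem fieldInt_sum_eq_loopInt (h : Fin N → MvPolynomial (Fin N) ℂ) :
    fieldInt (∑ ρ, normalProd (fieldDeriv (S.q ρ)) (onTrajectory S.q (h ρ))) = S.loopInt h := by
  rw [loopInt_apply, fieldInt_eq, map_sum]
  rfl

/-- `∫ ∑ binom(m,n) ∂_{m-n} f(q(t)) I^{mA}_n(t) dt`. -/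
def curFn (i : Fin (r + 1)) :
    MvPolynomial (Fin N) ℂ →ₗ[ℂ] UEnv N 𝔤 →ₗ[ℂ] Module.End ℂ V :=
  (S.curOp i).comp (jetJL N (p - i))

/-- The action of vector fields on the jets, without the action on tensor indices. -/
def curVec (i : Fin (r + 1)) : VecField N →ₗ[ℂ] Module.End ℂ V :=
  ((S.curOp i).flip 1).comp (jetVL N (p - i))

theorem curFn_apply (i : Fin (r + 1)) (f : MvPolynomial (Fin N) ℂ) (A : UEnv N 𝔤) :
    S.curFn i f A = S.curOp i (jetJ (p - i) f) A := rfl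

theorem curVec_apply (i : Fin (r + 1)) (ξ : VecField N) :
    S.curVec i ξ = S.curOp i (jetV (p - i) ξ) 1 := rfl

theorem map_pderiv_jetJ (q : ℕ) (ρ : Fin N) (f : MvPolynomial (Fin N) ℂ) :
    (jetJ q f).map (MvPolynomial.pderiv ρ) = jetJ q (MvPolynomial.pderiv ρ f) :=
  Matrix.ext fun m n => pderiv_jetJ_apply q ρ f m n

theorem map_pderiv_jetV (q : ℕ) (ρ : Fin N) (ξ : VecField N) :
    (jetV q ξ).map (MvPolynomial.pderiv ρ) = jetV q (fun μ => MvPolynomial.pderiv ρ (ξ μ)) :=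
  Matrix.ext fun m n => pderiv_jetV_apply q ρ ξ m n

theorem smul_sum_lineInt (k c : ℂ) (h : Fin N → MvPolynomial (Fin N) ℂ) :
    (k / (2 * Real.pi * Complex.I)) • ∑ ρ, S.lineInt ρ (c • h ρ) =
      (1 / (2 * Real.pi * Complex.I) : ℂ) • S.loopInt fun ρ => (k * c) • h ρ := by
  rw [loopInt_apply]
  simp only [map_smul, ← Finset.smul_sum, smul_smul]
  congr 1
  ring

theorem lie_curFn_curFn (i : Fin (r + 1)) (f g : MvPolynomial (Fin N) ℂ) (A A' : UEnv N 𝔤) :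
    ⁅S.curFn i f A, S.curFn i g A'⁆ = S.curFn i (f * g) (A * A' - A' * A) -
      (1 / (2 * Real.pi * Complex.I) : ℂ) • S.loopInt fun ρ =>
        (S.k i A A' * ((N + (p - (i : ℕ))).choose N : ℂ)) • (MvPolynomial.pderiv ρ f * g) := by
  rw [curFn_apply, curFn_apply, lie_curOp, jetJ_mul, jetJ_mul, mul_comm g f]
  simp only [map_pderiv_jetJ, jetJ_mul, trace_jetJ]
  rw [smul_sum_lineInt, map_sub]
  rfl

/-- The full action of a vector field on the currents coupled to a function of the trajectory. -/
theorem lie_vec_curFn (i : Fin (r + 1)) (ξ : VecField N) (f : MvPolynomial (Fin N) ℂ)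
    (A : UEnv N 𝔤) :
    ⁅trajOp S.mom (fun μ => onTrajectory S.q (ξ μ)), S.curFn i f A⁆ +
        ⁅S.curVec i ξ, S.curFn i f A⁆ =
      S.curFn i (∑ μ, ξ μ * MvPolynomial.pderiv μ f) A -
      (1 / (2 * Real.pi * Complex.I) : ℂ) • S.loopInt fun ρ =>
        (S.k i A 1 * ((N + (p - (i : ℕ))).choose (N + 1) : ℂ)) •
          ∑ μ, MvPolynomial.pderiv μ (MvPolynomial.pderiv ρ (ξ μ)) * f := by
  have h1 := congrArg (fun M => S.curOp i M A) (jetV_lie_jetJ (p - i) ξ f)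
  rw [curFn_apply, curFn_apply, curVec_apply, lie_trajOp_curOp, lie_curOp, one_mul, mul_one,
    S.k_symm i 1 A]
  simp only [map_pderiv_jetJ, map_pderiv_jetV, trace_jetV_mul_jetJ]
  rw [smul_sum_lineInt]
  simp only [map_sub, LinearMap.sub_apply] at h1
  rw [h1]
  abel

/-- The same bracket in the opposite order. -/
theorem lie_curFn_vec (i : Fin (r + 1)) (ξ : VecField N) (f : MvPolynomial (Fin N) ℂ)
    (A : UEnv N 𝔤) :
    -⁅trajOp S.mom (fun μ => onTrajectory S.q (ξ μ)), S.curFn i f A⁆ +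
        ⁅S.curFn i f A, S.curVec i ξ⁆ =
      -S.curFn i (∑ μ, ξ μ * MvPolynomial.pderiv μ f) A -
      (1 / (2 * Real.pi * Complex.I) : ℂ) • S.loopInt fun ρ =>
        (S.k i A 1 * ((N + (p - (i : ℕ))).choose (N + 1) : ℂ)) •
          ∑ μ, MvPolynomial.pderiv μ (ξ μ) * MvPolynomial.pderiv ρ f := by
  have h1 := congrArg (fun M => S.curOp i M A) (jetV_lie_jetJ (p - i) ξ f)
  rw [curFn_apply, curFn_apply, curVec_apply, lie_trajOp_curOp, lie_curOp, one_mul, mul_one]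
  simp only [map_pderiv_jetJ, Matrix.trace_mul_comm (jetJ _ _) (jetV _ _), trace_jetV_mul_jetJ]
  rw [smul_sum_lineInt]
  simp only [map_sub, LinearMap.sub_apply] at h1
  rw [← sub_eq_zero] at h1 ⊢
  rw [← neg_eq_zero, ← h1]
  abel

/-- The cross brackets with the trajectory cancel the base point corrections in `jetV_lie_jetV`; the
cocycle is the trace of two jet vector fields, weighted by `k(1,1)`. -/
theorem lie_curVec_curVec (i : Fin (r + 1)) (ξ η : VecField N) :
    ⁅trajOp S.mom (fun μ => onTrajectory S.q (ξ μ)), S.curVec i η⁆ -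
      ⁅trajOp S.mom (fun μ => onTrajectory S.q (η μ)), S.curVec i ξ⁆ +
      ⁅S.curVec i ξ, S.curVec i η⁆ = S.curVec i (vecBracket ξ η) -
      (1 / (2 * Real.pi * Complex.I) : ℂ) • S.loopInt fun ρ => (S.k i 1 1 * 1) •
        (((N + (p - (i : ℕ)) + 1).choose (N + 2) : ℂ) • ∑ μ, ∑ ν,
          MvPolynomial.pderiv ν (MvPolynomial.pderiv ρ (ξ μ)) * MvPolynomial.pderiv μ (η ν) +
        ((N + (p - (i : ℕ))).choose (N + 2) : ℂ) • ∑ μ, ∑ ν,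
          MvPolynomial.pderiv μ (MvPolynomial.pderiv ρ (ξ μ)) * MvPolynomial.pderiv ν (η ν)) := by
  have h1 := congrArg (fun M => S.curOp i M 1) (jetV_lie_jetV (p - i) ξ η)
  rw [← smul_sum_lineInt, curVec_apply, curVec_apply, lie_trajOp_curOp, lie_trajOp_curOp,
    lie_curOp, one_mul]
  simp only [map_pderiv_jetV, trace_jetV_mul_jetV, one_smul]
  simp only [map_sub, map_add, LinearMap.sub_apply, LinearMap.add_apply] at h1
  rw [h1, curVec_apply]
  abel

end CurrentSystem

/-- `∂_ρ ∂_ν ξ^μ ∂_μ η^ν`. -/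
def mixedForm {N : ℕ} (ξ η : VecField N) (ρ : Fin N) : MvPolynomial (Fin N) ℂ :=
  ∑ μ, ∑ ν, MvPolynomial.pderiv ρ (MvPolynomial.pderiv ν (ξ μ)) * MvPolynomial.pderiv μ (η ν)

/-- `∂_ρ ∂_μ ξ^μ ∂_ν η^ν`. -/
def divForm {N : ℕ} (ξ η : VecField N) (ρ : Fin N) : MvPolynomial (Fin N) ℂ :=
  ∑ μ, ∑ ν, MvPolynomial.pderiv ρ (MvPolynomial.pderiv μ (ξ μ)) * MvPolynomial.pderiv ν (η ν)

/-- The Jacobian of a bracket is the transported Jacobians plus their matrix commutator. The three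
pieces arise from vector-tensor, tensor-vector and tensor-tensor brackets. -/
theorem pderiv_vecBracket {N : ℕ} (ξ η : VecField N) (ν κ : Fin N) :
    MvPolynomial.pderiv ν (vecBracket ξ η κ) =
      ∑ μ, ξ μ * MvPolynomial.pderiv μ (MvPolynomial.pderiv ν (η κ)) -
      ∑ μ, η μ * MvPolynomial.pderiv μ (MvPolynomial.pderiv ν (ξ κ)) +
      ∑ μ, (MvPolynomial.pderiv ν (ξ μ) * MvPolynomial.pderiv μ (η κ) -
        MvPolynomial.pderiv ν (η μ) * MvPolynomial.pderiv μ (ξ κ)) := by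
  rw [vecBracket, map_sum, ← Finset.sum_sub_distrib, ← Finset.sum_add_distrib]
  refine Finset.sum_congr rfl fun μ _ => ?_
  rw [map_sub, Derivation.leibniz, Derivation.leibniz, pderiv_comm ν μ, pderiv_comm ν μ]
  simp only [smul_eq_mul]
  ring

section Kronecker

variable {N : ℕ} {M : Type*} [AddCommGroup M] [Module ℂ M]

theorem sum_ite_mul_smul (k b : ℂ) (F : Fin N → Fin N → M) :
    ∑ κ, ∑ ν, ((if ν = κ then k else 0) * b) • F κ ν = (k * b) • ∑ κ, F κ κ := by
  simp only [ite_mul, zero_mul, ite_smul, zero_smul, Finset.sum_ite_eq', Finset.mem_univ, if_true,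
    Finset.smul_sum]

theorem sum_ite_add_ite_mul_smul (k k' b : ℂ) (F : Fin N → Fin N → Fin N → Fin N → M) :
    ∑ μ, ∑ ν, ∑ κ, ∑ σ, (((if ν = κ ∧ σ = μ then k else 0) +
      (if ν = μ ∧ σ = κ then k' else 0)) * b) • F μ ν κ σ =
      (k * b) • (∑ μ, ∑ ν, F μ ν ν μ) + (k' * b) • ∑ μ, ∑ κ, F μ μ κ κ := by
  simp only [add_mul, add_smul, Finset.sum_add_distrib, ite_mul, zero_mul, ite_smul, zero_smul]
  congr 1
  · rw [Finset.smul_sum]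
    refine Finset.sum_congr rfl fun μ _ => ?_
    rw [Finset.smul_sum]
    refine Finset.sum_congr rfl fun ν _ => ?_
    rw [Finset.sum_eq_single ν, Finset.sum_eq_single μ]
    · rw [if_pos ⟨rfl, rfl⟩]
    · exact fun σ _ hσ => if_neg fun h => hσ h.2
    · simp
    · exact fun κ _ hκ => Finset.sum_eq_zero fun σ _ => if_neg fun h => hκ h.1.symm
    · simp
  · rw [Finset.smul_sum]
    refine Finset.sum_congr rfl fun μ _ => ?_
    rw [Finset.smul_sum, Finset.sum_eq_single μ]
    · refine Finset.sum_congr rfl fun κ _ => ?_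
      rw [Finset.sum_eq_single κ]
      · rw [if_pos ⟨rfl, rfl⟩]
      · exact fun σ _ hσ => if_neg fun h => hσ h.2
      · simp
    · exact fun ν _ hν => Finset.sum_eq_zero fun κ _ => Finset.sum_eq_zero fun σ _ =>
        if_neg fun h => hν h.1
    · simp

end Kronecker

/-! ### Diffeomorphism bracket of one system of currents -/

namespace CurrentSystem

variable {ι 𝔤 : Type*} [LieRing 𝔤] [LieAlgebra ℂ 𝔤] {N r p : ℕ} {Jb : Module.Basis ι ℂ 𝔤}
  {B : LinearMap.BilinForm ℂ 𝔤} {l : 𝔤 →ₗ[ℂ] ℂ} {P : ℕ → CentralParams}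
  {V : Type*} [AddCommGroup V] [Module ℂ V] (S : CurrentSystem N r p Jb B l P V)

/-- The action of vector fields on tensor indices, given by the `gl(N)` currents. -/
def curTen (i : Fin (r + 1)) (ξ : VecField N) : Module.End ℂ V :=
  ∑ μ, ∑ ν, S.curFn i (MvPolynomial.pderiv ν (ξ μ)) (uT 𝔤 ν μ)

/-- The action of vector fields on the `i`-th system of currents. -/
def curL (i : Fin (r + 1)) (ξ : VecField N) : Module.End ℂ V := S.curVec i ξ + S.curTen i ξ

/-- `∫ ξ^μ(q(t)) p_μ(t) dt`. -/
def trajL (ξ : VecField N) : Module.End ℂ V :=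
  trajOp S.mom (fun μ => onTrajectory S.q (ξ μ))

theorem sum_smul_loopInt {J : Type*} (s : Finset J) (c : ℂ)
    (h : J → Fin N → MvPolynomial (Fin N) ℂ) :
    ∑ j ∈ s, c • S.loopInt (h j) = c • S.loopInt fun ρ => ∑ j ∈ s, h j ρ := by
  rw [← Finset.smul_sum, ← map_sum]
  congr 2
  funext ρ
  rw [Finset.sum_apply]

theorem sum_sub_smul_loopInt {J : Type*} [Fintype J] (c : ℂ) (X : J → J → J → J → Module.End ℂ V)
    (h : J → J → J → J → Fin N → MvPolynomial (Fin N) ℂ) {H : Fin N → MvPolynomial (Fin N) ℂ}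
    (hH : ∀ ρ, ∑ a, ∑ b, ∑ a', ∑ b', h a b a' b' ρ = H ρ) :
    ∑ a, ∑ b, ∑ a', ∑ b', (X a b a' b' - c • S.loopInt (h a b a' b')) =
      (∑ a, ∑ b, ∑ a', ∑ b', X a b a' b') -
        c • S.loopInt H := by
  simp only [Finset.sum_sub_distrib, sum_smul_loopInt, hH]

theorem lie_vec_curTen (i : Fin (r + 1)) (ξ η : VecField N) :
    ⁅S.trajL ξ, S.curTen i η⁆ + ⁅S.curVec i ξ, S.curTen i η⁆ =
      (∑ κ, ∑ ν, S.curFn i (∑ μ, ξ μ * MvPolynomial.pderiv μ (MvPolynomial.pderiv ν (η κ)))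
        (uT 𝔤 ν κ)) -
      (1 / (2 * Real.pi * Complex.I) : ℂ) • S.loopInt fun ρ =>
        ((P i).k₃ * ((N + (p - (i : ℕ))).choose (N + 1) : ℂ)) • divForm ξ η ρ := by
  simp only [curTen, trajL, ring_lie_sum, ← Finset.sum_add_distrib, lie_vec_curFn, S.k_T,
    Finset.sum_sub_distrib, sum_smul_loopInt, sum_ite_mul_smul]
  refine congrArg₂ _ rfl (congrArg (fun h => _ • S.loopInt h) (funext fun ρ => ?_))
  refine congrArg _ ?_
  rw [divForm, Finset.sum_comm]
  simp only [pderiv_comm _ ρ]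

/-- Keeping this order puts the derivative `∂_ρ` in the cocycle on `ξ`. Both mixed brackets then
yield literally the same form, without integration by parts; hence the factor `2` with `k₃`. -/
theorem lie_curTen_vec (i : Fin (r + 1)) (ξ η : VecField N) :
    -⁅S.trajL η, S.curTen i ξ⁆ + ⁅S.curTen i ξ, S.curVec i η⁆ =
      -(∑ κ, ∑ ν, S.curFn i (∑ μ, η μ * MvPolynomial.pderiv μ (MvPolynomial.pderiv ν (ξ κ)))
        (uT 𝔤 ν κ)) -
      (1 / (2 * Real.pi * Complex.I) : ℂ) • S.loopInt fun ρ =>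
        ((P i).k₃ * ((N + (p - (i : ℕ))).choose (N + 1) : ℂ)) • divForm ξ η ρ := by
  simp only [curTen, trajL, ring_lie_sum, ring_sum_lie, ← Finset.sum_neg_distrib,
    ← Finset.sum_add_distrib, lie_curFn_vec, S.k_T, Finset.sum_sub_distrib, sum_smul_loopInt,
    sum_ite_mul_smul]
  refine congrArg₂ _ rfl (congrArg (fun h => _ • S.loopInt h) (funext fun ρ => ?_))
  refine congrArg _ ?_
  rw [divForm]
  exact Finset.sum_congr rfl fun _ _ => Finset.sum_congr rfl fun _ _ => mul_comm _ _

/-- The `gl(N)` relations form the commutator of the Jacobians; the two invariant pairings of matrix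
units give the two diffeomorphism cocycles. -/
theorem lie_curTen_curTen (i : Fin (r + 1)) (ξ η : VecField N) :
    ⁅S.curTen i ξ, S.curTen i η⁆ =
      (∑ κ, ∑ ν, S.curFn i (∑ μ, (MvPolynomial.pderiv ν (ξ μ) * MvPolynomial.pderiv μ (η κ) -
        MvPolynomial.pderiv ν (η μ) * MvPolynomial.pderiv μ (ξ κ))) (uT 𝔤 ν κ)) -
      (1 / (2 * Real.pi * Complex.I) : ℂ) • S.loopInt fun ρ =>
        ((P i).k₁ * ((N + (p - (i : ℕ))).choose N : ℂ)) • mixedForm ξ η ρ +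
        ((P i).k₂ * ((N + (p - (i : ℕ))).choose N : ℂ)) • divForm ξ η ρ := by
  obtain ⟨G, hG⟩ : ∃ G : Fin N → Fin N → MvPolynomial (Fin N) ℂ →+ Module.End ℂ V,
      ∀ ν κ f, S.curFn i f (uT 𝔤 ν κ) = G ν κ f :=
    ⟨fun ν κ => ((S.curFn i).flip (uT 𝔤 ν κ)).toAddMonoidHom, fun _ _ _ => rfl⟩
  have h' : ∀ ν μ κ σ (f : MvPolynomial (Fin N) ℂ),
      S.curFn i f (uT 𝔤 ν μ * uT 𝔤 σ κ - uT 𝔤 σ κ * uT 𝔤 ν μ) =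
      (if σ = μ then G ν κ f else 0) - (if ν = κ then G σ μ f else 0) := by
    intro ν μ κ σ f
    rw [uT_mul_sub, map_sub, ← hG, ← hG]
    congr 1 <;> split_ifs <;> first | rfl | exact map_zero _
  rw [curTen, curTen, lie_sum_sum]
  simp only [lie_curFn_curFn, S.k_TT, h']
  simp only [hG]
  rw [← sum_single_contraction G (fun μ ν => MvPolynomial.pderiv ν (ξ μ))
    (fun κ σ => MvPolynomial.pderiv σ (η κ))]
  exact S.sum_sub_smul_loopInt _ _ _ fun ρ => sum_ite_add_ite_mul_smul _ _ _ _

theorem curTen_vecBracket (i : Fin (r + 1)) (ξ η : VecField N) :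
    S.curTen i (vecBracket ξ η) =
      (∑ κ, ∑ ν, S.curFn i (∑ μ, ξ μ * MvPolynomial.pderiv μ (MvPolynomial.pderiv ν (η κ)))
        (uT 𝔤 ν κ)) -
      (∑ κ, ∑ ν, S.curFn i (∑ μ, η μ * MvPolynomial.pderiv μ (MvPolynomial.pderiv ν (ξ κ)))
        (uT 𝔤 ν κ)) +
      ∑ κ, ∑ ν, S.curFn i (∑ μ, (MvPolynomial.pderiv ν (ξ μ) * MvPolynomial.pderiv μ (η κ) -
        MvPolynomial.pderiv ν (η μ) * MvPolynomial.pderiv μ (ξ κ))) (uT 𝔤 ν κ) := by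
  simp only [← Finset.sum_sub_distrib, ← Finset.sum_add_distrib, ← LinearMap.sub_apply,
    ← LinearMap.add_apply, ← map_sub, ← map_add]
  rw [curTen]
  refine Finset.sum_congr rfl fun κ _ => Finset.sum_congr rfl fun ν _ => ?_
  rw [pderiv_vecBracket]
  simp only [Finset.sum_sub_distrib, Finset.sum_add_distrib]

theorem combine_four {W : Type*} [AddCommGroup W]
    {x₁ x₂ x₃ y₁ y₂ z₁ z₂ w u₁ u₂ u₃ u₄ c₁ c₂ c₃ c₄ : W}
    (h₁ : x₁ - x₂ + x₃ = u₁ - c₁) (h₂ : y₁ + y₂ = u₂ - c₂) (h₃ : -z₁ + z₂ = -u₃ - c₃)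
    (h₄ : w = u₄ - c₄) :
    x₁ + y₁ - (x₂ + z₁) + (x₃ + z₂ + (y₂ + w)) =
      u₁ + (u₂ - u₃ + u₄) - (c₁ + c₂ + c₃ + c₄) := by
  calc _ = (x₁ - x₂ + x₃) + (y₁ + y₂) + (-z₁ + z₂) + w := by abel
    _ = _ := by rw [h₁, h₂, h₃, h₄]; abel

/-- The contribution of one system of currents to the commutator of two vector fields. -/
theorem lie_curL (i : Fin (r + 1)) (ξ η : VecField N) :
    ⁅S.trajL ξ, S.curL i η⁆ - ⁅S.trajL η, S.curL i ξ⁆ + ⁅S.curL i ξ, S.curL i η⁆ =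
      S.curL i (vecBracket ξ η) - (1 / (2 * Real.pi * Complex.I) : ℂ) • S.loopInt fun ρ =>
        ((P i).k₁ * ((N + (p - (i : ℕ))).choose N : ℂ) +
          (P i).k₄ * ((N + (p - (i : ℕ)) + 1).choose (N + 2) : ℂ)) • mixedForm ξ η ρ +
        ((P i).k₂ * ((N + (p - (i : ℕ))).choose N : ℂ) +
          2 * (P i).k₃ * ((N + (p - (i : ℕ))).choose (N + 1) : ℂ) +
          (P i).k₄ * ((N + (p - (i : ℕ))).choose (N + 2) : ℂ)) • divForm ξ η ρ := by
  have h1 := S.lie_curVec_curVec i ξ η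
  have h2 := S.lie_vec_curTen i ξ η
  have h3 := S.lie_curTen_vec i ξ η
  have h4 := S.lie_curTen_curTen i ξ η
  have h5 := S.curTen_vecBracket i ξ η
  change ⁅S.trajL ξ, _⁆ - ⁅S.trajL η, _⁆ + _ = _ at h1
  -- The cocycle is split by origin: vector-vector, the two equal mixed contributions, and
  -- tensor-tensor.
  have h6 : (fun ρ => ((P i).k₁ * ((N + (p - (i : ℕ))).choose N : ℂ) +
          (P i).k₄ * ((N + (p - (i : ℕ)) + 1).choose (N + 2) : ℂ)) • mixedForm ξ η ρ +
        ((P i).k₂ * ((N + (p - (i : ℕ))).choose N : ℂ) +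
          2 * (P i).k₃ * ((N + (p - (i : ℕ))).choose (N + 1) : ℂ) +
          (P i).k₄ * ((N + (p - (i : ℕ))).choose (N + 2) : ℂ)) • divForm ξ η ρ) =
      (fun ρ => (S.k i 1 1 * 1) •
        (((N + (p - (i : ℕ)) + 1).choose (N + 2) : ℂ) • ∑ μ, ∑ ν,
          MvPolynomial.pderiv ν (MvPolynomial.pderiv ρ (ξ μ)) * MvPolynomial.pderiv μ (η ν) +
        ((N + (p - (i : ℕ))).choose (N + 2) : ℂ) • ∑ μ, ∑ ν,
          MvPolynomial.pderiv μ (MvPolynomial.pderiv ρ (ξ μ)) * MvPolynomial.pderiv ν (η ν))) +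
      (fun ρ => ((P i).k₃ * ((N + (p - (i : ℕ))).choose (N + 1) : ℂ)) • divForm ξ η ρ) +
      (fun ρ => ((P i).k₃ * ((N + (p - (i : ℕ))).choose (N + 1) : ℂ)) • divForm ξ η ρ) +
      (fun ρ => ((P i).k₁ * ((N + (p - (i : ℕ))).choose N : ℂ)) • mixedForm ξ η ρ +
        ((P i).k₂ * ((N + (p - (i : ℕ))).choose N : ℂ)) • divForm ξ η ρ) := by
    funext ρ
    simp only [Pi.add_apply, S.k_one, mul_one, pderiv_comm _ ρ, ← mixedForm.eq_1, ← divForm.eq_1]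
    module
  rw [h6, map_add, map_add, map_add, curL, curL, curL, h5, smul_add, smul_add, smul_add]
  simp only [ring_lie_add, ring_add_lie]
  exact combine_four h1 h2 h3 h4

end CurrentSystem

theorem sum_comm_four {A B C D M : Type*} [AddCommMonoid M] (s : Finset A) (t : Finset B)
    (u : Finset C) (v : Finset D) (f : A → B → C → D → M) :
    ∑ a ∈ s, ∑ b ∈ t, ∑ c ∈ u, ∑ d ∈ v, f a b c d =
      ∑ c ∈ u, ∑ d ∈ v, ∑ a ∈ s, ∑ b ∈ t, f a b c d := by
  calc _ = ∑ a ∈ s, ∑ c ∈ u, ∑ d ∈ v, ∑ b ∈ t, f a b c d :=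
        Finset.sum_congr rfl fun a _ => Finset.sum_comm.trans
          (Finset.sum_congr rfl fun c _ => Finset.sum_comm)
    _ = _ := Finset.sum_comm.trans (Finset.sum_congr rfl fun c _ => Finset.sum_comm)

theorem jets_subset {N q p : ℕ} (h : q ≤ p) : jets N q ⊆ jets N p := fun _ hm =>
  mem_jets.mpr ((mem_jets.mp hm).trans h)

theorem add_single_sub_single {N : ℕ} (n : Fin N → ℕ) (μ : Fin N) :
    n + Pi.single μ 1 - Pi.single μ 1 = n := by
  funext ν
  simp

theorem sub_single_add_single {N : ℕ} {s : Fin N → ℕ} {μ : Fin N} (h : s μ ≠ 0) :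
    s - Pi.single μ 1 + Pi.single μ 1 = s := by
  funext ν
  by_cases hν : ν = μ
  · subst hν
    simp
    omega
  · simp [hν]

/-- Reindexing by `s = n + μ`. Terms whose shifted index leaves the smaller truncation vanish by
hypothesis, and indices with `s μ = 0` are not of this form. -/
theorem sum_jets_add_single {N q p : ℕ} {W : Type*} [AddCommGroup W] (hqp : q ≤ p) (μ : Fin N)
    (F : (Fin N → ℕ) → W) (hF : ∀ s, s ∉ jets N q → F s = 0) :
    ∑ n ∈ jets N p, F (n + Pi.single μ 1) = ∑ s ∈ jets N q, if s μ = 0 then 0 else F s := by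
  rw [Finset.sum_ite, Finset.sum_const_zero, zero_add, ← Finset.sum_filter_of_ne
    (p := fun n => n + Pi.single μ 1 ∈ jets N q) (fun n _ h => by
      by_contra hn
      exact h (hF _ hn))]
  refine Finset.sum_nbij' (fun n => n + Pi.single μ 1) (fun s => s - Pi.single μ 1) ?_ ?_ ?_ ?_ ?_
  · intro n hn
    rw [Finset.mem_filter] at hn ⊢
    exact ⟨hn.2, by simp⟩
  · intro s hs
    rw [Finset.mem_filter] at hs ⊢
    rw [sub_single_add_single hs.2]
    refine ⟨mem_jets.mpr ((Finset.sum_le_sum fun ν _ => ?_).trans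
      ((mem_jets.mp hs.1).trans hqp)), hs.1⟩
    exact Nat.sub_le _ _
  · intro n _
    exact add_single_sub_single n μ
  · intro s hs
    exact sub_single_add_single (Finset.mem_filter.mp hs).2
  · intro n _
    rfl

section Fields

variable {V : Type*} [AddCommGroup V] [Module ℂ V]

/-- Multiplication by an exponential shifts the mode number of the second factor and leaves `k`,
hence the ordering, untouched. Thus `a` and `b` need not commute, as is required for momentum and
velocity. -/
theorem trig_normalProd (f : ℂ[T;T⁻¹]) (a b : RField V) :
    normalProd (trig V f) (normalProd a b) = normalProd a (normalProd (trig V f) b) := by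
  change normalProdL V (trigL V f) _ = normalProdL V a (normalProdL V (trigL V f) b)
  induction f using LaurentPolynomial.induction_on' with
  | add p q hp hq => simp only [map_add, LinearMap.add_apply, hp, hq]
  | C_mul_T n c =>
    rw [← LaurentPolynomial.smul_eq_C_mul]
    simp only [map_smul, LinearMap.smul_apply]
    refine congrArg _ (mode_ext fun k => ?_)
    change mode (normalProd (trig V _) _) k = mode (normalProd a (normalProd (trig V _) b)) k
    rw [mode_trig_T_normalProd]
    refine (hasLSum_normalProd a b (k - n)).unique ((hasLSum_normalProd a _ k).congr fun j => ?_)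
    unfold normalTerm
    rw [mode_trig_T_normalProd, sub_right_comm]

end Fields

namespace CurrentSystem

variable {ι 𝔤 : Type*} [LieRing 𝔤] [LieAlgebra ℂ 𝔤] {N r p : ℕ} {Jb : Module.Basis ι ℂ 𝔤}
  {B : LinearMap.BilinForm ℂ 𝔤} {l : 𝔤 →ₗ[ℂ] ℂ} {P : ℕ → CentralParams}
  {V : Type*} [AddCommGroup V] [Module ℂ V] (S : CurrentSystem N r p Jb B l P V)

/-! ### The generators as sums over the systems of currents -/

/-- `∫ f(q(t)) I^{mA}_n(t) dt` for arbitrary multi-indices. -/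
def jetInt (i : Fin (r + 1)) (A : UEnv N 𝔤) (m n : Fin N → ℕ) :
    MvPolynomial (Fin N) ℂ →ₗ[ℂ] Module.End ℂ V :=
  (fieldIntL V).comp (((normalProdL V).flip (S.cur i m n A)).comp (onTrajectoryL S.q))

theorem jetInt_apply (i : Fin (r + 1)) (A : UEnv N 𝔤) (m n : Fin N → ℕ)
    (f : MvPolynomial (Fin N) ℂ) :
    S.jetInt i A m n f = fieldInt (normalProd (onTrajectory S.q f) (S.cur i m n A)) := rfl

theorem jetInt_eq_zero (i : Fin (r + 1)) (A : UEnv N 𝔤) {m n : Fin N → ℕ}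
    (h : m ∉ jets N (p - i) ∨ n ∉ jets N (p - i)) : S.jetInt i A m n = 0 := by
  refine LinearMap.ext fun f => ?_
  rw [jetInt_apply, S.cur_zero i m n h, normalProd_eq, LinearMap.zero_apply, map_zero, fieldInt_eq,
    map_zero, LinearMap.zero_apply]

theorem sum_jetInt (A : UEnv N 𝔤) (m n : Fin N → ℕ) (f : MvPolynomial (Fin N) ℂ) :
    ∑ i, S.jetInt i A m n f = fieldInt (normalProd (onTrajectory S.q f) (S.I m n A)) := by
  rw [CurrentSystem.I, normalProd_eq, map_sum, fieldInt_eq, map_sum]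
  rfl

theorem curFn_eq (i : Fin (r + 1)) (f : MvPolynomial (Fin N) ℂ) (A : UEnv N 𝔤) :
    S.curFn i f A = ∑ m ∈ jets N p, ∑ n ∈ jets N p,
      (multiChoose m n : ℂ) • S.jetInt i A m n (multiDeriv (m - n) f) := by
  have hsub := jets_subset (N := N) (Nat.sub_le p i)
  rw [← Finset.sum_subset hsub, curFn_apply, curOp_apply]
  · refine Eq.trans ?_ (Finset.sum_coe_sort (jets N (p - i)) _)
    refine Finset.sum_congr rfl fun m _ => ?_
    rw [← Finset.sum_subset hsub]
    · refine Eq.trans ?_ (Finset.sum_coe_sort (jets N (p - i)) _)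
      refine Finset.sum_congr rfl fun n _ => ?_
      rw [← map_smul, jetJ_apply]
      rfl
    · intro n _ hn
      rw [S.jetInt_eq_zero i A (Or.inr hn), LinearMap.zero_apply, smul_zero]
  · intro m _ hm
    refine Finset.sum_eq_zero fun n _ => ?_
    rw [S.jetInt_eq_zero i A (Or.inl hm), LinearMap.zero_apply, smul_zero]

theorem sum_curFn (f : MvPolynomial (Fin N) ℂ) (A : UEnv N 𝔤) :
    ∑ i, S.curFn i f A = fieldInt (∑ m ∈ jets N p, ∑ n ∈ jets N p,
      (multiChoose m n : ℂ) •
        normalProd (onTrajectory S.q (multiDeriv (m - n) f)) (S.I m n A)) := by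
  simp only [curFn_eq]
  rw [Finset.sum_comm, fieldInt_eq, map_sum]
  refine Finset.sum_congr rfl fun m _ => ?_
  rw [Finset.sum_comm, map_sum]
  refine Finset.sum_congr rfl fun n _ => ?_
  rw [← Finset.smul_sum, sum_jetInt, map_smul]
  rfl

/-- Matches the jet matrix with the formula in the generator: the `P` term removes exactly the
summands with `n = m`, and currents beyond order `p - i` vanish. -/
theorem curVec_eq (i : Fin (r + 1)) (ξ : VecField N) :
    S.curVec i ξ = ∑ μ, (-(∑ m ∈ jets N p, S.jetInt i 1 m (m + Pi.single μ 1) (ξ μ)) +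
      ∑ m ∈ jets N p, ∑ n ∈ jets N p, (multiChoose m n : ℂ) •
        S.jetInt i 1 m (n + Pi.single μ 1) (multiDeriv (m - n) (ξ μ))) := by
  have hsub := jets_subset (N := N) (Nat.sub_le p i)
  have h1 : S.curVec i ξ = ∑ m ∈ jets N (p - i), ∑ s ∈ jets N (p - i), ∑ μ,
      if s μ = 0 ∨ s - Pi.single μ 1 = m then 0 else
        (multiChoose m (s - Pi.single μ 1) : ℂ) •
          S.jetInt i 1 m s (multiDeriv (m - (s - Pi.single μ 1)) (ξ μ)) := by
    rw [curVec_apply, curOp_apply]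
    refine Eq.trans ?_ (Finset.sum_coe_sort (jets N (p - i)) _)
    refine Finset.sum_congr rfl fun m _ => ?_
    refine Eq.trans ?_ (Finset.sum_coe_sort (jets N (p - i)) _)
    refine Finset.sum_congr rfl fun s _ => ?_
    rw [← jetInt_apply, jetV_apply, map_sum]
    refine Finset.sum_congr rfl fun μ _ => ?_
    rw [apply_ite (S.jetInt i 1 m s), map_zero, map_smul]
  simp only [← sub_eq_neg_add, ← Finset.sum_sub_distrib]
  conv_rhs => rw [Finset.sum_comm]
  rw [h1, ← Finset.sum_subset hsub]
  · refine Finset.sum_congr rfl fun m _ => ?_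
    rw [Finset.sum_comm]
    refine Finset.sum_congr rfl fun μ _ => ?_
    have h2 := sum_jets_add_single (Nat.sub_le p i) μ (fun s =>
      (multiChoose m (s - Pi.single μ 1) : ℂ) •
        S.jetInt i 1 m s (multiDeriv (m - (s - Pi.single μ 1)) (ξ μ))) fun s hs => by
        rw [S.jetInt_eq_zero i 1 (Or.inr hs), LinearMap.zero_apply, smul_zero]
    simp only [add_single_sub_single] at h2
    have h3 : S.jetInt i 1 m (m + Pi.single μ 1) (ξ μ) = ∑ s ∈ jets N (p - i),
        if s = m + Pi.single μ 1 then S.jetInt i 1 m s (ξ μ) else 0 := by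
      rw [Finset.sum_ite_eq']
      split_ifs with h
      · rfl
      · rw [S.jetInt_eq_zero i 1 (Or.inr h), LinearMap.zero_apply]
    rw [h2, h3, ← Finset.sum_sub_distrib]
    refine Finset.sum_congr rfl fun s _ => ?_
    by_cases hs : s μ = 0
    · rw [if_pos (Or.inl hs), if_pos hs, if_neg, sub_zero]
      rintro rfl
      simp at hs
    · rw [if_neg hs]
      by_cases hm : s - Pi.single μ 1 = m
      · rw [if_pos (Or.inr hm), if_pos (by rw [← hm, sub_single_add_single hs]), hm,
          multiChoose_self, tsub_self, multiDeriv_zero, Nat.cast_one, one_smul, sub_self]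
      · rw [if_neg (not_or.mpr ⟨hs, hm⟩), if_neg, sub_zero]
        rintro rfl
        exact hm (add_single_sub_single m μ)
  · intro m _ hm
    refine Finset.sum_eq_zero fun μ _ => ?_
    simp only [S.jetInt_eq_zero i 1 (Or.inl hm), LinearMap.zero_apply, smul_zero,
      Finset.sum_const_zero, sub_zero]

theorem genL_eq (ξ : VecField N) : S.genL ξ = S.trajL ξ + ∑ i, S.curL i ξ := by
  have h1 : S.genT ξ = ∑ i, S.curTen i ξ := by
    have h : ∀ μ ν : Fin N, ∑ i, S.curFn i (MvPolynomial.pderiv ν (ξ μ)) (uT 𝔤 ν μ) =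
        fieldIntL V (∑ m ∈ jets N p, ∑ n ∈ jets N p, (multiChoose m n : ℂ) •
          normalProd (onTrajectory S.q (multiDeriv (m - n + Pi.single ν 1) (ξ μ)))
            (S.T m n ν μ)) := by
      intro μ ν
      simp only [sum_curFn, multiDeriv_add_single, ← multiDeriv_pderiv]
      rfl
    simp only [curTen]
    rw [Finset.sum_comm]
    conv_rhs =>
      enter [2, μ]
      rw [Finset.sum_comm]
    simp only [h]
    simp only [← map_sum]
    rw [genT, fieldInt_eq]
    refine congrArg _ ?_
    simp only [Finset.smul_sum]
    exact sum_comm_four _ _ _ _ _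
  have h2 : ∑ i, S.curL i ξ = ∑ i, S.curVec i ξ + ∑ i, S.curTen i ξ := Finset.sum_add_distrib
  rw [genL, h1, h2, ← add_assoc]
  congr 1
  simp only [curVec_eq]
  rw [Finset.sum_comm (s := Finset.univ), trajL, trajOp, fieldInt_eq, fieldInt_eq, map_sum, map_sum,
    ← Finset.sum_add_distrib]
  refine Finset.sum_congr rfl fun μ _ => ?_
  rw [map_add, map_sub, Finset.sum_add_distrib, Finset.sum_neg_distrib, sub_eq_add_neg, add_assoc]
  congr 3
  · rw [Finset.sum_comm]
    simp only [sum_jetInt]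
    rw [bigP, normalProd_eq, map_sum, map_sum]
    rfl
  · rw [map_sum, Finset.sum_comm (s := Finset.univ (α := Fin (r + 1)))]
    refine Finset.sum_congr rfl fun m _ => ?_
    rw [map_sum, Finset.sum_comm (s := Finset.univ (α := Fin (r + 1)))]
    refine Finset.sum_congr rfl fun n _ => ?_
    rw [← Finset.smul_sum, sum_jetInt, map_smul]
    rfl

theorem genR_eq (f : ℂ[T;T⁻¹]) : S.genR f = S.reparOp f := by
  rw [genR, reparOp, smear_add, F, smear_sum]
  congr 1
  rw [smear_neg, smear_sum, trajOp, fieldInt_eq, map_sum, ← Finset.sum_neg_distrib]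
  refine Finset.sum_congr rfl fun μ _ => ?_
  rw [smear_eq, trig_normalProd, reparField, normalProd_eq _ (-_), map_neg, map_neg]
  rfl

/-- The action of gauge transformations on the `i`-th system of currents. -/
def curJ [Fintype ι] (i : Fin (r + 1)) (X : GaugeMap N ι) : Module.End ℂ V :=
  ∑ a, S.curFn i (X a) (uJ N (Jb a))

theorem genJ_eq [Fintype ι] (X : GaugeMap N ι) : S.genJ X = ∑ i, S.curJ i X := by
  simp only [curJ]
  rw [Finset.sum_comm]
  simp only [sum_curFn]
  rw [genJ, fieldInt_eq]
  simp only [fieldInt_eq, ← map_sum]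
  refine congrArg _ ?_
  rw [Finset.sum_comm (s := Finset.univ)]
  refine Finset.sum_congr rfl fun m _ => ?_
  rw [Finset.sum_comm (s := Finset.univ)]
  simp only [Finset.smul_sum]
  rfl

end CurrentSystem

/-! ### Sums of binomial coefficients -/

/-- Pascal's rule: an alternating binomial sum of order `r + 1` is one of order `r` of the first
differences. -/
theorem sum_altChoose_succ (r : ℕ) (g : ℕ → ℂ) :
    ∑ i ∈ Finset.range (r + 1 + 1), altChoose (r + 1) i * g i =
      ∑ i ∈ Finset.range (r + 1), altChoose r i * (g i - g (i + 1)) := by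
  have h1 : ∀ i, altChoose (r + 1) (i + 1) = altChoose r (i + 1) - altChoose r i := fun i => by
    unfold altChoose
    rw [Nat.choose_succ_succ]
    push_cast
    ring
  have h2 : ∑ i ∈ Finset.range (r + 1), altChoose r (i + 1) * g (i + 1) + altChoose r 0 * g 0 =
      ∑ i ∈ Finset.range (r + 1), altChoose r i * g i := by
    rw [← Finset.sum_range_succ' (fun i => altChoose r i * g i), Finset.sum_range_succ]
    simp [altChoose]
  rw [Finset.sum_range_succ']
  simp only [h1, mul_sub, sub_mul, Finset.sum_sub_distrib]
  rw [← h2]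
  simp [altChoose]
  ring

theorem choose_sub_choose {N p i : ℕ} (a : ℕ) (h : i < p) :
    ((N + (p - i)).choose (a + 1) : ℂ) - ((N + (p - (i + 1))).choose (a + 1) : ℂ) =
      ((N + (p - (i + 1))).choose a : ℂ) := by
  obtain ⟨k, rfl⟩ : ∃ k, p = i + 1 + k := ⟨p - (i + 1), by omega⟩
  rw [show N + (i + 1 + k - i) = N + k + 1 by omega,
    show N + (i + 1 + k - (i + 1)) = N + k by omega, Nat.choose_succ_succ]
  push_cast
  ring

/-- Each difference lowers the lower entry of the binomial by one, so `r` of them turn `N` into `N -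
r`. -/
theorem sum_altChoose_choose (N r p : ℕ) (h : r ≤ p) :
    ∑ i ∈ Finset.range (r + 1), altChoose r i * ((N + (p - i)).choose N : ℂ) =
      chargeBinom N r p := by
  induction r generalizing N with
  | zero => simp [altChoose, chargeBinom]
  | succ r ih =>
    rw [sum_altChoose_succ r fun i => ((N + (p - i)).choose N : ℂ)]
    cases N with
    -- For `N = 0` the binomials are all `1` and their first differences vanish.
    | zero => simp [chargeBinom]
    | succ N =>
      have h1 : ∀ i ∈ Finset.range (r + 1),
          altChoose r i * (((N + 1 + (p - i)).choose (N + 1) : ℂ) -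
            ((N + 1 + (p - (i + 1))).choose (N + 1) : ℂ)) =
          altChoose r i * ((N + (p - i)).choose N : ℂ) := fun i hi => by
        have hi' := Finset.mem_range.mp hi
        rw [choose_sub_choose N (by omega), show N + 1 + (p - (i + 1)) = N + (p - i) by omega]
      rw [Finset.sum_congr rfl h1, ih N (by omega)]
      unfold chargeBinom
      simp only [Nat.succ_le_succ_iff, Nat.add_sub_add_right]
      rw [show N + 1 + p - (r + 1) = N + p - r by omega]

/-- Summation by parts. -/
theorem sum_mul_eq_sum_partial_mul {r : ℕ} {u g h : ℕ → ℂ}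
    (hu : ∑ i ∈ Finset.range (r + 1), u i = 0) (hg : ∀ i < r, g i - g (i + 1) = h i) :
    ∑ i ∈ Finset.range (r + 1), u i * g i =
      ∑ i ∈ Finset.range (r + 1), (∑ j ∈ Finset.range (i + 1), u j) * h i := by
  have key : ∀ n ≤ r, ∑ i ∈ Finset.range (n + 1), u i * g i =
      (∑ j ∈ Finset.range (n + 1), u j) * g n +
        ∑ i ∈ Finset.range n, (∑ j ∈ Finset.range (i + 1), u j) * h i := by
    intro n
    induction n with
    | zero => simp
    | succ n ih =>
      intro hn
      rw [Finset.sum_range_succ, ih (by omega), Finset.sum_range_succ u (n + 1),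
        Finset.sum_range_succ (fun i => (∑ j ∈ Finset.range (i + 1), u j) * h i) n,
        ← hg n (by omega)]
      ring
  rw [key r le_rfl, hu, Finset.sum_range_succ _ r, hu]
  ring

/-- The shift in `h` makes the partial sums strict. The boundary value `h (r + 1)` is irrelevant,
being multiplied by the vanishing total sum. -/
theorem sum_mul_eq_sum_partial_mul' {r : ℕ} {u g h : ℕ → ℂ}
    (hu : ∑ i ∈ Finset.range (r + 1), u i = 0) (hg : ∀ i < r, g i - g (i + 1) = h (i + 1)) :
    ∑ i ∈ Finset.range (r + 1), u i * g i =
      ∑ i ∈ Finset.range (r + 1), (∑ j ∈ Finset.range i, u j) * h i := by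
  rw [sum_mul_eq_sum_partial_mul (h := fun i => h (i + 1)) hu hg, Finset.sum_range_succ, hu,
    Finset.sum_range_succ' _ r]
  simp

/-! ### The charges -/

section Charges

variable {r N p : ℕ} {P : ℕ → CentralParams}

theorem sum_eq_chargeBinom (hrp : r ≤ p) {u : ℕ → ℂ} {c : ℂ}
    (hu : ∀ i ≤ r, u i = altChoose r i * c) :
    ∑ i ∈ Finset.range (r + 1), u i * ((N + (p - i)).choose N : ℂ) = c * chargeBinom N r p := by
  rw [← sum_altChoose_choose N r p hrp, Finset.mul_sum]
  refine Finset.sum_congr rfl fun i hi => ?_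
  rw [hu i (Nat.lt_succ_iff.mp (Finset.mem_range.mp hi))]
  ring

/-- One summation by parts moves the weights of `C(·,N+1)` to `C(·,N)`, where they enter as strict
partial sums. -/
theorem sum_add_eq_chargeBinom (hrp : r ≤ p) {u w : ℕ → ℂ} {c : ℂ}
    (hw : ∑ i ∈ Finset.range (r + 1), w i = 0)
    (hu : ∀ i ≤ r, u i + ∑ j ∈ Finset.range i, w j = altChoose r i * c) :
    ∑ i ∈ Finset.range (r + 1), (u i * ((N + (p - i)).choose N : ℂ) +
      w i * ((N + (p - i)).choose (N + 1) : ℂ)) = c * chargeBinom N r p := by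
  rw [← sum_eq_chargeBinom hrp hu, Finset.sum_add_distrib,
    sum_mul_eq_sum_partial_mul' hw (g := fun i => ((N + (p - i)).choose (N + 1) : ℂ))
      (h := fun i => ((N + (p - i)).choose N : ℂ))
      (fun i hi => choose_sub_choose N (by omega)), ← Finset.sum_add_distrib]
  exact Finset.sum_congr rfl fun i _ => (add_mul _ _ _).symm

/-- Two summations by parts. Because `C(·+1,N+2)` has upper entry one larger, the first produces
inclusive partial sums of `k₄`, the second strict sums of these. -/
theorem charge_mixed (hP : FinitenessConditions r P) (hrp : r ≤ p) :
    ∑ i ∈ Finset.range (r + 1), ((P i).k₁ * ((N + (p - i)).choose N : ℂ) +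
      (P i).k₄ * ((N + (p - i) + 1).choose (N + 2) : ℂ)) = (P 0).k₁ * chargeBinom N r p := by
  -- The condition `k₄'` stops at `r - 1`; the last partial sum is the total, which is zero by `k₄`.
  have h1 : ∑ i ∈ Finset.range (r + 1), ∑ s ∈ Finset.range (i + 1), (P s).k₄ = 0 := by
    rw [Finset.sum_range_succ, hP.k₄, hP.k₄', add_zero]
  have h2 := sum_mul_eq_sum_partial_mul hP.k₄
    (g := fun i => ((N + (p - i) + 1).choose (N + 2) : ℂ))
    (h := fun i => ((N + (p - i)).choose (N + 1) : ℂ)) fun i hi => by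
      have h3 := choose_sub_choose (N := N + 1) (p := p) (i := i) (N + 1) (by omega)
      rw [show N + 1 + (p - i) = N + (p - i) + 1 by omega,
        show N + 1 + (p - (i + 1)) = N + (p - i) by omega] at h3
      rw [show N + (p - (i + 1)) + 1 = N + (p - i) by omega]
      exact h3
  rw [Finset.sum_add_distrib, h2, ← Finset.sum_add_distrib]
  exact sum_add_eq_chargeBinom hrp h1 hP.k₁

/-- Here the upper entry is not shifted, so the first summation by parts gives strict partial sums
of `k₄`; they join `2 k₃` before the second. -/
theorem charge_div (hP : FinitenessConditions r P) (hrp : r ≤ p) :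
    ∑ i ∈ Finset.range (r + 1), ((P i).k₂ * ((N + (p - i)).choose N : ℂ) +
      2 * (P i).k₃ * ((N + (p - i)).choose (N + 1) : ℂ) +
      (P i).k₄ * ((N + (p - i)).choose (N + 2) : ℂ)) = (P 0).k₂ * chargeBinom N r p := by
  rw [← sum_add_eq_chargeBinom hrp hP.k₃ hP.k₂, Finset.sum_add_distrib,
    sum_mul_eq_sum_partial_mul' hP.k₄ (g := fun i => ((N + (p - i)).choose (N + 2) : ℂ))
      (h := fun i => ((N + (p - i)).choose (N + 1) : ℂ))
      (fun i hi => choose_sub_choose (N + 1) (by omega)), ← Finset.sum_add_distrib]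
  refine Finset.sum_congr rfl fun i _ => ?_
  ring

theorem totalCharges_of_lt (h : N < r) :
    totalCharges N r p P = ⟨1, 0, 1, 2 * N, 0, 0, 0, 0⟩ := by
  simp [totalCharges, chargeBinom, Nat.not_le.mpr h]

theorem totalCharges_self :
    totalCharges r r p P = ⟨1 - (P 0).k₁, -(P 0).k₂, 1 + (P 0).d₁, 2 * r + (P 0).c,
      (P 0).k₅, (P 0).d₂, (P 0).k₇, (P 0).k₈⟩ := by
  simp [totalCharges, chargeBinom]

/-- Parameters that satisfy the finiteness conditions, with prescribed values at `i = 0`. -/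
def altParams (r : ℕ) (k₁ k₂ k₅ k₇ k₈ d₁ d₂ c : ℂ) (i : ℕ) : CentralParams where
  k₁ := altChoose r i * k₁
  k₂ := altChoose r i * k₂
  k₃ := 0
  k₄ := 0
  k₅ := altChoose r i * k₅
  k₆ := 0
  k₇ := altChoose r i * k₇
  k₈ := altChoose r i * k₈
  d₀ := 0
  d₁ := altChoose r i * d₁
  d₂ := altChoose r i * d₂
  c := altChoose r i * c

theorem finitenessConditions_altParams (r : ℕ) (k₁ k₂ k₅ k₇ k₈ d₁ d₂ c : ℂ) :
    FinitenessConditions r (altParams r k₁ k₂ k₅ k₇ k₈ d₁ d₂ c) := by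
  constructor <;> simp [altParams, altChoose]

theorem exists_totalCharges_eq (r : ℕ) (C : AbelianCharges) :
    ∃ P : ℕ → CentralParams, FinitenessConditions r P ∧ ∀ p, totalCharges r r p P = C := by
  refine ⟨altParams r (1 - C.c₁) (-C.c₂) C.c₅ C.c₇ C.c₈ (C.c₃ - 1) C.c₆ (C.c₄ - 2 * r),
    finitenessConditions_altParams _ _ _ _ _ _ _ _ _, fun p => ?_⟩
  rw [totalCharges_self]
  ext <;> simp [altParams, altChoose]

theorem tendsto_norm_add_mul_chargeBinom (h : r < N) (a : ℂ) {k : ℂ} (hk : k ≠ 0) :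
    Filter.Tendsto (fun p => ‖a + k * chargeBinom N r p‖) Filter.atTop Filter.atTop := by
  have h1 : Filter.Tendsto (fun p : ℕ => ‖k‖ * (p : ℝ) - ‖a‖) Filter.atTop Filter.atTop :=
    Filter.tendsto_atTop_add_const_right _ _
      (tendsto_natCast_atTop_atTop.const_mul_atTop (norm_pos_iff.mpr hk))
  refine Filter.tendsto_atTop_mono (fun p => ?_) h1
  -- A linear lower bound suffices; each increment of the binomial in `p` is a positive binomial
  -- coefficient.
  have h2 : p ≤ (N + p - r).choose (N - r) := by
    obtain ⟨m, rfl⟩ : ∃ m, N = r + m + 1 := ⟨N - r - 1, by omega⟩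
    rw [show r + m + 1 + p - r = m + 1 + p by omega, show r + m + 1 - r = m + 1 by omega]
    clear h1
    induction p with
    | zero => exact Nat.zero_le _
    | succ p ih =>
      rw [← add_assoc, Nat.choose_succ_succ, Nat.succ_eq_add_one]
      have : 0 < (m + 1 + p).choose m := Nat.choose_pos (by omega)
      omega
  have h3 : ‖k‖ * (p : ℝ) ≤ ‖k * chargeBinom N r p‖ := by
    rw [norm_mul, chargeBinom, if_pos h.le, Complex.norm_natCast]
    exact mul_le_mul_of_nonneg_left (Nat.cast_le.mpr h2) (norm_nonneg k)
  have h4 := norm_sub_le (a + k * chargeBinom N r p) a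
  rw [add_sub_cancel_left] at h4
  linarith

theorem tendsto_norm_mul_chargeBinom (h : r < N) {k : ℂ} (hk : k ≠ 0) :
    Filter.Tendsto (fun p => ‖k * chargeBinom N r p‖) Filter.atTop Filter.atTop := by
  simpa using tendsto_norm_add_mul_chargeBinom h 0 hk

theorem tendsto_norm_totalCharges (h : r < N) :
    ((P 0).k₁ ≠ 0 → Filter.Tendsto
      (fun p => ‖(totalCharges N r p P).c₁‖) Filter.atTop Filter.atTop) ∧
    ((P 0).k₂ ≠ 0 → Filter.Tendsto
      (fun p => ‖(totalCharges N r p P).c₂‖) Filter.atTop Filter.atTop) ∧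
    ((P 0).d₁ ≠ 0 → Filter.Tendsto
      (fun p => ‖(totalCharges N r p P).c₃‖) Filter.atTop Filter.atTop) ∧
    ((P 0).c ≠ 0 → Filter.Tendsto
      (fun p => ‖(totalCharges N r p P).c₄‖) Filter.atTop Filter.atTop) ∧
    ((P 0).k₅ ≠ 0 → Filter.Tendsto
      (fun p => ‖(totalCharges N r p P).c₅‖) Filter.atTop Filter.atTop) ∧
    ((P 0).d₂ ≠ 0 → Filter.Tendsto
      (fun p => ‖(totalCharges N r p P).c₆‖) Filter.atTop Filter.atTop) ∧
    ((P 0).k₇ ≠ 0 → Filter.Tendsto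
      (fun p => ‖(totalCharges N r p P).c₇‖) Filter.atTop Filter.atTop) ∧
    ((P 0).k₈ ≠ 0 → Filter.Tendsto
      (fun p => ‖(totalCharges N r p P).c₈‖) Filter.atTop Filter.atTop) := by
  refine ⟨fun hk => ?_, fun hk => ?_, tendsto_norm_add_mul_chargeBinom h 1,
    tendsto_norm_add_mul_chargeBinom h _, tendsto_norm_mul_chargeBinom h,
    tendsto_norm_mul_chargeBinom h, tendsto_norm_mul_chargeBinom h,
    tendsto_norm_mul_chargeBinom h⟩
  · simpa [totalCharges, sub_eq_add_neg] using
      tendsto_norm_add_mul_chargeBinom h 1 (neg_ne_zero.mpr hk)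
  · simpa [totalCharges] using tendsto_norm_mul_chargeBinom h hk

end Charges

/-- `δ^a X_a ∂_ρ ∂_μ ξ^μ`. -/
def gaugeDivForm {N : ℕ} {ι 𝔤 : Type*} [Fintype ι] [LieRing 𝔤] [LieAlgebra ℂ 𝔤]
    (Jb : Module.Basis ι ℂ 𝔤) (l : 𝔤 →ₗ[ℂ] ℂ) (ξ : VecField N) (X : GaugeMap N ι) (ρ : Fin N) :
    MvPolynomial (Fin N) ℂ :=
  ∑ a, ∑ μ, l (Jb a) • (X a * MvPolynomial.pderiv ρ (MvPolynomial.pderiv μ (ξ μ)))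

/-! ### Gauge brackets and reparametrization brackets of the current parts -/

namespace CurrentSystem

variable {ι 𝔤 : Type*} [LieRing 𝔤] [LieAlgebra ℂ 𝔤] {N r p : ℕ}
  {Jb : Module.Basis ι ℂ 𝔤}
  {B : LinearMap.BilinForm ℂ 𝔤} {l : 𝔤 →ₗ[ℂ] ℂ} {P : ℕ → CentralParams}
  {V : Type*} [AddCommGroup V] [Module ℂ V] (S : CurrentSystem N r p Jb B l P V)

theorem lie_vec_curJ [Fintype ι] (i : Fin (r + 1)) (ξ : VecField N) (X : GaugeMap N ι) :
    ⁅S.trajL ξ, S.curJ i X⁆ + ⁅S.curVec i ξ, S.curJ i X⁆ = S.curJ i (vecAct ξ X) -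
      (1 / (2 * Real.pi * Complex.I) : ℂ) • S.loopInt fun ρ =>
        ((P i).k₆ * ((N + (p - (i : ℕ))).choose (N + 1) : ℂ)) • gaugeDivForm Jb l ξ X ρ := by
  simp only [curJ, trajL, ring_lie_sum, ← Finset.sum_add_distrib, lie_vec_curFn, S.k_J,
    Finset.sum_sub_distrib, sum_smul_loopInt]
  have h : ∀ ρ, ∑ a, ((P i).k₆ * l (Jb a) * ((N + (p - (i : ℕ))).choose (N + 1) : ℂ)) •
      ∑ μ, MvPolynomial.pderiv μ (MvPolynomial.pderiv ρ (ξ μ)) * X a =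
      ((P i).k₆ * ((N + (p - (i : ℕ))).choose (N + 1) : ℂ)) • gaugeDivForm Jb l ξ X ρ := by
    intro ρ
    simp only [gaugeDivForm, Finset.smul_sum, smul_smul]
    refine Finset.sum_congr rfl fun a _ => Finset.sum_congr rfl fun μ _ => ?_
    rw [pderiv_comm μ ρ, mul_comm (X a), mul_right_comm]
  simp only [h]
  rfl

/-- The two summands of `𝔤 ⊕ gl(N)` commute in the enveloping algebra, so only the pairing `k₇`
survives. -/
theorem lie_curTen_curJ [Fintype ι] (i : Fin (r + 1)) (ξ : VecField N) (X : GaugeMap N ι) :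
    ⁅S.curTen i ξ, S.curJ i X⁆ = -((1 / (2 * Real.pi * Complex.I) : ℂ) • S.loopInt fun ρ =>
        ((P i).k₇ * ((N + (p - (i : ℕ))).choose N : ℂ)) • gaugeDivForm Jb l ξ X ρ) := by
  simp only [curJ, curTen, ring_lie_sum, ring_sum_lie, lie_curFn_curFn, uT_mul_uJ_sub, map_zero,
    zero_sub, Finset.sum_neg_distrib, sum_smul_loopInt, S.k_TJ]
  have h : ∀ ρ, ∑ a, ∑ μ, ∑ ν, ((if ν = μ then (P i).k₇ * l (Jb a) else 0) *
      ((N + (p - (i : ℕ))).choose N : ℂ)) •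
        (MvPolynomial.pderiv ρ (MvPolynomial.pderiv ν (ξ μ)) * X a) =
      ((P i).k₇ * ((N + (p - (i : ℕ))).choose N : ℂ)) • gaugeDivForm Jb l ξ X ρ := by
    intro ρ
    simp only [gaugeDivForm, Finset.smul_sum, smul_smul, sum_ite_mul_smul]
    refine Finset.sum_congr rfl fun a _ => Finset.sum_congr rfl fun μ _ => ?_
    rw [mul_comm (X a), mul_right_comm]
  simp only [h]

/-- The contribution of one system of currents to the commutator of a vector field and a gauge
transformation. -/
theorem lie_curL_curJ [Fintype ι] (i : Fin (r + 1)) (ξ : VecField N) (X : GaugeMap N ι) :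
    ⁅S.trajL ξ, S.curJ i X⁆ + ⁅S.curL i ξ, S.curJ i X⁆ = S.curJ i (vecAct ξ X) -
      (1 / (2 * Real.pi * Complex.I) : ℂ) • S.loopInt fun ρ =>
        ((P i).k₇ * ((N + (p - (i : ℕ))).choose N : ℂ) +
          (P i).k₆ * ((N + (p - (i : ℕ))).choose (N + 1) : ℂ)) • gaugeDivForm Jb l ξ X ρ := by
  rw [curL, ring_add_lie, ← add_assoc, lie_vec_curJ, lie_curTen_curJ, ← sub_eq_add_neg, sub_sub,
    ← smul_add, ← map_add]
  refine congrArg (fun h => _ - _ • S.loopInt h) (funext fun ρ => ?_)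
  rw [Pi.add_apply, ← add_smul, add_comm]

theorem curJ_gaugeBracket [Fintype ι] (i : Fin (r + 1)) (X Y : GaugeMap N ι) :
    S.curJ i (gaugeBracket Jb X Y) = ∑ a, ∑ b, S.curFn i (X a * Y b) (uJ N ⁅Jb a, Jb b⁆) := by
  have h : ∀ a b, uJ N ⁅Jb a, Jb b⁆ = ∑ c, Jb.repr ⁅Jb a, Jb b⁆ c • uJ N (Jb c) := fun a b => by
    rw [← uJ_sum, Jb.sum_repr]
  simp only [curJ, gaugeBracket, h, map_sum, map_smul, LinearMap.sum_apply, LinearMap.smul_apply]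
  rw [Finset.sum_comm]
  refine Finset.sum_congr rfl fun a _ => Finset.sum_comm

/-- The contribution of one system of currents to the commutator of two gauge transformations. -/
theorem lie_curJ_curJ [Fintype ι] (i : Fin (r + 1)) (X Y : GaugeMap N ι) :
    ⁅S.curJ i X, S.curJ i Y⁆ = S.curJ i (gaugeBracket Jb X Y) -
      (1 / (2 * Real.pi * Complex.I) : ℂ) • S.loopInt fun ρ => ∑ a, ∑ b,
        (((P i).k₅ * B (Jb a) (Jb b) + (P i).k₈ * (l (Jb a) * l (Jb b))) *
          ((N + (p - (i : ℕ))).choose N : ℂ)) • (MvPolynomial.pderiv ρ (X a) * Y b) := by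
  rw [curJ_gaugeBracket]
  simp only [curJ, ring_lie_sum, ring_sum_lie, lie_curFn_curFn, uJ_mul_sub, S.k_JJ,
    Finset.sum_sub_distrib, sum_smul_loopInt]
  rw [Finset.sum_comm]
  refine congrArg (fun h => _ - _ • S.loopInt h) (funext fun ρ => ?_)
  exact Finset.sum_comm

/-- `∫ h(t) f(q(t)) dt`. -/
def trajSmear (h : ℂ[T;T⁻¹]) : MvPolynomial (Fin N) ℂ →ₗ[ℂ] Module.End ℂ V :=
  ((fieldIntL V).comp (normalProdL V (trig V h))).comp (onTrajectoryL S.q)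

theorem smear_onTrajectory (h : ℂ[T;T⁻¹]) (f : MvPolynomial (Fin N) ℂ) :
    smear h (onTrajectory S.q f) = S.trajSmear h f := smear_eq _ _

theorem lie_reparOp_curFn (f : ℂ[T;T⁻¹]) (i : Fin (r + 1)) (g : MvPolynomial (Fin N) ℂ)
    (A : UEnv N 𝔤) :
    ⁅S.reparOp f, S.curFn i g A⁆ =
      (S.d i A * ((N + (p - (i : ℕ))).choose N : ℂ)) • ((1 / (4 * Real.pi * Complex.I) : ℂ) •
        S.trajSmear (circDeriv (circDeriv f) - Complex.I • circDeriv f) g) := by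
  rw [curFn_apply, lie_reparOp_curOp, trace_jetJ, smear_onTrajectory, map_smul, smul_smul,
    smul_smul]
  congr 1
  ring

theorem lie_reparOp_curL (f : ℂ[T;T⁻¹]) (i : Fin (r + 1)) (ξ : VecField N) :
    ⁅S.reparOp f, S.curL i ξ⁆ =
      ((P i).d₁ * ((N + (p - (i : ℕ))).choose N : ℂ) +
          (P i).d₀ * ((N + (p - (i : ℕ))).choose (N + 1) : ℂ)) •
        ((1 / (4 * Real.pi * Complex.I) : ℂ) •
          S.trajSmear (circDeriv (circDeriv f) - Complex.I • circDeriv f)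
            (∑ μ, MvPolynomial.pderiv μ (ξ μ))) := by
  rw [curL, ring_lie_add, curVec_apply, lie_reparOp_curOp, trace_jetV, smear_onTrajectory, map_smul,
    S.d_one, curTen, add_smul, add_comm]
  congr 1
  · simp only [ring_lie_sum, lie_reparOp_curFn, S.d_T, sum_ite_mul_smul, map_sum, Finset.smul_sum]
  · rw [smul_smul, smul_smul]
    congr 1
    ring

theorem lie_reparOp_curJ [Fintype ι] (f : ℂ[T;T⁻¹]) (i : Fin (r + 1)) (X : GaugeMap N ι) :
    ⁅S.reparOp f, S.curJ i X⁆ = ((P i).d₂ * ((N + (p - (i : ℕ))).choose N : ℂ)) •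
        ((1 / (4 * Real.pi * Complex.I) : ℂ) •
          S.trajSmear (circDeriv (circDeriv f) - Complex.I • circDeriv f)
            (∑ a, l (Jb a) • X a)) := by
  simp only [curJ, ring_lie_sum, lie_reparOp_curFn, S.d_J, map_sum, map_smul, Finset.smul_sum,
    smul_smul]
  refine Finset.sum_congr rfl fun a _ => ?_
  congr 1
  ring

end CurrentSystem

/-! ### Assembly of the brackets over all systems of currents -/

namespace CurrentSystem

variable {ι 𝔤 : Type*} [LieRing 𝔤] [LieAlgebra ℂ 𝔤] {N r p : ℕ}
  {Jb : Module.Basis ι ℂ 𝔤}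
  {B : LinearMap.BilinForm ℂ 𝔤} {l : 𝔤 →ₗ[ℂ] ℂ} {P : ℕ → CentralParams}
  {V : Type*} [AddCommGroup V] [Module ℂ V] (S : CurrentSystem N r p Jb B l P V)

theorem lie_curL_of_ne {i j : Fin (r + 1)} (h : i ≠ j) (ξ η : VecField N) :
    ⁅S.curL i ξ, S.curL j η⁆ = 0 := by
  simp only [curL, curTen, curVec_apply, curFn_apply, ring_add_lie, ring_lie_add, ring_sum_lie,
    ring_lie_sum, S.lie_curOp_of_ne h, Finset.sum_const_zero, add_zero]

theorem lie_curL_curJ_of_ne [Fintype ι] {i j : Fin (r + 1)} (h : i ≠ j) (ξ : VecField N)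
    (X : GaugeMap N ι) : ⁅S.curL i ξ, S.curJ j X⁆ = 0 := by
  simp only [curL, curTen, curJ, curVec_apply, curFn_apply, ring_add_lie, ring_sum_lie,
    ring_lie_sum, S.lie_curOp_of_ne h, Finset.sum_const_zero, add_zero]

theorem lie_curJ_of_ne [Fintype ι] {i j : Fin (r + 1)} (h : i ≠ j) (X Y : GaugeMap N ι) :
    ⁅S.curJ i X, S.curJ j Y⁆ = 0 := by
  simp only [curJ, curFn_apply, ring_sum_lie, ring_lie_sum, S.lie_curOp_of_ne h,
    Finset.sum_const_zero]

theorem lie_trajL_trajL (ξ η : VecField N) :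
    ⁅S.trajL ξ, S.trajL η⁆ = S.trajL (vecBracket ξ η) +
      (1 / (2 * Real.pi * Complex.I) : ℂ) • S.loopInt (mixedForm ξ η) := by
  rw [trajL, trajL, lie_trajOp_onTrajectory S.isHeisenberg]
  refine congrArg (fun Z : Module.End ℂ V => trajOp S.mom _ + (_ : ℂ) • Z) ?_
  simp only [trajForm_eq, ← loopInt_apply, ← map_sum]
  refine congrArg _ (funext fun ρ => ?_)
  simp only [Finset.sum_apply]
  rfl

theorem lie_curOp_q (i : Fin (r + 1))
    (M : Matrix (jets N (p - i)) (jets N (p - i)) (MvPolynomial (Fin N) ℂ)) (A : UEnv N 𝔤)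
    (μ : Fin N) (n : ℤ) : ⁅S.curOp i M A, mode (S.q μ) n⁆ = 0 := by
  rw [← mode_adField, S.adField_curOp_of_fcomm M A (fun ν => S.isHeisenberg.qq ν μ)
    (fun _ _ _ => (S.fcomm_q_cur _ _ _ _ μ).symm), mode_zero]

theorem isLinearMap_genL : IsLinearMap ℂ S.genL where
  map_add ξ η := by
    simp only [genL_eq, trajL, trajOp, curL, curTen, Pi.add_apply, map_add, onTrajectory_eq,
      normalProd_eq, fieldInt_eq, LinearMap.add_apply, Finset.sum_add_distrib]
    abel
  map_smul c ξ := by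
    simp only [genL_eq, trajL, trajOp, curL, curTen, Pi.smul_apply, map_smul, onTrajectory_eq,
      normalProd_eq, fieldInt_eq, LinearMap.smul_apply, Derivation.map_smul, ← Finset.smul_sum,
      ← smul_add]

theorem isLinearMap_genJ [Fintype ι] : IsLinearMap ℂ S.genJ where
  map_add X Y := by
    simp only [genJ_eq, curJ, Pi.add_apply, map_add, LinearMap.add_apply, Finset.sum_add_distrib]
  map_smul c X := by
    simp only [genJ_eq, curJ, Pi.smul_apply, map_smul, LinearMap.smul_apply, ← Finset.smul_sum]

theorem isLinearMap_genR : IsLinearMap ℂ S.genR := by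
  have h : S.genR = ⇑(((fieldIntL V).comp ((normalProdL V).flip
      (-(∑ μ, normalProd (S.mom μ) (fieldDeriv (S.q μ))) + S.F))).comp (trigL V)) :=
    funext fun f => smear_eq _ _
  rw [h]
  exact LinearMap.isLinear _

theorem isRealization [Fintype ι] (hP : FinitenessConditions r P) (hrp : r ≤ p) :
    IsRealization Jb B l (totalCharges N r p P) S.q S.genL S.genJ S.genR where
  linear_L := S.isLinearMap_genL
  linear_J := S.isLinearMap_genJ
  linear_R := S.isLinearMap_genR
  LL ξ η := by
    have h1 : (fun ρ => ∑ μ, ∑ ν, ((totalCharges N r p P).c₁ •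
          (MvPolynomial.pderiv ρ (MvPolynomial.pderiv ν (ξ μ)) * MvPolynomial.pderiv μ (η ν)) +
        (totalCharges N r p P).c₂ •
          (MvPolynomial.pderiv ρ (MvPolynomial.pderiv μ (ξ μ)) * MvPolynomial.pderiv ν (η ν)))) =
        mixedForm ξ η - fun ρ => ∑ i : Fin (r + 1),
          (((P i).k₁ * ((N + (p - (i : ℕ))).choose N : ℂ) +
            (P i).k₄ * ((N + (p - (i : ℕ)) + 1).choose (N + 2) : ℂ)) • mixedForm ξ η ρ +
          ((P i).k₂ * ((N + (p - (i : ℕ))).choose N : ℂ) +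
            2 * (P i).k₃ * ((N + (p - (i : ℕ))).choose (N + 1) : ℂ) +
            (P i).k₄ * ((N + (p - (i : ℕ))).choose (N + 2) : ℂ)) • divForm ξ η ρ) := by
      funext ρ
      rw [Pi.sub_apply, Finset.sum_add_distrib, ← Finset.sum_smul, ← Finset.sum_smul,
        (Fin.sum_univ_eq_sum_range (fun i => ((P i).k₁ * ((N + (p - i)).choose N : ℂ) +
          (P i).k₄ * ((N + (p - i) + 1).choose (N + 2) : ℂ))) (r + 1)).trans (charge_mixed hP hrp),
        (Fin.sum_univ_eq_sum_range (fun i => ((P i).k₂ * ((N + (p - i)).choose N : ℂ) +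
          2 * (P i).k₃ * ((N + (p - i)).choose (N + 1) : ℂ) +
          (P i).k₄ * ((N + (p - i)).choose (N + 2) : ℂ))) (r + 1)).trans (charge_div hP hrp)]
      simp only [Finset.sum_add_distrib, ← Finset.smul_sum, ← mixedForm.eq_1, ← divForm.eq_1,
        totalCharges]
      module
    rw [fieldInt_sum_eq_loopInt, genL_eq, genL_eq, genL_eq,
      lie_add_sum _ _ _ _ fun i j h => S.lie_curL_of_ne h ξ η, lie_trajL_trajL, h1]
    simp only [lie_curL, Finset.sum_sub_distrib, sum_smul_loopInt]
    rw [map_sub, smul_sub]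
    abel
  LJ ξ X := by
    have h1 : (fun ρ => ∑ a, ∑ μ, l (Jb a) •
        (X a * MvPolynomial.pderiv ρ (MvPolynomial.pderiv μ (ξ μ)))) = gaugeDivForm Jb l ξ X := rfl
    -- Gauge transformations have no trajectory part; a zero is inserted so that the bracket formula
    -- for sums applies.
    rw [fieldInt_sum_eq_loopInt, h1, genL_eq, genJ_eq, genJ_eq, ← zero_add (∑ i, S.curJ i X),
      lie_add_sum _ _ _ _ fun i j h => S.lie_curL_curJ_of_ne h ξ X]
    simp only [ring_zero_lie, ring_lie_zero, sub_zero, zero_add, lie_curL_curJ,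
      Finset.sum_sub_distrib, sum_smul_loopInt]
    congr 1
    have h3 : (fun ρ => ∑ i : Fin (r + 1), ((P i).k₇ * ((N + (p - (i : ℕ))).choose N : ℂ) +
          (P i).k₆ * ((N + (p - (i : ℕ))).choose (N + 1) : ℂ)) • gaugeDivForm Jb l ξ X ρ) =
        ((P 0).k₇ * chargeBinom N r p) • gaugeDivForm Jb l ξ X := by
      funext ρ
      rw [← Finset.sum_smul, (Fin.sum_univ_eq_sum_range (fun i =>
        ((P i).k₇ * ((N + (p - i)).choose N : ℂ) +
          (P i).k₆ * ((N + (p - i)).choose (N + 1) : ℂ))) (r + 1)).trans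
        (sum_add_eq_chargeBinom hrp hP.k₆ hP.k₇), Pi.smul_apply]
    rw [h3, map_smul, smul_smul]
    congr 1
    simp only [totalCharges]
    ring
  JJ X Y := by
    have h1 : (fun ρ => ∑ a, ∑ b, ((totalCharges N r p P).c₅ * B (Jb a) (Jb b) +
        (totalCharges N r p P).c₈ * (l (Jb a) * l (Jb b))) •
          (MvPolynomial.pderiv ρ (X a) * Y b)) =
        fun ρ => ∑ i : Fin (r + 1), ∑ a, ∑ b,
          (((P i).k₅ * B (Jb a) (Jb b) + (P i).k₈ * (l (Jb a) * l (Jb b))) *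
          ((N + (p - (i : ℕ))).choose N : ℂ)) • (MvPolynomial.pderiv ρ (X a) * Y b) := by
      funext ρ
      conv_rhs => rw [Finset.sum_comm]
      refine Finset.sum_congr rfl fun a _ => ?_
      conv_rhs => rw [Finset.sum_comm]
      refine Finset.sum_congr rfl fun b _ => ?_
      rw [← Finset.sum_smul]
      congr 1
      have h5 := sum_eq_chargeBinom (N := N) hrp hP.k₅
      have h8 := sum_eq_chargeBinom (N := N) hrp hP.k₈
      rw [← Fin.sum_univ_eq_sum_range (fun i => (P i).k₅ * ((N + (p - i)).choose N : ℂ))] at h5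
      rw [← Fin.sum_univ_eq_sum_range (fun i => (P i).k₈ * ((N + (p - i)).choose N : ℂ))] at h8
      simp only [totalCharges]
      rw [← h5, ← h8, Finset.sum_mul, Finset.sum_mul, ← Finset.sum_add_distrib]
      refine Finset.sum_congr rfl fun i _ => ?_
      ring
    rw [fieldInt_sum_eq_loopInt, h1, genJ_eq, genJ_eq, genJ_eq, ← zero_add (∑ i, S.curJ i X),
      ← zero_add (∑ i, S.curJ i Y), lie_add_sum _ _ _ _ fun i j h => S.lie_curJ_of_ne h X Y]
    simp only [ring_zero_lie, sub_zero, zero_add, lie_curJ_curJ,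
      Finset.sum_sub_distrib, sum_smul_loopInt]
  RL f ξ := by
    rw [genR_eq, genL_eq, ring_lie_add, ring_lie_sum, trajL, lie_reparOp_trajOp,
      smear_onTrajectory]
    simp only [lie_reparOp_curL]
    rw [← Finset.sum_smul, (Fin.sum_univ_eq_sum_range (fun i =>
        ((P i).d₁ * ((N + (p - i)).choose N : ℂ) +
          (P i).d₀ * ((N + (p - i)).choose (N + 1) : ℂ))) (r + 1)).trans
        (sum_add_eq_chargeBinom hrp hP.d₀ hP.d₁), smul_smul, ← add_smul]
    congr 1
    simp only [totalCharges]
    ring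
  RJ f X := by
    rw [genR_eq, genJ_eq, ring_lie_sum, smear_onTrajectory]
    simp only [lie_reparOp_curJ]
    rw [← Finset.sum_smul, (Fin.sum_univ_eq_sum_range (fun i =>
        (P i).d₂ * ((N + (p - i)).choose N : ℂ)) (r + 1)).trans
        (sum_eq_chargeBinom hrp hP.d₂), smul_smul]
    congr 1
    simp only [totalCharges]
    ring
  RR f g := by
    rw [genR_eq, genR_eq, genR_eq, lie_reparOp, (Fin.sum_univ_eq_sum_range (fun i =>
      (P i).c * ((N + (p - i)).choose N : ℂ)) (r + 1)).trans (sum_eq_chargeBinom hrp hP.c)]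
    rfl
  Lq ξ μ n := by
    rw [genL_eq, ring_add_lie, ring_sum_lie, Finset.sum_eq_zero, add_zero, trajL, ← mode_adField,
      adField_trajOp_q S.isHeisenberg fun μ ν => (S.isHeisenberg.fcomm_q_onTrajectory ν _).symm]
    intro i _
    simp only [curL, curTen, curVec_apply, curFn_apply, ring_add_lie, ring_sum_lie, lie_curOp_q,
      Finset.sum_const_zero, add_zero]
  Rq f g μ := by
    rw [genR_eq, lie_reparOp_q]
  Jq X μ n := by
    simp only [genJ_eq, curJ, curFn_apply, ring_sum_lie, lie_curOp_q, Finset.sum_const_zero]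
  qq := S.q_q

end CurrentSystem

end DGRO

end

theorem theorem7p1 {ι 𝔤 : Type*} [Fintype ι] [LieRing 𝔤] [LieAlgebra ℂ 𝔤]
    (Jb : Module.Basis ι ℂ 𝔤) (B : LinearMap.BilinForm ℂ 𝔤)
    (hB_symm : ∀ x y : 𝔤, B x y = B y x) (hB_inv : ∀ x y z : 𝔤, B ⁅x, y⁆ z = B x ⁅y, z⁆)
    (l : 𝔤 →ₗ[ℂ] ℂ) (hl : ∀ x y : 𝔤, l ⁅x, y⁆ = 0)
    (N r : ℕ) (P : ℕ → DGRO.CentralParams) (hP : DGRO.FinitenessConditions r P) :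
    -- the direct sum realizes the algebra, with the stated charges
    (∀ p : ℕ, r ≤ p → ∀ (V : Type*) [AddCommGroup V] [Module ℂ V]
      (S : DGRO.CurrentSystem N r p Jb B l P V),
      DGRO.IsRealization Jb B l (DGRO.totalCharges N r p P) S.q S.genL S.genJ S.genR) ∧
    -- for `N < r` only the contribution of the trajectory remains
    (N < r → ∀ p : ℕ, r ≤ p →
      DGRO.totalCharges N r p P = ⟨1, 0, 1, 2 * N, 0, 0, 0, 0⟩) ∧
    -- for `N = r` the charges are independent of `p`
    (N = r → ∀ p : ℕ, r ≤ p →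
      DGRO.totalCharges N r p P = ⟨1 - (P 0).k₁, -(P 0).k₂, 1 + (P 0).d₁, 2 * N + (P 0).c,
        (P 0).k₅, (P 0).d₂, (P 0).k₇, (P 0).k₈⟩) ∧
    -- for `N = r` the charges are in general nonzero: the conditions leave them arbitrary
    (N = r → ∀ C : DGRO.AbelianCharges, ∃ P' : ℕ → DGRO.CentralParams,
      DGRO.FinitenessConditions r P' ∧
        ∀ p : ℕ, r ≤ p → DGRO.totalCharges N r p P' = C) ∧
    -- for `r < N` the charges diverge
    (r < N →
      ((P 0).k₁ ≠ 0 → Filter.Tendsto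
        (fun p => ‖(DGRO.totalCharges N r p P).c₁‖) Filter.atTop Filter.atTop) ∧
      ((P 0).k₂ ≠ 0 → Filter.Tendsto
        (fun p => ‖(DGRO.totalCharges N r p P).c₂‖) Filter.atTop Filter.atTop) ∧
      ((P 0).d₁ ≠ 0 → Filter.Tendsto
        (fun p => ‖(DGRO.totalCharges N r p P).c₃‖) Filter.atTop Filter.atTop) ∧
      ((P 0).c ≠ 0 → Filter.Tendsto
        (fun p => ‖(DGRO.totalCharges N r p P).c₄‖) Filter.atTop Filter.atTop) ∧
      ((P 0).k₅ ≠ 0 → Filter.Tendsto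
        (fun p => ‖(DGRO.totalCharges N r p P).c₅‖) Filter.atTop Filter.atTop) ∧
      ((P 0).d₂ ≠ 0 → Filter.Tendsto
        (fun p => ‖(DGRO.totalCharges N r p P).c₆‖) Filter.atTop Filter.atTop) ∧
      ((P 0).k₇ ≠ 0 → Filter.Tendsto
        (fun p => ‖(DGRO.totalCharges N r p P).c₇‖) Filter.atTop Filter.atTop) ∧
      ((P 0).k₈ ≠ 0 → Filter.Tendsto
        (fun p => ‖(DGRO.totalCharges N r p P).c₈‖) Filter.atTop Filter.atTop)) := by
  refine ⟨fun p hp V _ _ S => S.isRealization hP hp, fun h p _ => DGRO.totalCharges_of_lt h, ?_, ?_,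
    DGRO.tendsto_norm_totalCharges⟩
  · rintro rfl p _
    exact DGRO.totalCharges_self
  · rintro rfl C
    obtain ⟨P', hP', h⟩ := DGRO.exists_totalCharges_eq N C
    exact ⟨P', hP', fun p _ => h p⟩
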